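/- **Setting.** Let $\widehat{\mathcal S}\subset\{-1,0,1\}^2\setminus\{(0,0)\}$ be a step set that is symmetric ($(i,j)\in\widehat{\mathcal S}\Rightarrow(j,i)\in\widehat{\mathcal S}$), contains neither $(-1,1)$ nor $(1,-1)$, and is not contained in a closed half-plane bounded by a line through the origin (there are exactly eight such sets). Put $\mathcal S=\{(i-j,i):(i,j)\in\widehat{\mathcal S}\}$, let $t\in(0,1/|\mathcal S|)$, and let $$K(x,y)=xy\Big(t\sum_{(i,j)\in\mathcal S}x^iy^j-1\Big)=a(x)y^2+b(x)y+c(x)=\widetilde a(y)x^2+\widetilde b(y)x+\widetilde c(y),$$ $d=b^2-4ac$ and $\widetilde d=\widetilde b^2-4\widetilde a\widetilde c$. Let $x_1<x_2$ be the roots of $d$ in $(-1,1)$, let $y_1<y_2$ be the roots of $\widetilde d$ in $(-1,1)$, and let $y_3$ be the smallest root of $\widetilde d$ in $(1,\infty)$. For $k\in\{1,2\}$ put $Y(x_k)=-b(x_k)/(2a(x_k))$, with $Y(x_k)=\infty$ if $a(x_k)=0$. Let $$\mathcal L=\{y\in\mathbb C:K(x,y)=0\text{ for some }x\in[x_1,x_2]\},$$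 and let $\mathcal G_{\mathcal L}$ be the open domain delimited by $\mathcal L$ and avoiding $+\infty$, i.e. the set of points of $\mathbb C\setminus\mathcal L$ that are not in the connected component of $\mathbb C\setminus\mathcal L$ containing all large positive real numbers. Let $\sqrt{\widetilde d}$ be the square root of $\widetilde d$ that is analytic on $\mathbb C\setminus\{y\in\mathbb R:\widetilde d(y)\le0\}$ and positive on $(y_2,y_3)$. Let $\mathcal D$ be the open unit disc. **Theorem 3.5.** The function $\sqrt{\widetilde d}$ exists, and $\mathcal L$ is symmetric in the real axis, contained in the closure of $\mathcal G_{\mathcal L}$, and disjoint from $\{y\in\mathbb R:\widetilde d(y)\le0\}$; moreover $\sqrt{\widetilde d}$ has no zero on $\mathcal L$. (1) Let $g$ be any conformal mapping (analytic bijection) from $\mathcal G_{\mathcal L}$ onto $\mathcal D$ such that $g(\overline y)=\overline{g(y)}$. Then $g'$ does not vanish on $\mathcal G_{\mathcal L}$, the function $f=g/g'$ is analytic in $\mathcal G_{\mathcal L}$, it has a finite non-zero limit, denoted $f(y)$, at every $y\in\mathcal L$ from within $\mathcal G_{\mathcal L}$, and $$\frac{\sqrt{\widetilde d(\overline y)}}{\sqrt{\widetilde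 d(y)}}=\frac{f(\overline y)}{f(y)}\qquad\text{for all }y\in\mathcal L.$$ (2) Let $w$ be a conformal gluing function for $\mathcal G_{\mathcal L}$: $w$ is meromorphic in $\mathcal G_{\mathcal L}$, one-to-one on $\mathcal G_{\mathcal L}$ (as a map into the Riemann sphere), has a finite limit $w(y)$ at every $y\in\mathcal L$ from within $\mathcal G_{\mathcal L}$, and $w(y)=w(\overline y)$ for all $y\in\mathcal L$. Assume that $w$ is real-valued on $\mathcal L$, and that $w$ has finite limits $w(Y(x_1))$ and $w(Y(x_2))$ at $Y(x_1)$ and $Y(x_2)$ from within $\mathcal G_{\mathcal L}$ (at infinity if $Y(x_k)=\infty$). Then $w(Y(x_1))\ne w(Y(x_2))$. Let $h(z)=-z+\sqrt{z^2-1}$, where the square root is analytic on $\mathbb C\setminus[-1,1]$ and equivalent to $z$ at infinity, and let $h(\infty)=0$. Then $$g(y)=h\left(\frac{2}{w(Y(x_2))-w(Y(x_1))}\Big(w(y)-\frac{w(Y(x_1))+w(Y(x_2))}{2}\Big)\right)$$ is a conformal mapping from $\mathcal G_{\mathcal L}$ onto $\mathcal D$ with $g(\overline y)=\overline{g(y)}$,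 so that one can choose this $g$ in (1). -/

import Mathlib

open Set Filter Topology Polynomial

noncomputable section

namespace ThreeQuadrant

/-- The symmetric step sets of the paper: small non-zero steps, symmetric in the diagonal, without
the two anti-diagonal steps, and not degenerate, i.e. not contained in a closed half-plane whose
boundary line passes through the origin. Exactly eight step sets satisfy this. -/
structure IsAdmissible (H : Finset (ℤ × ℤ)) : Prop where
  small : ∀ s ∈ H, |s.1| ≤ 1 ∧ |s.2| ≤ 1
  ne_zero : ((0, 0) : ℤ × ℤ) ∉ H
  symm : ∀ i j : ℤ, (i, j) ∈ H → (j, i) ∈ H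
  no_antidiag : ((-1, 1) : ℤ × ℤ) ∉ H ∧ ((1, -1) : ℤ × ℤ) ∉ H
  nondegenerate : ∀ u v : ℝ, (u, v) ≠ (0, 0) → ∃ s ∈ H, u * (s.1 : ℝ) + v * (s.2 : ℝ) < 0

/-- The step set after the change of variable `(x, y) ↦ (x y, x⁻¹)`. -/
def transform (H : Finset (ℤ × ℤ)) : Finset (ℤ × ℤ) :=
  H.image fun s => (s.1 - s.2, s.1)

/-- The kernel `x y (t ∑ x^i y^j - 1)`, written as a polynomial; the steps `(i, j)` of `S` are
supposed to be small, so that the exponents `i + 1`, `j + 1` are non-negative. -/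
def kernel (S : Finset (ℤ × ℤ)) (t : ℝ) (x y : ℂ) : ℂ :=
  (t : ℂ) * ∑ s ∈ S, x ^ (s.1 + 1).toNat * y ^ (s.2 + 1).toNat - x * y

/-- The coefficient of `y ^ (k + 1)` in the kernel, a polynomial in `x`:
`a`, `b`, `c` for `k = 1, 0, -1`. -/
def coeffInX (S : Finset (ℤ × ℤ)) (t : ℝ) (k : ℤ) : ℝ[X] :=
  C t * (∑ s ∈ S with s.2 = k, X ^ (s.1 + 1).toNat) - if k = 0 then X else 0

/-- The coefficient of `x ^ (k + 1)` in the kernel, a polynomial in `y`: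
`ã`, `b̃`, `c̃` for `k = 1, 0, -1`. -/
def coeffInY (S : Finset (ℤ × ℤ)) (t : ℝ) (k : ℤ) : ℝ[X] :=
  C t * (∑ s ∈ S with s.1 = k, X ^ (s.2 + 1).toNat) - if k = 0 then X else 0

/-- The discriminant `d(x) = b(x)² - 4 a(x) c(x)`. -/
def discX (S : Finset (ℤ × ℤ)) (t : ℝ) : ℝ[X] :=
  coeffInX S t 0 ^ 2 - 4 * coeffInX S t 1 * coeffInX S t (-1)

/-- The discriminant `d̃(y) = b̃(y)² - 4 ã(y) c̃(y)`. -/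
def discY (S : Finset (ℤ × ℤ)) (t : ℝ) : ℝ[X] :=
  coeffInY S t 0 ^ 2 - 4 * coeffInY S t 1 * coeffInY S t (-1)

/-- The first branch point: the smallest root in `(-1, 1)`. -/
def branch₁ (p : ℝ[X]) : ℝ := sInf {x : ℝ | |x| < 1 ∧ p.IsRoot x}

/-- The second branch point: the largest root in `(-1, 1)`. -/
def branch₂ (p : ℝ[X]) : ℝ := sSup {x : ℝ | |x| < 1 ∧ p.IsRoot x}

/-- The third branch point: the smallest root in `(1, ∞)`. -/
def branch₃ (p : ℝ[X]) : ℝ := sInf {x : ℝ | 1 < x ∧ p.IsRoot x}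

/-- The curve `ℒ = {y : K(x, y) = 0 for some x ∈ [x₁, x₂]}` in the complex plane. -/
def curve (S : Finset (ℤ × ℤ)) (t : ℝ) : Set ℂ :=
  {y | ∃ x ∈ Icc (branch₁ (discX S t)) (branch₂ (discX S t)), kernel S t (x : ℂ) y = 0}

/-- The domain `𝒢` delimited by `ℒ` and avoiding `+∞`: the points off `ℒ` whose connected component
in the complement of `ℒ` does not contain all large positive real numbers. -/
def domain (S : Finset (ℤ × ℤ)) (t : ℝ) : Set ℂ :=
  {y | y ∉ curve S t ∧
    ¬ ∀ᶠ R : ℝ in atTop, (R : ℂ) ∈ connectedComponentIn (curve S t)ᶜ y}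

/-- The common value `Y(x) = -b(x) / (2 a(x))` of the two branches at a branch point `x`
with `a(x) ≠ 0`. When `a(x) = 0`, the point `Y(x)` is `∞`. -/
def branchValue (S : Finset (ℤ × ℤ)) (t : ℝ) (x : ℝ) : ℂ :=
  ((-(coeffInX S t 0).eval x / (2 * (coeffInX S t 1).eval x) : ℝ) : ℂ)

/-- The filter of neighbourhoods, inside `𝒢`, of the point `Y(x)` of the Riemann sphere,
for a branch point `x`. -/
def nhdsBranchValue (S : Finset (ℤ × ℤ)) (t : ℝ) (x : ℝ) : Filter ℂ :=
  if (coeffInX S t 1).eval x = 0 then cocompact ℂ ⊓ 𝓟 (domain S t)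
  else 𝓝[domain S t] (branchValue S t x)

/-- The cuts `[y₁, y₂] ∪ [y₃, y₄]`: the real points where `d̃ ≤ 0`. -/
def cuts (S : Finset (ℤ × ℤ)) (t : ℝ) : Set ℂ :=
  {z | ∃ y : ℝ, (discY S t).eval y ≤ 0 ∧ z = (y : ℂ)}

/-- `r` is the determination of `√d̃` that is analytic off the cuts and positive on `(y₂, y₃)`. -/
structure IsSqrtDiscY (S : Finset (ℤ × ℤ)) (t : ℝ) (r : ℂ → ℂ) : Prop where
  analytic : AnalyticOnNhd ℂ r (cuts S t)ᶜ
  sq_eq : ∀ y ∈ (cuts S t)ᶜ, r y ^ 2 = aeval y (discY S t)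
  pos : ∀ y : ℝ, branch₂ (discY S t) < y → y < branch₃ (discY S t) →
    0 < (r (y : ℂ)).re ∧ (r (y : ℂ)).im = 0

/-- `g` is a conformal mapping from `𝒢` onto the open unit disc, commuting with complex
conjugation. -/
structure IsSymmConformal (S : Finset (ℤ × ℤ)) (t : ℝ) (g : ℂ → ℂ) : Prop where
  analytic : AnalyticOnNhd ℂ g (domain S t)
  bijOn : BijOn g (domain S t) (Metric.ball 0 1)
  conj : ∀ y ∈ domain S t, g (starRingEnd ℂ y) = starRingEnd ℂ (g y)

/-- The poles of `w` in `𝒢`. -/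
def poles (S : Finset (ℤ × ℤ)) (t : ℝ) (w : ℂ → ℂ) : Set ℂ :=
  {y | y ∈ domain S t ∧ meromorphicOrderAt w y < 0}

/-- `w` is a conformal gluing function for `𝒢`. As a map into the Riemann sphere it takes the
value `∞` at its poles, so that injectivity means: at most one pole, and injectivity on the
complement of the poles. (The complex number `w y` at a pole `y` is irrelevant.) -/
structure IsConformalGluing (S : Finset (ℤ × ℤ)) (t : ℝ) (w : ℂ → ℂ) : Prop where
  meromorphic : MeromorphicOn w (domain S t)
  analytic : ∀ y ∈ domain S t \ poles S t w, AnalyticAt ℂ w y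
  poles_subsingleton : (poles S t w).Subsingleton
  injOn : InjOn w (domain S t \ poles S t w)
  glue : ∀ y ∈ curve S t, ∃ u : ℂ, Tendsto w (𝓝[domain S t] y) (𝓝 u) ∧
    Tendsto w (𝓝[domain S t] (starRingEnd ℂ y)) (𝓝 u)

/-- `h(z) = -z + √(z² - 1)`, where `√(z² - 1) = z √(1 - z⁻²)` is the determination that is analytic
off `[-1, 1]` and equivalent to `z` at infinity; thus `h(∞) = 0`. -/
def hMap (z : ℂ) : ℂ := -z + z * (1 - (z ^ 2)⁻¹) ^ (2⁻¹ : ℂ)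

open Classical in
/-- The function `g = h (2 / (W₂ - W₁) * (w - (W₁ + W₂) / 2))`, with value `h(∞) = 0` at the pole
of `w`. -/
def gluedMap (S : Finset (ℤ × ℤ)) (t : ℝ) (w : ℂ → ℂ) (W₁ W₂ : ℂ) (y : ℂ) : ℂ :=
  if y ∈ poles S t w then 0 else hMap (2 / (W₂ - W₁) * (w y - (W₁ + W₂) / 2))

end ThreeQuadrant

end

open ThreeQuadrant

/-! All eight step sets are treated at once: the kernel depends on four non-negative weights `A`,
`B`, `C`, `E`, with total mass below 1 and three non-degeneracy inequalities (`Weights`).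

Geometry. For x in [x₁, x₂] the discriminant d(x) is non-positive, so the two roots y are conjugate:
|y|² = c/a and 2 Re y = -b/a. As c/a is strictly decreasing (`cross_lt`), a circle around 0 meets
the curve in at most one conjugate pair, which belongs to a single x. On such a circle the points to
the left of the pair are inside and those to the right are outside. This describes the domain
explicitly as a connected open set (`domain_eq`).

Part (1). Every point y₀ of the curve has an analytic chart ψ that sends the real axis to the curve
and the upper side into the domain, with ψ'(0) a real multiple of i·K_x(x₀, y₀) (`exists_isChart`).
In this chart a conformal map g onto the disc has modulus tending to 1, so it extends by reflection
to a function Γ of modulus 1 on the real axis. Hence Γ'(0) = iτΓ(0) with τ real, and τ ≠ 0 by the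
boundary point lemma `deriv_ne_zero_of_norm_lt_one`. So g/g' tends to a non-zero real multiple of
K_x(x₀, y₀). On the other hand K_x² equals the discriminant in x wherever K = 0, so its square root
is ±K_x. Since both functions commute with conjugation, both ratios equal conj(K_x)/K_x. That K_x
does not vanish on the curve rests on `not_critical`: the two roots in x have product 1/y, so a
double root would mean x²y = 1, which convexity forbids.

Part (2). Schwarz reflection of w and the open mapping theorem show that the real boundary values
along the upper half of the curve have no extremum strictly between Y(x₁) and Y(x₂): a nearby value
that is not a boundary value would be attained in the domain both near y₀ and near its conjugate,
against injectivity. So the boundary values fill exactly the segment between the two end values,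
which differ, and w omits this segment inside the domain (`exists_segment`, `ne_boundaryValue`).
After rescaling to [-1, 1], h maps the complement of the segment injectively into the disc with |h|
→ 1 at the segment. The composite is injective and its modulus tends to 1 at the boundary, hence it
is onto (`surjOn_ball`). Its symmetry follows from the identity theorem. -/

noncomputable section
namespace ThreeQuadrant

/-! ### Holomorphic gluing across the real axis -/

/-- The open upper half of the ball of radius `δ`. -/
def upperBall (δ : ℝ) : Set ℂ := Metric.ball 0 δ ∩ {z | 0 < z.im}

/-- The open lower half of the ball of radius `δ`. -/
def lowerBall (δ : ℝ) : Set ℂ := Metric.ball 0 δ ∩ {z | z.im < 0}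

lemma isOpen_upperBall (δ : ℝ) : IsOpen (upperBall δ) :=
  Metric.isOpen_ball.inter (isOpen_lt continuous_const Complex.continuous_im)

lemma isOpen_lowerBall (δ : ℝ) : IsOpen (lowerBall δ) :=
  Metric.isOpen_ball.inter (isOpen_lt Complex.continuous_im continuous_const)

lemma convex_upperBall (δ : ℝ) : Convex ℝ (upperBall δ) :=
  (convex_ball 0 δ).inter (convex_halfSpace_im_gt 0)

lemma convex_lowerBall (δ : ℝ) : Convex ℝ (lowerBall δ) :=
  (convex_ball 0 δ).inter (convex_halfSpace_im_lt 0)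

lemma mem_closure_upperBall {δ : ℝ} {z : ℂ} (hz : ‖z‖ < δ) (h : 0 ≤ z.im) :
    z ∈ closure (upperBall δ) := by
  have ht : Tendsto (fun ε : ℝ => z + ε * Complex.I) (𝓝[>] 0) (𝓝 z) := by
    have : Continuous fun ε : ℝ => z + ε * Complex.I := by fun_prop
    simpa using (this.tendsto 0).mono_left nhdsWithin_le_nhds
  refine mem_closure_of_tendsto ht ?_
  have h1 := ht.eventually (Metric.isOpen_ball.mem_nhds (by simpa using hz : z ∈ Metric.ball 0 δ))
  filter_upwards [h1, self_mem_nhdsWithin] with ε h1 (h2 : 0 < ε)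
  exact ⟨h1, by simp; linarith⟩

lemma mem_closure_lowerBall {δ : ℝ} {z : ℂ} (hz : ‖z‖ < δ) (h : z.im ≤ 0) :
    z ∈ closure (lowerBall δ) := by
  have ht : Tendsto (fun ε : ℝ => z - ε * Complex.I) (𝓝[>] 0) (𝓝 z) := by
    have : Continuous fun ε : ℝ => z - ε * Complex.I := by fun_prop
    simpa using (this.tendsto 0).mono_left nhdsWithin_le_nhds
  refine mem_closure_of_tendsto ht ?_
  have h1 := ht.eventually (Metric.isOpen_ball.mem_nhds (by simpa using hz : z ∈ Metric.ball 0 δ))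
  filter_upwards [h1, self_mem_nhdsWithin] with ε h1 (h2 : 0 < ε)
  exact ⟨h1, by simp; linarith⟩

/-- A bounded holomorphic function on a convex open set has a primitive, which extends to a
Lipschitz function on the whole plane. -/
lemma exists_lipschitz_primitive {f : ℂ → ℂ} {U : Set ℂ} (hU : IsOpen U) (hc : Convex ℝ U)
    (hf : DifferentiableOn ℂ f U) {M : ℝ} (hM : ∀ z ∈ U, ‖f z‖ ≤ M) :
    ∃ (P : ℂ → ℂ) (C : NNReal), LipschitzWith C P ∧ ∀ z ∈ U, HasDerivAt P (f z) z := by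
  obtain ⟨g, hg⟩ := hc.exists_forall_hasDerivWithinAt hf
  have hL : LipschitzOnWith M.toNNReal g U := by
    refine hc.lipschitzOnWith_of_nnnorm_hasDerivWithin_le hg fun z hz => ?_
    rw [← NNReal.coe_le_coe]
    simpa using Or.inl (hM z hz)
  obtain ⟨P, hP, hPg⟩ := hL.extend_finite_dimension
  refine ⟨P, _, hP, fun z hz => ?_⟩
  refine ((hg z hz).hasDerivAt (hU.mem_nhds hz)).congr_of_eventuallyEq ?_
  filter_upwards [hU.mem_nhds hz] with y hy using (hPg hy).symm

/-- The hypotheses of the gluing lemma: two bounded holomorphic functions on the two halves of a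
ball, whose values at conjugate points become equal on the real axis. -/
structure Matching (f k : ℂ → ℂ) (δ M : ℝ) : Prop where
  diff_upper : DifferentiableOn ℂ f (upperBall δ)
  diff_lower : DifferentiableOn ℂ k (lowerBall δ)
  bound_upper : ∀ z ∈ upperBall δ, ‖f z‖ ≤ M
  bound_lower : ∀ z ∈ lowerBall δ, ‖k z‖ ≤ M
  agree : ∀ x : ℝ, |x| < δ →
    Tendsto (fun z => f z - k (starRingEnd ℂ z)) (𝓝[upperBall δ] (x : ℂ)) (𝓝 0)

/-- The increments of P and Q from 0 to x are approximated by integrals of f and k along the segment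
shifted by +iε and -iε. The integrands become equal as ε → 0, and the bound M permits dominated
convergence. -/
lemma Matching.primitive_sub_const {f k : ℂ → ℂ} {δ M : ℝ} (h : Matching f k δ M) {P Q : ℂ → ℂ}
    (hPc : Continuous P) (hQc : Continuous Q) (hP : ∀ z ∈ upperBall δ, HasDerivAt P (f z) z)
    (hQ : ∀ z ∈ lowerBall δ, HasDerivAt Q (k z) z) {x : ℝ} (hx : |x| < δ) :
    P x - Q x = P 0 - Q 0 := by
  have hmem : ∀ᶠ ε : ℝ in 𝓝[>] 0, ∀ s ∈ Icc (0 : ℝ) 1,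
      ((s * x : ℝ) + ε * Complex.I : ℂ) ∈ upperBall δ ∧
      ((s * x : ℝ) - ε * Complex.I : ℂ) ∈ lowerBall δ := by
    have h1 : ∀ᶠ ε : ℝ in 𝓝[>] 0, ε < δ - |x| :=
      nhdsWithin_le_nhds (Iio_mem_nhds (by linarith))
    filter_upwards [h1, self_mem_nhdsWithin] with ε h1 (h2 : 0 < ε) s hs
    have h3 : ‖((s * x : ℝ) : ℂ)‖ ≤ |x| := by
      rw [Complex.norm_real, Real.norm_eq_abs, abs_mul, abs_of_nonneg hs.1]
      exact mul_le_of_le_one_left (abs_nonneg x) hs.2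
    have h4 : ‖(ε * Complex.I : ℂ)‖ = ε := by simp [abs_of_pos h2]
    refine ⟨⟨?_, by simpa using h2⟩, ⟨?_, by simpa using h2⟩⟩
    · rw [mem_ball_zero_iff]
      linarith [norm_add_le ((s * x : ℝ) : ℂ) (ε * Complex.I)]
    · rw [mem_ball_zero_iff]
      linarith [norm_sub_le ((s * x : ℝ) : ℂ) (ε * Complex.I)]
  set D : ℝ → ℂ := fun ε => (P (x + ε * Complex.I) - Q (x - ε * Complex.I)) -
    (P (0 + ε * Complex.I) - Q (0 - ε * Complex.I)) with hD
  set J : ℝ → ℝ → ℂ := fun ε s => (f ((s * x : ℝ) + ε * Complex.I) -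
    k ((s * x : ℝ) - ε * Complex.I)) * x with hJ
  have hcont : ∀ᶠ ε : ℝ in 𝓝[>] 0, ContinuousOn (J ε) (uIcc 0 1) := by
    filter_upwards [hmem] with ε hε
    rw [uIcc_of_le zero_le_one]
    refine ((h.diff_upper.continuousOn.comp (by fun_prop) fun s hs => (hε s hs).1).sub
      (h.diff_lower.continuousOn.comp (by fun_prop) fun s hs => (hε s hs).2)).mul
      continuousOn_const
  have hDJ : ∀ᶠ ε : ℝ in 𝓝[>] 0, ∫ s in (0 : ℝ)..1, J ε s = D ε := by
    filter_upwards [hmem, hcont] with ε hε hc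
    have := intervalIntegral.integral_eq_sub_of_hasDerivAt
      (f := fun s : ℝ => P ((s * x : ℝ) + ε * Complex.I) - Q ((s * x : ℝ) - ε * Complex.I))
      (f' := J ε) (a := 0) (b := 1) (fun s hs => ?_) hc.intervalIntegrable
    · rw [this]; simp [hD]
    · rw [uIcc_of_le zero_le_one] at hs
      have e1 : HasDerivAt (fun s : ℝ => ((s * x : ℝ) : ℂ)) (x : ℂ) s := by
        simpa using ((hasDerivAt_id s).mul_const x).ofReal_comp
      have a1 := (hP _ (hε s hs).1).comp_of_eq s (e1.add_const (ε * Complex.I)) rfl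
      have a2 := (hQ _ (hε s hs).2).comp_of_eq s (e1.sub_const (ε * Complex.I)) rfl
      exact (a1.sub a2).congr_deriv (by simp only [hJ]; ring)
  have hlimJ : Tendsto (fun ε => ∫ s in (0 : ℝ)..1, J ε s) (𝓝[>] 0)
      (𝓝 (∫ s in (0 : ℝ)..1, (0 : ℂ))) := by
    refine intervalIntegral.tendsto_integral_filter_of_dominated_convergence
      (fun _ => (M + M) * |x|) ?_ ?_ (by simp) ?_
    · filter_upwards [hcont] with ε hc
      exact (hc.mono uIoc_subset_uIcc).aestronglyMeasurable measurableSet_uIoc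
    · filter_upwards [hmem] with ε hε
      refine Eventually.of_forall fun s hs => ?_
      rw [uIoc_of_le zero_le_one] at hs
      have hs' := hε s ⟨hs.1.le, hs.2⟩
      simp only [hJ, norm_mul, Complex.norm_real, Real.norm_eq_abs]
      gcongr
      exact (norm_sub_le _ _).trans
        (add_le_add (h.bound_upper _ hs'.1) (h.bound_lower _ hs'.2))
    · refine Eventually.of_forall fun s hs => ?_
      rw [uIoc_of_le zero_le_one] at hs
      have hsx : |s * x| < δ := by
        rw [abs_mul, abs_of_pos hs.1]
        exact (mul_le_of_le_one_left (abs_nonneg x) hs.2).trans_lt hx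
      have ht : Tendsto (fun ε : ℝ => ((s * x : ℝ) + ε * Complex.I : ℂ)) (𝓝[>] 0)
          (𝓝[upperBall δ] ((s * x : ℝ) : ℂ)) := by
        refine tendsto_nhdsWithin_iff.2 ⟨?_, ?_⟩
        · have : Continuous fun ε : ℝ => ((s * x : ℝ) + ε * Complex.I : ℂ) := by fun_prop
          simpa using (this.tendsto 0).mono_left nhdsWithin_le_nhds
        · filter_upwards [hmem] with ε hε using (hε s ⟨hs.1.le, hs.2⟩).1
      have := ((h.agree _ hsx).comp ht).mul_const (x : ℂ)
      rw [zero_mul] at this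
      refine this.congr fun ε => ?_
      simp only [hJ, Function.comp, map_add, map_mul, Complex.conj_ofReal, Complex.conj_I]
      congr 4
      ring
  have hlimD : Tendsto D (𝓝[>] 0) (𝓝 ((P x - Q x) - (P 0 - Q 0))) := by
    have : Continuous D := by fun_prop
    simpa [hD] using (this.tendsto 0).mono_left (nhdsWithin_le_nhds (s := Ioi 0))
  have := tendsto_nhds_unique (hlimJ.congr' hDJ) hlimD
  simp only [intervalIntegral.integral_zero] at this
  exact (sub_eq_zero.1 this.symm)

lemma Matching.exists_primitive {f k : ℂ → ℂ} {δ M : ℝ} (h : Matching f k δ M) :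
    ∃ Φ : ℂ → ℂ, Continuous Φ ∧ (∀ z ∈ upperBall δ, HasDerivAt Φ (f z) z) ∧
      (∀ z ∈ lowerBall δ, HasDerivAt Φ (k z) z) := by
  obtain ⟨P, C₁, hPL, hP⟩ := exists_lipschitz_primitive (isOpen_upperBall δ) (convex_upperBall δ)
    h.diff_upper h.bound_upper
  obtain ⟨Q, C₂, hQL, hQ⟩ := exists_lipschitz_primitive (isOpen_lowerBall δ) (convex_lowerBall δ)
    h.diff_lower h.bound_lower
  have hPc := hPL.continuous
  have hQc := hQL.continuous
  -- Above the axis the two Q terms cancel and P remains. Below it P - Q is evaluated at a real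
  -- point, where it is constant, so Q plus a constant remains. Continuity is then automatic.
  refine ⟨fun z => P (z.re + (max z.im 0 : ℝ) * Complex.I) +
    Q (z.re + (min z.im 0 : ℝ) * Complex.I) - Q z.re, by fun_prop, fun z hz => ?_, fun z hz => ?_⟩
  · refine (hP z hz).congr_of_eventuallyEq ?_
    filter_upwards [(isOpen_upperBall δ).mem_nhds hz] with y hy
    have h0 : 0 < y.im := hy.2
    simp [max_eq_left h0.le, min_eq_right h0.le]
  · refine ((hQ z hz).add_const (P 0 - Q 0)).congr_of_eventuallyEq ?_
    filter_upwards [(isOpen_lowerBall δ).mem_nhds hz] with y hy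
    have h0 : y.im < 0 := hy.2
    have hre : |y.re| < δ := (Complex.abs_re_le_norm y).trans_lt (by simpa using hy.1)
    rw [← h.primitive_sub_const hPc hQc hP hQ hre]
    simp [max_eq_right h0.le, min_eq_left h0.le]
    ring

/-- By the mean value inequality on a convex set, a derivative that extends continuously to the
closure is a derivative there too. The real Fréchet version is used and then made complex again. -/
lemma hasFDerivWithinAt_closure_of_hasDerivAt {Ψ Φ : ℂ → ℂ} {s : Set ℂ} (hs : IsOpen s)
    (hc : Convex ℝ s) (hΨ : Continuous Ψ) (hΦ : Continuous Φ)
    (h : ∀ z ∈ s, HasDerivAt Ψ (Φ z) z) (x : ℂ) :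
    HasDerivWithinAt Ψ (Φ x) (closure s) x := by
  have key : HasFDerivWithinAt Ψ
      ((ContinuousLinearMap.toSpanSingleton ℂ (Φ x)).restrictScalars ℝ) (closure s) x := by
    refine hasFDerivWithinAt_closure_of_tendsto_fderiv (s := s)
      (fun z hz => ((h z hz).differentiableAt.restrictScalars ℝ).differentiableWithinAt) hc hs
      (fun _ _ => hΨ.continuousWithinAt) ?_
    have hcont : Continuous fun z =>
        (ContinuousLinearMap.toSpanSingleton ℂ (Φ z)).restrictScalars ℝ := by
      have h1 : Continuous fun z => ContinuousLinearMap.toSpanSingleton ℂ (Φ z) :=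
        (ContinuousLinearMap.toSpanSingletonCLE (𝕜 := ℂ) (E := ℂ)).continuous.comp hΦ
      exact (ContinuousLinearMap.restrictScalarsL ℂ ℂ ℂ ℝ ℝ).continuous.comp h1
    refine ((hcont.tendsto x).mono_left nhdsWithin_le_nhds).congr' ?_
    filter_upwards [self_mem_nhdsWithin] with z hz
    exact ((h z hz).hasFDerivAt.restrictScalars ℝ).fderiv.symm
  rw [hasDerivWithinAt_iff_hasFDerivWithinAt]
  exact key.of_restrictScalars ℝ rfl

/-- Two bounded holomorphic functions on the two halves of a ball whose values at conjugate points
become equal on the real axis are restrictions of one holomorphic function. -/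
theorem Matching.exists_extension {f k : ℂ → ℂ} {δ M : ℝ} (h : Matching f k δ M) :
    ∃ F : ℂ → ℂ, DifferentiableOn ℂ F (Metric.ball 0 δ) ∧ EqOn F f (upperBall δ) ∧
      EqOn F k (lowerBall δ) := by
  obtain ⟨Φ, hΦc, hΦu, hΦl⟩ := h.exists_primitive
  obtain ⟨N, hN⟩ := (isCompact_closedBall (0 : ℂ) δ).exists_bound_of_continuousOn
    hΦc.continuousOn
  -- So far Φ is only continuous on the real axis. A second primitive Ψ has derivative Φ from both
  -- closed sides, hence is holomorphic on the ball; so Φ = Ψ' is holomorphic, and Φ' is the desired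
  -- extension.
  have hm : Matching Φ Φ δ N :=
    { diff_upper := fun z hz => (hΦu z hz).differentiableAt.differentiableWithinAt
      diff_lower := fun z hz => (hΦl z hz).differentiableAt.differentiableWithinAt
      bound_upper := fun z hz => hN z (Metric.ball_subset_closedBall hz.1)
      bound_lower := fun z hz => hN z (Metric.ball_subset_closedBall hz.1)
      agree := fun x _ => by
        have : Continuous fun z => Φ z - Φ (starRingEnd ℂ z) :=
          hΦc.sub (hΦc.comp Complex.continuous_conj)
        simpa using (this.tendsto (x : ℂ)).mono_left nhdsWithin_le_nhds }
  obtain ⟨Ψ, hΨc, hΨu, hΨl⟩ := hm.exists_primitive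
  have hΨ : ∀ z ∈ Metric.ball (0 : ℂ) δ, HasDerivAt Ψ (Φ z) z := by
    intro z hz
    have hu := hasFDerivWithinAt_closure_of_hasDerivAt (isOpen_upperBall δ) (convex_upperBall δ)
      hΨc hΦc hΨu z
    have hl := hasFDerivWithinAt_closure_of_hasDerivAt (isOpen_lowerBall δ) (convex_lowerBall δ)
      hΨc hΦc hΨl z
    refine (hu.union hl).hasDerivAt ?_
    filter_upwards [Metric.isOpen_ball.mem_nhds hz] with y hy
    rw [mem_ball_zero_iff] at hy
    rcases le_total 0 y.im with h0 | h0
    · exact Or.inl (mem_closure_upperBall hy h0)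
    · exact Or.inr (mem_closure_lowerBall hy h0)
  have hΨd : DifferentiableOn ℂ Ψ (Metric.ball 0 δ) :=
    fun z hz => (hΨ z hz).differentiableAt.differentiableWithinAt
  have hΦd : DifferentiableOn ℂ Φ (Metric.ball 0 δ) :=
    (hΨd.deriv Metric.isOpen_ball).congr fun z hz => (hΨ z hz).deriv.symm
  exact ⟨deriv Φ, hΦd.deriv Metric.isOpen_ball, fun z hz => (hΦu z hz).deriv,
    fun z hz => (hΦl z hz).deriv⟩

/-! ### Non-vanishing of derivatives, in the interior and at the boundary -/

/-- A non-constant analytic function with vanishing derivative at `z₀` has the form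
`f z₀ + (z - z₀) ^ n * h z` with `n ≥ 2` and `h z₀ ≠ 0`. -/
lemma exists_pow_mul_of_deriv_eq_zero {f : ℂ → ℂ} {z₀ : ℂ} (hf : AnalyticAt ℂ f z₀)
    (hd : deriv f z₀ = 0) (hne : ¬ ∀ᶠ z in 𝓝 z₀, f z = f z₀) :
    ∃ (n : ℕ) (h : ℂ → ℂ), 2 ≤ n ∧ AnalyticAt ℂ h z₀ ∧ h z₀ ≠ 0 ∧
      ∀ᶠ z in 𝓝 z₀, f z = f z₀ + (z - z₀) ^ n * h z := by
  have hg : AnalyticAt ℂ (fun z => f z - f z₀) z₀ := hf.sub analyticAt_const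
  obtain ⟨n, h, hh, hh0, heq⟩ := hg.exists_eventuallyEq_pow_smul_nonzero_iff.2
    (by simpa [sub_eq_zero] using hne)
  simp only [smul_eq_mul] at heq
  refine ⟨n, h, ?_, hh, hh0, heq.mono fun z hz => by rw [← hz]; ring⟩
  by_contra hlt
  have hn : n = 0 ∨ n = 1 := by omega
  rcases hn with rfl | rfl
  · have := heq.self_of_nhds
    simp [hh0.symm] at this
  · have h1 : HasDerivAt (fun z => (z - z₀) ^ 1 * h z) (h z₀) z₀ := by
      have := (((hasDerivAt_id z₀).sub_const z₀).pow 1).mul hh.differentiableAt.hasDerivAt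
      exact this.congr_deriv (by simp)
    have h2 : HasDerivAt (fun z => f z - f z₀) (h z₀) z₀ := h1.congr_of_eventuallyEq heq
    have h3 : HasDerivAt (fun z => f z - f z₀) 0 z₀ := by
      simpa [hd] using hf.differentiableAt.hasDerivAt.sub_const (f z₀)
    exact hh0 (h2.unique h3)

/-- The derivative of an injective analytic function does not vanish. -/
theorem deriv_ne_zero_of_injOn {f : ℂ → ℂ} {z₀ : ℂ} {V : Set ℂ} (hf : AnalyticAt ℂ f z₀)
    (hV : V ∈ 𝓝 z₀) (hinj : InjOn f V) : deriv f z₀ ≠ 0 := by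
  intro hd
  have hne : ¬ ∀ᶠ z in 𝓝 z₀, f z = f z₀ := by
    intro hc
    have h1 : ∀ᶠ z in 𝓝[≠] z₀, z = z₀ := by
      refine nhdsWithin_le_nhds ?_
      filter_upwards [hc, hV] with z h1 h2 using hinj h2 (mem_of_mem_nhds hV) h1
    obtain ⟨z, hz, hz'⟩ := (h1.and self_mem_nhdsWithin).exists
    exact hz' hz
  obtain ⟨n, h, hn, hh, hh0, heq⟩ := exists_pow_mul_of_deriv_eq_zero hf hd hne
  have hn0 : n ≠ 0 := by omega
  -- An n-th root p of f - f(z₀) is built as a local coordinate; dividing by h(z₀) keeps the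
  -- principal root analytic, since its argument is then near 1.
  set c : ℂ := h z₀ ^ ((n : ℂ)⁻¹) with hc
  have hcn : c ^ n = h z₀ := Complex.cpow_nat_inv_pow _ hn0
  have hc0 : c ≠ 0 := by
    rintro h0
    rw [h0, zero_pow hn0] at hcn
    exact hh0 hcn.symm
  set p : ℂ → ℂ := fun z => (z - z₀) * (c * (h z / h z₀) ^ ((n : ℂ)⁻¹)) with hp
  have hpan : AnalyticAt ℂ p z₀ := by
    refine (analyticAt_id.sub analyticAt_const).mul (analyticAt_const.mul
      ((hh.div analyticAt_const hh0).cpow analyticAt_const ?_))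
    simp [div_self hh0]
  have hpd : deriv p z₀ = c := by
    have h2 : AnalyticAt ℂ (fun z => c * (h z / h z₀) ^ ((n : ℂ)⁻¹)) z₀ :=
      analyticAt_const.mul ((hh.div analyticAt_const hh0).cpow analyticAt_const
        (by simp [div_self hh0]))
    have := ((hasDerivAt_id z₀).sub_const z₀).mul h2.differentiableAt.hasDerivAt
    exact this.deriv.trans (by simp [div_self hh0])
  have hpn : ∀ᶠ z in 𝓝 z₀, f z = f z₀ + p z ^ n := by
    filter_upwards [heq] with z hz
    rw [hz, hp]
    simp only [mul_pow]
    rw [Complex.cpow_nat_inv_pow _ hn0, Complex.cpow_nat_inv_pow _ hn0, mul_div_cancel₀ _ hh0]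
  have hmap : map p (𝓝 z₀) = 𝓝 (p z₀) := by
    have := hpan.hasStrictDerivAt
    rw [hpd] at this
    exact this.map_nhds_eq hc0
  have hp0 : p z₀ = 0 := by simp [hp]
  rw [hp0] at hmap
  have hW : p '' (V ∩ {z | f z = f z₀ + p z ^ n}) ∈ 𝓝 (0 : ℂ) := by
    rw [← hmap]
    exact image_mem_map (inter_mem hV hpn)
  have hprim := Complex.isPrimitiveRoot_exp n hn0
  set ω := Complex.exp (2 * Real.pi * Complex.I / n)
  have hω : Tendsto (fun η : ℂ => ω * η) (𝓝 0) (𝓝 0) := by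
    have : Continuous fun η : ℂ => ω * η := by fun_prop
    simpa using this.tendsto 0
  have hev : ∀ᶠ η in 𝓝[≠] (0 : ℂ), η ∈ p '' (V ∩ {z | f z = f z₀ + p z ^ n}) ∧
      ω * η ∈ p '' (V ∩ {z | f z = f z₀ + p z ^ n}) :=
    nhdsWithin_le_nhds ((eventually_mem_set.2 hW).and (hω.eventually (eventually_mem_set.2 hW)))
  -- The points u and v where p takes the values η and ωη, with ω a primitive n-th root of unity,
  -- have the same image under f.
  obtain ⟨η, ⟨⟨u, ⟨hu, hu'⟩, hue⟩, v, ⟨hv, hv'⟩, hve⟩, hη⟩ := (hev.and self_mem_nhdsWithin).exists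
  have : u = v := by
    refine hinj hu hv ?_
    simp only [mem_ofPred_eq] at hu' hv'
    rw [hu', hv', hue, hve, mul_pow, hprim.pow_eq_one, one_mul]
  rw [this, hve] at hue
  have h1 : ω = 1 := mul_right_cancel₀ hη (by simpa using hue)
  exact hprim.ne_one (by omega) h1

/-- The range 0 < φ < 2π is what is needed: dividing φ by an integer n ≥ 2 gives a direction
strictly inside the upper half-plane. -/
lemma exists_rotation_re_pos {q : ℂ} (hq : q ≠ 0) :
    ∃ φ : ℝ, 0 < φ ∧ φ < 2 * Real.pi ∧ 0 < (q * Complex.exp (φ * Complex.I)).re := by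
  have key : ∀ φ : ℝ, (q * Complex.exp (φ * Complex.I)).re = ‖q‖ * Real.cos (q.arg + φ) := by
    intro φ
    conv_lhs => rw [← Complex.norm_mul_exp_arg_mul_I q]
    rw [mul_assoc, ← Complex.exp_add, ← add_mul, ← Complex.ofReal_add, Complex.re_ofReal_mul,
      Complex.exp_ofReal_mul_I_re]
  have hq' : 0 < ‖q‖ := norm_pos_iff.2 hq
  have hpi := Real.pi_pos
  rcases lt_trichotomy q.arg 0 with h | h | h
  · refine ⟨-q.arg, by linarith, by linarith [Complex.neg_pi_lt_arg q], ?_⟩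
    rw [key]; simpa using hq
  · refine ⟨Real.pi / 3, by linarith, by linarith, ?_⟩
    rw [key, h, zero_add, Real.cos_pi_div_three]; linarith
  · refine ⟨2 * Real.pi - q.arg, by linarith [Complex.arg_le_pi q], by linarith, ?_⟩
    rw [key]; simpa using hq

/-- A boundary point lemma: an analytic function which maps the upper side of a real point into the
unit disc, and the point to the unit circle, has non-zero derivative there. -/
theorem deriv_ne_zero_of_norm_lt_one {G : ℂ → ℂ} (hG : AnalyticAt ℂ G 0) (h0 : ‖G 0‖ = 1)
    (hlt : ∀ᶠ z in 𝓝 (0 : ℂ), 0 < z.im → ‖G z‖ < 1) : deriv G 0 ≠ 0 := by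
  intro hd
  have hray : ∀ e : ℂ, Tendsto (fun r : ℝ => (r : ℂ) * e) (𝓝[>] 0) (𝓝 0) := by
    intro e
    have : Continuous fun r : ℝ => (r : ℂ) * e := by fun_prop
    simpa using (this.tendsto 0).mono_left (nhdsWithin_le_nhds (s := Ioi 0))
  have hne : ¬ ∀ᶠ z in 𝓝 (0 : ℂ), G z = G 0 := by
    intro hc
    obtain ⟨r, ⟨h1, h2⟩, h3⟩ := (((hray Complex.I).eventually (hlt.and hc)).and
      self_mem_nhdsWithin).exists
    have := h1 (by simpa using h3)
    rw [h2, h0] at this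
    exact lt_irrefl _ this
  obtain ⟨n, h, hn, hh, hh0, heq⟩ := exists_pow_mul_of_deriv_eq_zero hG hd hne
  have hG0 : G 0 ≠ 0 := norm_ne_zero_iff.1 (by rw [h0]; exact one_ne_zero)
  obtain ⟨φ, hφ0, hφ1, hφ⟩ := exists_rotation_re_pos
    (mul_ne_zero ((map_ne_zero (starRingEnd ℂ)).2 hG0) hh0)
  have hn0 : (0 : ℝ) < n := by exact_mod_cast (by omega : 0 < n)
  -- On the ray with direction e, the leading correction z^n h(z) has positive real part relative to
  -- G(0), so |G| exceeds 1 although the ray lies in the upper half-plane.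
  set e : ℂ := Complex.exp ((φ / n : ℝ) * Complex.I) with he
  have hen : e ^ n = Complex.exp (φ * Complex.I) := by
    rw [he, ← Complex.exp_nat_mul]
    congr 1
    have hnc : (n : ℂ) ≠ 0 := by exact_mod_cast hn0.ne'
    push_cast
    field_simp
  have heim : 0 < e.im := by
    rw [he, Complex.exp_ofReal_mul_I_im]
    refine Real.sin_pos_of_pos_of_lt_pi (by positivity) ?_
    rw [div_lt_iff₀ hn0]
    have : (2 : ℝ) ≤ n := by exact_mod_cast hn
    nlinarith [Real.pi_pos]
  have hcont : Tendsto (fun z => (starRingEnd ℂ (G 0) * h z * Complex.exp (φ * Complex.I)).re)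
      (𝓝 0) (𝓝 (starRingEnd ℂ (G 0) * h 0 * Complex.exp (φ * Complex.I)).re) := by
    have h1 : ContinuousAt
        (fun z => (starRingEnd ℂ (G 0) * h z * Complex.exp (φ * Complex.I)).re) 0 :=
      Complex.continuous_re.continuousAt.comp
        ((continuousAt_const.mul hh.continuousAt).mul continuousAt_const)
    exact h1
  have hpos := hcont.eventually (lt_mem_nhds hφ)
  obtain ⟨r, ⟨⟨h1, h2⟩, h3⟩, h4⟩ := (((hray e).eventually ((hlt.and heq).and hpos)).and
      self_mem_nhdsWithin).exists
  have h4' : 0 < r := h4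
  have hlt1 := h1 (by rw [Complex.im_ofReal_mul]; positivity)
  set z : ℂ := r * e
  set w : ℂ := (z - 0) ^ n * h z with hw
  have hre : 0 < (starRingEnd ℂ (G 0) * w).re := by
    have : starRingEnd ℂ (G 0) * w =
        ((r ^ n : ℝ) : ℂ) * (starRingEnd ℂ (G 0) * h z * Complex.exp (φ * Complex.I)) := by
      rw [hw, sub_zero, mul_pow, hen]; push_cast; ring
    rw [this, Complex.re_ofReal_mul]
    positivity
  have hsq : ‖G z‖ ^ 2 = 1 + 2 * (starRingEnd ℂ (G 0) * w).re + ‖w‖ ^ 2 := by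
    rw [h2, ← one_pow 2, ← h0, Complex.sq_norm, Complex.sq_norm, Complex.sq_norm,
      Complex.normSq_add]
    have : (G 0 * starRingEnd ℂ w).re = (starRingEnd ℂ (G 0) * w).re := by
      simp only [Complex.mul_re, Complex.conj_re, Complex.conj_im]; ring
    rw [this]; ring
  nlinarith [sq_nonneg ‖w‖, norm_nonneg (G z)]

/-! ### The map h, an inverse of the Joukowski map -/

/-- The segment `[-1, 1]` in the complex plane. -/
def unitSegment : Set ℂ := {z | ∃ x : ℝ, |x| ≤ 1 ∧ z = x}

lemma ne_zero_of_notMem_unitSegment {z : ℂ} (hz : z ∉ unitSegment) : z ≠ 0 := by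
  rintro rfl
  exact hz ⟨0, by simp, by simp⟩

/-- 1 - z⁻² is a non-positive real only when z² is real in (0, 1], that is, when z is in the
segment. -/
lemma mem_slitPlane_of_notMem_unitSegment {z : ℂ} (hz : z ∉ unitSegment) :
    1 - (z ^ 2)⁻¹ ∈ Complex.slitPlane := by
  have hz0 := ne_zero_of_notMem_unitSegment hz
  rw [Complex.mem_slitPlane_iff_not_le_zero]
  intro hle
  obtain ⟨hre, him⟩ := Complex.le_def.1 hle
  set q := (z ^ 2)⁻¹ with hq
  have hqim : q.im = 0 := by simpa using him
  have hqre : 1 ≤ q.re := by simpa using hre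
  have hqe : q = (q.re : ℂ) := Complex.ext rfl (by simpa using hqim)
  have hz2 : z ^ 2 = ((q.re)⁻¹ : ℝ) := by
    rw [Complex.ofReal_inv, ← hqe, hq, inv_inv]
  have hle1 : (q.re)⁻¹ ≤ 1 := inv_le_one_of_one_le₀ hqre
  have hpos : 0 < (q.re)⁻¹ := by positivity
  set s := Real.sqrt (q.re)⁻¹ with hs
  have hs2 : s ^ 2 = (q.re)⁻¹ := Real.sq_sqrt hpos.le
  have hs1 : |s| ≤ 1 := by rw [abs_of_nonneg (Real.sqrt_nonneg _)]; exact Real.sqrt_le_one.2 hle1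
  have : (z - s) * (z + s) = 0 := by
    have : (z - s) * (z + s) = z ^ 2 - ((s ^ 2 : ℝ) : ℂ) := by push_cast; ring
    rw [this, hs2, hz2, sub_self]
  rcases mul_eq_zero.1 this with h | h
  · exact hz ⟨s, hs1, sub_eq_zero.1 h⟩
  · exact hz ⟨-s, by rwa [abs_neg], by push_cast; exact eq_neg_of_add_eq_zero_left h⟩

/-- The second factor is the other root of k² + 2zk + 1 = 0, whose roots have product 1. -/
lemma hMap_mul_eq_one {z : ℂ} (hz : z ≠ 0) :
    hMap z * (-z - z * (1 - (z ^ 2)⁻¹) ^ (2⁻¹ : ℂ)) = 1 := by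
  have h1 : ((1 - (z ^ 2)⁻¹) ^ (2⁻¹ : ℂ)) ^ 2 = 1 - (z ^ 2)⁻¹ := by simp
  have : hMap z * (-z - z * (1 - (z ^ 2)⁻¹) ^ (2⁻¹ : ℂ)) =
      z ^ 2 * (1 - ((1 - (z ^ 2)⁻¹) ^ (2⁻¹ : ℂ)) ^ 2) := by
    rw [hMap]; ring
  rw [this, h1]
  field_simp
  ring

lemma hMap_ne_zero {z : ℂ} (hz : z ≠ 0) : hMap z ≠ 0 :=
  left_ne_zero_of_mul_eq_one (hMap_mul_eq_one hz)

lemma hMap_quadratic {z : ℂ} (hz : z ≠ 0) : hMap z ^ 2 + 1 = -(2 * z * hMap z) := by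
  have h1 := hMap_mul_eq_one hz
  have h2 : hMap z * (-z - z * (1 - (z ^ 2)⁻¹) ^ (2⁻¹ : ℂ)) = hMap z * (-2 * z - hMap z) := by
    rw [hMap]; ring
  rw [h2] at h1
  linear_combination -h1

/-- The quadratic equation recovers z from k = h(z) as -(k + 1/k)/2. -/
lemma hMap_injOn : InjOn hMap {z | z ≠ 0} := by
  intro z hz w hw h
  have h1 := hMap_quadratic hz
  have h2 := hMap_quadratic hw
  rw [← h] at h2
  have h3 := hMap_ne_zero hz
  have : (z - w) * hMap z = 0 := by linear_combination (h1 - h2) / 2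
  exact sub_eq_zero.1 ((mul_eq_zero.1 this).resolve_right h3)

/-- The principal root s has positive real part, so |1 - s| < |1 + s|. Thus h(z) is the smaller in
modulus of two numbers with product 1. -/
lemma norm_hMap_lt_one {z : ℂ} (hz : z ∉ unitSegment) : ‖hMap z‖ < 1 := by
  have hz0 := ne_zero_of_notMem_unitSegment hz
  set s := (1 - (z ^ 2)⁻¹) ^ (2⁻¹ : ℂ) with hs
  have hsp := mem_slitPlane_of_notMem_unitSegment hz
  have hsre : 0 < s.re := by
    have h0 := Complex.slitPlane_ne_zero hsp
    have harg := Complex.mem_slitPlane_iff_arg.1 hsp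
    rw [hs, Complex.cpow_def_of_ne_zero h0, Complex.exp_re]
    refine mul_pos (Real.exp_pos _) (Real.cos_pos_of_mem_Ioo ?_)
    have h2 : (Complex.log (1 - (z ^ 2)⁻¹) * (2⁻¹ : ℂ)).im = (1 - (z ^ 2)⁻¹).arg / 2 := by
      rw [show (2⁻¹ : ℂ) = ((2⁻¹ : ℝ) : ℂ) by push_cast; rfl, mul_comm, Complex.im_ofReal_mul,
        Complex.log_im]
      ring
    rw [h2]
    have h3 := Complex.neg_pi_lt_arg (1 - (z ^ 2)⁻¹)
    have h4 := lt_of_le_of_ne (Complex.arg_le_pi (1 - (z ^ 2)⁻¹)) harg.1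
    constructor <;> linarith
  have hprod := congrArg norm (hMap_mul_eq_one hz0)
  rw [norm_mul, norm_one] at hprod
  have hlt : ‖hMap z‖ < ‖-z - z * s‖ := by
    have e1 : hMap z = -(z * (1 - s)) := by rw [hMap, ← hs]; ring
    have e2 : -z - z * s = -(z * (1 + s)) := by ring
    rw [e1, e2, norm_neg, norm_neg, norm_mul, norm_mul]
    refine mul_lt_mul_of_pos_left ?_ (norm_pos_iff.2 hz0)
    refine lt_of_pow_lt_pow_left₀ 2 (norm_nonneg _) ?_
    rw [Complex.sq_norm, Complex.sq_norm, Complex.normSq_apply, Complex.normSq_apply]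
    simp
    nlinarith
  rw [← hs] at hprod
  by_contra! hge
  nlinarith [mul_nonneg (sub_nonneg.2 hge) (sub_nonneg.2 (hge.trans hlt.le))]

/-- The level sets of |h| are ellipses with foci ±1. This follows from (k ∓ 1)² = -2k(z ± 1) and the
parallelogram law, and gives both the behaviour at the segment and the decay at infinity. -/
lemma norm_hMap_add_inv {z : ℂ} (hz : z ≠ 0) :
    ‖hMap z‖ ^ 2 + 1 = ‖hMap z‖ * (‖z - 1‖ + ‖z + 1‖) := by
  have hq := hMap_quadratic hz
  set k := hMap z
  have h1 : 2 * (‖k‖ * ‖z + 1‖) = ‖k - 1‖ ^ 2 := by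
    rw [← norm_mul, ← norm_pow, ← norm_neg ((k - 1) ^ 2)]
    rw [show -(k - 1) ^ 2 = (2 : ℂ) * (k * (z + 1)) by linear_combination -hq, norm_mul]
    simp
  have h2 : 2 * (‖k‖ * ‖z - 1‖) = ‖k + 1‖ ^ 2 := by
    rw [← norm_mul, ← norm_pow, ← norm_neg ((k + 1) ^ 2)]
    rw [show -(k + 1) ^ 2 = (2 : ℂ) * (k * (z - 1)) by linear_combination -hq, norm_mul]
    simp
  have h3 : ‖k - 1‖ ^ 2 + ‖k + 1‖ ^ 2 = 2 * (‖k‖ ^ 2 + 1) := by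
    simp only [Complex.sq_norm, Complex.normSq_apply]
    simp
    ring
  linarith

lemma analyticAt_hMap {z : ℂ} (hz : z ∉ unitSegment) : AnalyticAt ℂ hMap z := by
  have hz0 := ne_zero_of_notMem_unitSegment hz
  refine analyticAt_id.neg.add (analyticAt_id.mul (AnalyticAt.cpow ?_ analyticAt_const
    (mem_slitPlane_of_notMem_unitSegment hz)))
  exact analyticAt_const.sub ((analyticAt_id.pow 2).inv (pow_ne_zero 2 hz0))

lemma hMap_conj {z : ℂ} (hz : z ∉ unitSegment) :
    hMap (starRingEnd ℂ z) = starRingEnd ℂ (hMap z) := by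
  have harg := (Complex.mem_slitPlane_iff_arg.1 (mem_slitPlane_of_notMem_unitSegment hz)).1
  have h := Complex.cpow_conj (1 - (z ^ 2)⁻¹) (2⁻¹ : ℂ) harg
  simp only [map_sub, map_one, map_inv₀, map_pow] at h
  rw [show starRingEnd ℂ (2 : ℂ) = 2 from Complex.conj_ofNat 2] at h
  simp only [hMap, map_add, map_neg, map_mul, h, Complex.conj_conj]

lemma one_sub_norm_hMap_sq_le {z : ℂ} (hz : z ∉ unitSegment) :
    (1 - ‖hMap z‖) ^ 2 ≤ ‖z - 1‖ + ‖z + 1‖ - 2 := by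
  have h1 := norm_hMap_add_inv (ne_zero_of_notMem_unitSegment hz)
  have h2 := norm_hMap_lt_one hz
  have h3 := norm_nonneg (hMap z)
  have h4 : 2 ≤ ‖z - 1‖ + ‖z + 1‖ := by
    have := norm_sub_le (z - 1) (z + 1)
    rw [show z - 1 - (z + 1) = -2 by ring] at this
    simpa using this
  nlinarith

lemma tendsto_norm_hMap {x : ℝ} (hx : |x| ≤ 1) :
    Tendsto (fun z => ‖hMap z‖) (𝓝[unitSegmentᶜ] (x : ℂ)) (𝓝 1) := by
  obtain ⟨hx1, hx2⟩ := abs_le.1 hx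
  have hN : Tendsto (fun z : ℂ => Real.sqrt (‖z - 1‖ + ‖z + 1‖ - 2)) (𝓝[unitSegmentᶜ] (x : ℂ))
      (𝓝 0) := by
    have hc : Continuous fun z : ℂ => Real.sqrt (‖z - 1‖ + ‖z + 1‖ - 2) := by fun_prop
    have h0 : Real.sqrt (‖(x : ℂ) - 1‖ + ‖(x : ℂ) + 1‖ - 2) = 0 := by
      have e1 : ‖(x : ℂ) - 1‖ = 1 - x := by
        rw [← Complex.ofReal_one, ← Complex.ofReal_sub, Complex.norm_real, Real.norm_eq_abs,
          abs_of_nonpos (by linarith)]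
        ring
      have e2 : ‖(x : ℂ) + 1‖ = 1 + x := by
        rw [← Complex.ofReal_one, ← Complex.ofReal_add, Complex.norm_real, Real.norm_eq_abs,
          abs_of_nonneg (by linarith)]
        ring
      rw [e1, e2]
      norm_num
    rw [← h0]
    exact (hc.tendsto _).mono_left nhdsWithin_le_nhds
  rw [tendsto_iff_norm_sub_tendsto_zero]
  refine squeeze_zero' (Eventually.of_forall fun _ => norm_nonneg _) ?_ hN
  filter_upwards [self_mem_nhdsWithin] with z hz
  rw [Real.norm_eq_abs, abs_sub_comm]
  exact Real.abs_le_sqrt (one_sub_norm_hMap_sq_le hz)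

lemma tendsto_hMap_cobounded : Tendsto hMap (Bornology.cobounded ℂ) (𝓝 0) := by
  have hlim : Tendsto (fun z : ℂ => ‖z‖⁻¹) (Bornology.cobounded ℂ) (𝓝 0) :=
    tendsto_inv_atTop_zero.comp tendsto_norm_cobounded_atTop
  refine squeeze_zero_norm' ?_ hlim
  have hev : ∀ᶠ z : ℂ in Bornology.cobounded ℂ, 2 ≤ ‖z‖ :=
    tendsto_norm_cobounded_atTop.eventually (eventually_ge_atTop 2)
  filter_upwards [hev] with z hz
  have hseg : z ∉ unitSegment := by
    rintro ⟨x, hx, rfl⟩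
    rw [Complex.norm_real, Real.norm_eq_abs] at hz
    linarith
  have h1 := norm_hMap_add_inv (ne_zero_of_notMem_unitSegment hseg)
  have h2 := norm_hMap_lt_one hseg
  have h3 : 2 * ‖z‖ ≤ ‖z - 1‖ + ‖z + 1‖ := by
    have := norm_add_le (z - 1) (z + 1)
    rw [show z - 1 + (z + 1) = 2 * z by ring, norm_mul] at this
    simpa using this
  rw [le_inv_comm₀ (norm_pos_iff.2 (hMap_ne_zero (ne_zero_of_notMem_unitSegment hseg)))
    (by linarith)]
  have h4 : 0 < ‖hMap z‖ := norm_pos_iff.2 (hMap_ne_zero (ne_zero_of_notMem_unitSegment hseg))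
  rw [← one_div, le_div_iff₀ h4]
  nlinarith [norm_nonneg (hMap z)]

/-! ### Weights of the kernel and the branch points in x -/

/-- The weights, already multiplied by `t`, of the steps: `A` for `(0, 1)`, `B` for `(0, -1)`,
`C` for `(1, 1)` and `(-1, 0)`, `E` for `(-1, -1)` and `(1, 0)`. -/
structure Weights where
  A : ℝ
  B : ℝ
  C : ℝ
  E : ℝ
  A_nonneg : 0 ≤ A
  B_nonneg : 0 ≤ B
  C_nonneg : 0 ≤ C
  E_nonneg : 0 ≤ E
  AC_pos : 0 < A + C
  BE_pos : 0 < B + E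
  CE_pos : 0 < C + E
  total_lt : A + B + 2 * C + 2 * E < 1

namespace Weights

variable (W : Weights)

/-- The coefficient of `y²` in the kernel. -/
def a (x : ℝ) : ℝ := W.A * x + W.C * x ^ 2
/-- The coefficient of `y` in the kernel. -/
def b (x : ℝ) : ℝ := W.C + W.E * x ^ 2 - x
/-- The constant coefficient, in `y`, of the kernel. -/
def c (x : ℝ) : ℝ := W.B * x + W.E
/-- The discriminant of the kernel with respect to `y`. -/
def d (x : ℝ) : ℝ := W.b x ^ 2 - 4 * W.a x * W.c x

lemma continuous_a : Continuous W.a := by unfold a; fun_prop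
lemma continuous_b : Continuous W.b := by unfold b; fun_prop
lemma continuous_c : Continuous W.c := by unfold c; fun_prop
lemma continuous_d : Continuous W.d := by unfold d a b c; fun_prop

variable {W}

lemma a_pos {x : ℝ} (hx : 0 < x) : 0 < W.a x := by
  have h : W.a x = x * (W.A + W.C * x) := by unfold a; ring
  have : 0 < W.A + W.C * x := by
    rcases W.A_nonneg.lt_or_eq with h | h
    · have := mul_nonneg W.C_nonneg hx.le; linarith
    · have : 0 < W.C := by have := W.AC_pos; linarith
      rw [← h]; positivity
  rw [h]; positivity

lemma a_nonneg {x : ℝ} (hx : 0 ≤ x) : 0 ≤ W.a x := by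
  have := W.A_nonneg; have := W.C_nonneg
  unfold a; positivity

lemma c_nonneg {x : ℝ} (hx : 0 ≤ x) : 0 ≤ W.c x := by
  have := W.B_nonneg; have := W.E_nonneg
  unfold c; positivity

lemma c_pos {x : ℝ} (hx : 0 < x) : 0 < W.c x := by
  unfold c
  rcases W.E_nonneg.lt_or_eq with h | h
  · have := mul_nonneg W.B_nonneg hx.le; linarith
  · have : 0 < W.B := by have := W.BE_pos; linarith
    rw [← h]; positivity

/-- The quotient `c / a` is strictly decreasing. -/
lemma cross_lt {x x' : ℝ} (hx : 0 ≤ x) (hc : 0 < W.c x) (hxx : x < x') :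
    W.a x * W.c x' < W.a x' * W.c x := by
  have hA := W.A_nonneg; have hB := W.B_nonneg; have hC := W.C_nonneg; have hE := W.E_nonneg
  have hx' : 0 < x' := hx.trans_lt hxx
  have key : W.a x' * W.c x - W.a x * W.c x' =
      (x' - x) * (W.B * W.C * x * x' + W.E * W.A + W.E * W.C * (x + x')) := by
    unfold a c; ring
  have hpos : 0 < W.B * W.C * x * x' + W.E * W.A + W.E * W.C * (x + x') := by
    rcases hE.lt_or_eq with hE' | hE'
    · have h1 : 0 < W.A + W.C * x' := by
        rcases hA.lt_or_eq with h | h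
        · have := mul_nonneg hC hx'.le; linarith
        · have : 0 < W.C := by have := W.AC_pos; linarith
          rw [← h]; positivity
      have h2 : 0 ≤ W.B * W.C * x * x' := by positivity
      have h3 : 0 ≤ W.E * W.C * x := by positivity
      have h4 := mul_pos hE' h1
      nlinarith
    · have h1 : 0 < W.C := by have := W.CE_pos; linarith
      have h2 : 0 < W.B := by have := W.BE_pos; linarith
      have h3 : 0 < x := by
        rcases hx.lt_or_eq with h | h
        · exact h
        · rw [← h] at hc; simp [c, ← hE'] at hc
      rw [← hE']
      simp only [zero_mul, add_zero]
      positivity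
  have := mul_pos (sub_pos.2 hxx) hpos
  linarith

/-- Weighted AM-GM: a monomial is convex in logarithmic coordinates, here along the chord from (1,
…, 1). -/
lemma rpow_le_affine {m l : ℝ} (hm : 0 < m) (h0 : 0 ≤ l) (h1 : l ≤ 1) :
    m ^ l ≤ (1 - l) + l * m := by
  have := Real.geom_mean_le_arith_mean2_weighted (sub_nonneg.2 h1) h0 zero_le_one hm.le
    (by ring : (1 - l) + l = 1)
  simpa using this

/-- The kernel at positive points has a logarithmic concavity property. -/
lemma b_neg_d_pos_of_le {x x' : ℝ} (hx : 0 < x) (hb : W.b x < 0) (hd : 0 ≤ W.d x) (hxx : x < x')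
    (hx' : x' ≤ 1) : W.b x' < 0 ∧ 0 < W.d x' := by
  have hA := W.A_nonneg; have hB := W.B_nonneg; have hC := W.C_nonneg; have hE := W.E_nonneg
  have ha := W.a_pos hx
  -- The minimum point of the quadratic in y, where K ≤ 0 because d(x) ≥ 0.
  set y := -W.b x / (2 * W.a x) with hy
  have hy0 : 0 < y := by rw [hy]; apply div_pos <;> linarith
  have hK : W.a x * y ^ 2 + W.b x * y + W.c x ≤ 0 := by
    have h1 : W.a x * y ^ 2 + W.b x * y + W.c x = -W.d x / (4 * W.a x) := by
      rw [hy, d]; field_simp; ring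
    rw [h1]
    apply div_nonpos_of_nonpos_of_nonneg <;> linarith
  have hlogx : Real.log x < 0 := Real.log_neg hx (hxx.trans_le hx')
  have hlogx' : Real.log x' ≤ 0 := Real.log_nonpos (hx.trans hxx).le hx'
  -- With this l, the point (x', v) = (x^l, y^l) lies on the logarithmic segment between (1, 1) and
  -- (x, y). The weighted Laurent polynomial is below 1 at (1, 1) by `total_lt` and at most 1 at (x,
  -- y), so by log-convexity it is below 1 at (x', v), which makes K(x', v) negative.
  set l := Real.log x' / Real.log x with hl
  have hl0 : 0 ≤ l := div_nonneg_of_nonpos hlogx' hlogx.le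
  have hl1 : l < 1 := by
    rw [hl, div_lt_one_of_neg hlogx]
    exact Real.log_lt_log hx hxx
  have hxl : x ^ l = x' := by
    rw [Real.rpow_def_of_pos hx, hl, mul_div_cancel₀ _ hlogx.ne, Real.exp_log (hx.trans hxx)]
  set v := y ^ l with hv
  have hv0 : 0 < v := Real.rpow_pos_of_pos hy0 l
  have hx'0 : 0 < x' := hx.trans hxx
  have m1 : v ≤ (1 - l) + l * y := rpow_le_affine hy0 hl0 hl1.le
  have m2 : v⁻¹ ≤ (1 - l) + l * y⁻¹ := by
    rw [hv, ← Real.inv_rpow hy0.le]; exact rpow_le_affine (by positivity) hl0 hl1.le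
  have m3 : x' * v ≤ (1 - l) + l * (x * y) := by
    rw [hv, ← hxl, ← Real.mul_rpow hx.le hy0.le]; exact rpow_le_affine (by positivity) hl0 hl1.le
  have m4 : x'⁻¹ ≤ (1 - l) + l * x⁻¹ := by
    rw [← hxl, ← Real.inv_rpow hx.le]; exact rpow_le_affine (by positivity) hl0 hl1.le
  have m5 : (x' * v)⁻¹ ≤ (1 - l) + l * (x * y)⁻¹ := by
    rw [hv, ← hxl, ← Real.mul_rpow hx.le hy0.le, ← Real.inv_rpow (by positivity)]
    exact rpow_le_affine (by positivity) hl0 hl1.le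
  have m6 : x' ≤ (1 - l) + l * x := by
    conv_lhs => rw [← hxl]
    exact rpow_le_affine (by positivity) hl0 hl1.le
  have hN : W.A * y + W.B * y⁻¹ + W.C * (x * y + x⁻¹) + W.E * ((x * y)⁻¹ + x) ≤ 1 := by
    have h1 : W.a x * y ^ 2 + W.b x * y + W.c x = (x * y) *
        (W.A * y + W.B * y⁻¹ + W.C * (x * y + x⁻¹) + W.E * ((x * y)⁻¹ + x) - 1) := by
      unfold a b c; field_simp; ring
    rw [h1] at hK
    have := nonpos_of_mul_nonpos_right hK (mul_pos hx hy0)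
    linarith
  have hN' : W.A * v + W.B * v⁻¹ + W.C * (x' * v + x'⁻¹) + W.E * ((x' * v)⁻¹ + x') < 1 := by
    have h1 := mul_le_mul_of_nonneg_left m1 hA
    have h2 := mul_le_mul_of_nonneg_left m2 hB
    have h3 := mul_le_mul_of_nonneg_left (add_le_add m3 m4) hC
    have h4 := mul_le_mul_of_nonneg_left (add_le_add m5 m6) hE
    have h5 := mul_le_mul_of_nonneg_left hN hl0
    have h6 := mul_lt_mul_of_pos_left W.total_lt (sub_pos.2 hl1)
    nlinarith
  have hK' : W.a x' * v ^ 2 + W.b x' * v + W.c x' < 0 := by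
    have h1 : W.a x' * v ^ 2 + W.b x' * v + W.c x' = (x' * v) *
        (W.A * v + W.B * v⁻¹ + W.C * (x' * v + x'⁻¹) + W.E * ((x' * v)⁻¹ + x') - 1) := by
      unfold a b c; field_simp; ring
    rw [h1]
    exact mul_neg_of_pos_of_neg (by positivity) (by linarith)
  have ha' := W.a_pos hx'0
  have hc' := W.c_pos hx'0
  constructor
  · have : W.b x' * v < 0 := by nlinarith [mul_pos ha' (pow_pos hv0 2)]
    exact neg_of_mul_neg_left this hv0.le
  · have : W.d x' = (2 * W.a x' * v + W.b x') ^ 2 -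
        4 * W.a x' * (W.a x' * v ^ 2 + W.b x' * v + W.c x') := by unfold d; ring
    rw [this]
    nlinarith [sq_nonneg (2 * W.a x' * v + W.b x'), mul_neg_of_pos_of_neg ha' hK']

/-- On [0, 1] the coefficient b is strictly decreasing while a and c are non-decreasing, so b² - 4ac
strictly grows when moving left as long as b is non-negative. -/
lemma b_pos_d_pos_of_le {x x' : ℝ} (hx : 0 ≤ x) (hb : 0 ≤ W.b x') (hd : 0 ≤ W.d x') (hxx : x < x')
    (hx' : x' ≤ 1) : 0 < W.b x ∧ 0 < W.d x := by
  have hA := W.A_nonneg; have hB := W.B_nonneg; have hC := W.C_nonneg; have hE := W.E_nonneg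
  have h1 : W.b x - W.b x' = (x' - x) * (1 - W.E * (x + x')) := by unfold b; ring
  have h2 : 0 < 1 - W.E * (x + x') := by nlinarith [W.total_lt]
  have h3 : W.b x' < W.b x := by nlinarith [mul_pos (sub_pos.2 hxx) h2]
  have ha : W.a x ≤ W.a x' := by
    unfold a; gcongr
  have hc : W.c x ≤ W.c x' := by
    unfold c; gcongr
  have hac : W.a x * W.c x ≤ W.a x' * W.c x' :=
    mul_le_mul ha hc (c_nonneg hx) (a_nonneg (hx.trans hxx.le))
  refine ⟨by linarith, ?_⟩
  unfold d at hd ⊢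
  nlinarith

/-- For x = -z one has b ≥ z, while ac = z(Cz - A)(E - Bz) is non-positive or bounded by ABz² or
CEz². Both 4AB and 4CE are below 1. -/
lemma d_pos_of_neg {x : ℝ} (h1 : -1 < x) (h0 : x < 0) : 0 < W.d x := by
  have hA := W.A_nonneg; have hB := W.B_nonneg; have hC := W.C_nonneg; have hE := W.E_nonneg
  have ht := W.total_lt
  obtain ⟨z, rfl⟩ : ∃ z, x = -z := ⟨-x, by ring⟩
  have hz : 0 < z := by linarith
  have hb : z ≤ W.b (-z) := by unfold b; nlinarith [mul_nonneg hE (sq_nonneg z)]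
  have hac : W.a (-z) * W.c (-z) = z * ((W.C * z - W.A) * (W.E - W.B * z)) := by
    unfold a c; ring
  have hbound : 4 * (W.a (-z) * W.c (-z)) < z ^ 2 := by
    rw [hac]
    rcases le_total (W.C * z) W.A with h | h <;> rcases le_total (W.B * z) W.E with h' | h'
    · nlinarith [mul_nonneg hz.le (mul_nonneg (sub_nonneg.2 h) (sub_nonneg.2 h'))]
    · have h2 : (W.A - W.C * z) * (W.B * z - W.E) ≤ W.A * (W.B * z) := by
        apply mul_le_mul <;> nlinarith
      have h3 : 4 * (W.A * W.B) < 1 := by nlinarith [sq_nonneg (W.A - W.B)]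
      nlinarith [mul_le_mul_of_nonneg_left h2 hz.le, mul_lt_mul_of_pos_right h3 (pow_pos hz 2)]
    · have h2 : (W.C * z - W.A) * (W.E - W.B * z) ≤ (W.C * z) * W.E := by
        apply mul_le_mul <;> nlinarith
      have h3 : 4 * (W.C * W.E) < 1 := by nlinarith [sq_nonneg (W.C - W.E)]
      nlinarith [mul_le_mul_of_nonneg_left h2 hz.le, mul_lt_mul_of_pos_right h3 (pow_pos hz 2)]
    · nlinarith [mul_nonneg hz.le (mul_nonneg (sub_nonneg.2 h) (sub_nonneg.2 h'))]
  have : W.d (-z) = W.b (-z) ^ 2 - 4 * (W.a (-z) * W.c (-z)) := by unfold d; ring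
  rw [this]
  nlinarith

lemma d_one_pos : 0 < W.d 1 := by
  have hA := W.A_nonneg; have hB := W.B_nonneg; have hC := W.C_nonneg; have hE := W.E_nonneg
  have ht := W.total_lt
  have : W.d 1 = (1 - W.C - W.E) ^ 2 - 4 * (W.A + W.C) * (W.B + W.E) := by
    unfold d a b c; ring
  rw [this]
  nlinarith [sq_nonneg (W.A + W.C - W.B - W.E)]

lemma b_one_neg : W.b 1 < 0 := by
  have hA := W.A_nonneg; have hB := W.B_nonneg; have hC := W.C_nonneg; have hE := W.E_nonneg
  have ht := W.total_lt
  unfold b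
  nlinarith

/-- If C > 0, then b changes sign on (0, 1) and at its zero d = -4ac < 0. If C = 0, then d(x)
behaves like -4AEx near 0, and x = 2AE is small enough. -/
lemma exists_d_neg : ∃ x, 0 < x ∧ x < 1 ∧ W.d x < 0 := by
  have hA := W.A_nonneg; have hB := W.B_nonneg; have hC := W.C_nonneg; have hE := W.E_nonneg
  have ht := W.total_lt
  rcases hC.lt_or_eq with h | h
  · have h0 : W.b 0 = W.C := by simp [b]
    obtain ⟨x, hx, hx0⟩ := intermediate_value_Ioo' zero_le_one W.continuous_b.continuousOn
      (⟨W.b_one_neg, by rw [h0]; exact h⟩ : (0 : ℝ) ∈ Ioo (W.b 1) (W.b 0))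
    refine ⟨x, hx.1, hx.2, ?_⟩
    have := mul_pos (W.a_pos hx.1) (W.c_pos hx.1)
    unfold d
    rw [hx0]
    linarith
  · have hA' : 0 < W.A := by have := W.AC_pos; linarith
    have hE' : 0 < W.E := by have := W.CE_pos; linarith
    have hx : 0 < 2 * W.A * W.E := by positivity
    have hx1 : 2 * W.A * W.E < 1 := by nlinarith
    refine ⟨2 * W.A * W.E, hx, hx1, ?_⟩
    set x := 2 * W.A * W.E with hxdef
    have h1 : W.d x = x * (x * (W.E * x - 1) ^ 2 - 4 * W.A * (W.B * x + W.E)) := by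
      unfold d a b c; rw [← h]; ring
    rw [h1]
    refine mul_neg_of_pos_of_neg hx ?_
    have h2 : (W.E * x - 1) ^ 2 ≤ 1 := by
      have : W.E * x ≤ 1 := by nlinarith
      have : 0 ≤ W.E * x := by positivity
      nlinarith
    have h3 : 0 ≤ W.A * (W.B * x) := by positivity
    nlinarith

variable (W)

/-- The smallest root of the discriminant in `(-1, 1)`. -/
def x₁ : ℝ := sInf {x : ℝ | |x| < 1 ∧ W.d x = 0}
/-- The largest root of the discriminant in `(-1, 1)`. -/
def x₂ : ℝ := sSup {x : ℝ | |x| < 1 ∧ W.d x = 0}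

/-- The position of the branch points. -/
lemma branch_spec : 0 ≤ W.x₁ ∧ W.x₁ < W.x₂ ∧ W.x₂ < 1 ∧ W.d W.x₁ = 0 ∧ W.d W.x₂ = 0 ∧
    0 ≤ W.b W.x₁ ∧ W.b W.x₂ < 0 ∧ ∀ x ∈ Ioo W.x₁ W.x₂, W.d x < 0 := by
  obtain ⟨x₀, h0, h1, hd⟩ := W.exists_d_neg
  have hd0 : W.d 0 = W.C ^ 2 := by simp [d, a, b, c]
  obtain ⟨p, hp, hdp⟩ := intermediate_value_Icc' h0.le W.continuous_d.continuousOn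
    (⟨hd.le, by rw [hd0]; positivity⟩ : (0 : ℝ) ∈ Icc (W.d x₀) (W.d 0))
  obtain ⟨q, hq, hdq⟩ := intermediate_value_Ioo h1.le W.continuous_d.continuousOn
    (⟨hd, W.d_one_pos⟩ : (0 : ℝ) ∈ Ioo (W.d x₀) (W.d 1))
  have hpx : p < x₀ := lt_of_le_of_ne hp.2 (by rintro rfl; exact hd.ne hdp)
  have hb0 : 0 ≤ W.b 0 := by simpa [b] using W.C_nonneg
  have hbp : 0 ≤ W.b p := by
    by_contra! hb
    have hp0 : 0 < p := lt_of_le_of_ne hp.1 (by rintro rfl; linarith)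
    exact absurd (b_neg_d_pos_of_le hp0 hb hdp.ge hpx h1.le).2 (by linarith)
  have hbq : W.b q < 0 := by
    by_contra! hb
    exact absurd (b_pos_d_pos_of_le h0.le hb hdq.ge hq.1 hq.2.le).2 (by linarith)
  have hpq : p < q := hpx.trans hq.1
  -- The sign of b separates the roots: on the side b ≥ 0 a root forces d > 0 to its left, on the
  -- side b < 0 it forces d > 0 to its right. So each side has one root, and negative x has none.
  have hroots : {x : ℝ | |x| < 1 ∧ W.d x = 0} = {p, q} := by
    ext x
    simp only [mem_ofPred_eq, mem_insert_iff, mem_singleton_iff]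
    constructor
    · rintro ⟨hx, hdx⟩
      obtain ⟨hx1, hx2⟩ := abs_lt.1 hx
      by_contra! hne
      rcases lt_or_ge x 0 with hneg | hnn
      · exact absurd (W.d_pos_of_neg hx1 hneg) (by linarith)
      rcases lt_or_ge (W.b x) 0 with hbx | hbx
      · rcases lt_or_gt_of_ne hne.2 with h | h
        · have hx0 : 0 < x := lt_of_le_of_ne hnn (by rintro rfl; linarith)
          exact absurd (b_neg_d_pos_of_le hx0 hbx hdx.ge h hq.2.le).2 (by linarith)
        · exact absurd (b_neg_d_pos_of_le (h0.trans hq.1) hbq hdq.ge h hx2.le).2 (by linarith)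
      · rcases lt_or_gt_of_ne hne.1 with h | h
        · exact absurd (b_pos_d_pos_of_le hnn hbp hdp.ge h (hpx.trans h1).le).2 (by linarith)
        · exact absurd (b_pos_d_pos_of_le hp.1 hbx hdx.ge h hx2.le).2 (by linarith)
    · rintro (rfl | rfl)
      · exact ⟨abs_lt.2 ⟨by linarith [hp.1], by linarith⟩, hdp⟩
      · exact ⟨abs_lt.2 ⟨by linarith [hq.1], hq.2⟩, hdq⟩
  have e1 : W.x₁ = p := by rw [x₁, hroots, csInf_pair, min_eq_left hpq.le]
  have e2 : W.x₂ = q := by rw [x₂, hroots, csSup_pair, max_eq_right hpq.le]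
  rw [e1, e2]
  refine ⟨hp.1, hpq, hq.2, hdp, hdq, hbp, hbq, fun x hx => ?_⟩
  by_contra! hdx
  rcases lt_or_ge (W.b x) 0 with hbx | hbx
  · exact absurd (b_neg_d_pos_of_le (hp.1.trans_lt hx.1) hbx hdx hx.2 hq.2.le).2 (by linarith)
  · exact absurd (b_pos_d_pos_of_le hp.1 hbx hdx hx.1 (hx.2.trans hq.2).le).2 (by linarith)

lemma x₁_nonneg : 0 ≤ W.x₁ := W.branch_spec.1
lemma x₁_lt_x₂ : W.x₁ < W.x₂ := W.branch_spec.2.1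
lemma x₂_lt_one : W.x₂ < 1 := W.branch_spec.2.2.1
lemma d_x₁ : W.d W.x₁ = 0 := W.branch_spec.2.2.2.1
lemma d_x₂ : W.d W.x₂ = 0 := W.branch_spec.2.2.2.2.1
lemma b_x₁ : 0 ≤ W.b W.x₁ := W.branch_spec.2.2.2.2.2.1
lemma b_x₂ : W.b W.x₂ < 0 := W.branch_spec.2.2.2.2.2.2.1
lemma x₂_pos : 0 < W.x₂ := W.x₁_nonneg.trans_lt W.x₁_lt_x₂

variable {W}

lemma d_neg {x : ℝ} (hx : x ∈ Ioo W.x₁ W.x₂) : W.d x < 0 := W.branch_spec.2.2.2.2.2.2.2 x hx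

lemma d_nonpos {x : ℝ} (hx : x ∈ Icc W.x₁ W.x₂) : W.d x ≤ 0 := by
  rcases hx.1.eq_or_lt with h | h
  · rw [← h, d_x₁]
  rcases hx.2.eq_or_lt with h' | h'
  · rw [h', d_x₂]
  exact (d_neg ⟨h, h'⟩).le

lemma eq_or_eq_of_d_nonneg {x : ℝ} (hx : x ∈ Icc W.x₁ W.x₂) (hd : 0 ≤ W.d x) :
    x = W.x₁ ∨ x = W.x₂ := by
  by_contra! h
  exact absurd (d_neg ⟨lt_of_le_of_ne hx.1 h.1.symm, lt_of_le_of_ne hx.2 h.2⟩) (by linarith)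

lemma x₁_pos (hC : 0 < W.C) : 0 < W.x₁ := by
  refine lt_of_le_of_ne W.x₁_nonneg fun h => ?_
  have := W.d_x₁
  rw [← h] at this
  simp [d, a, b, c] at this
  exact hC.ne' this

lemma c_pos' {x : ℝ} (hx : W.x₁ ≤ x) : 0 < W.c x := by
  rcases W.C_nonneg.eq_or_lt with h | h
  · have hE : 0 < W.E := by have := W.CE_pos; linarith
    have hx0 : 0 ≤ x := W.x₁_nonneg.trans hx
    have := mul_nonneg W.B_nonneg hx0
    unfold c; linarith
  · exact c_pos ((x₁_pos h).trans_le hx)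

lemma a_eq_zero_iff {x : ℝ} (hx : W.x₁ ≤ x) : W.a x = 0 ↔ x = 0 := by
  constructor
  · intro h
    by_contra hne
    exact (a_pos (lt_of_le_of_ne (W.x₁_nonneg.trans hx) (Ne.symm hne))).ne' h
  · rintro rfl; simp [a]

/-- At a branch point, the two roots in `x` of the kernel are distinct. -/
lemma not_critical {x y : ℝ} (hx : 0 < x) (hx1 : x < 1) (hK : W.a x * y ^ 2 + W.b x * y + W.c x = 0)
    (hy : 2 * W.a x * y + W.b x = 0) : x ^ 2 * y ≠ 1 := by
  intro h
  have hA := W.A_nonneg; have hB := W.B_nonneg; have hC := W.C_nonneg; have hE := W.E_nonneg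
  have hy' : y = (x⁻¹) ^ 2 := by
    field_simp
    linarith
  set u := x⁻¹ with hu
  have hxu : x * u = 1 := mul_inv_cancel₀ hx.ne'
  have h1 : W.A * u ^ 2 + W.B * x ^ 2 + 2 * W.C * u + 2 * W.E * x = 1 := by
    rw [hy'] at hK
    unfold a b c at hK
    have e : W.A * u ^ 2 + W.B * x ^ 2 + 2 * W.C * u + 2 * W.E * x - 1 =
        x * ((W.A * x + W.C * x ^ 2) * (u ^ 2) ^ 2 + (W.C + W.E * x ^ 2 - x) * u ^ 2 +
          (W.B * x + W.E)) := by
      rw [hu]; field_simp; ring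
    rw [hK] at e
    linarith
  have h2 : W.A * u ^ 2 + W.C * u = W.B * x ^ 2 + W.E * x := by
    rw [hy'] at hy
    unfold a b at hy
    have e : 2 * W.A * u ^ 2 + 3 * W.C * u + W.E * x - 1 =
        u * (2 * (W.A * x + W.C * x ^ 2) * u ^ 2 + (W.C + W.E * x ^ 2 - x)) := by
      rw [hu]; field_simp; ring
    rw [hy] at e
    linarith
  have ht := W.total_lt
  -- Along the curve y = x⁻² the weighted sum is φ(x) = Ax⁻² + Bx² + 2Cx⁻¹ + 2Ex, which is convex;
  -- `h1` says φ(x) = 1 and `h2` says φ'(x) = 0. Then φ(1) ≥ φ(x) = 1, against φ(1) = A + B + 2C +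
  -- 2E < 1. The bounds `k1` to `k4` prove this term by term, with right-hand sides adding up to 0.
  have k1 : W.A * (u ^ 2 - 1) ≤ 2 * (1 - x) * (W.A * u ^ 2) := by
    have : 0 ≤ (1 - x) ^ 2 * u ^ 2 := by positivity
    have e : 2 * (1 - x) * u ^ 2 - (u ^ 2 - 1) = (1 - x) ^ 2 * u ^ 2 := by
      rw [hu]; field_simp; ring
    nlinarith
  have k2 : 2 * W.C * (u - 1) = 2 * (1 - x) * (W.C * u) := by linear_combination 2 * W.C * hxu
  have k3 : W.B * (x ^ 2 - 1) ≤ -(2 * (1 - x) * (W.B * x ^ 2)) := by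
    have : 0 ≤ (1 - x) ^ 2 * (2 * x + 1) := by positivity
    nlinarith
  have k4 : 2 * W.E * (x - 1) ≤ -(2 * (1 - x) * (W.E * x)) := by
    nlinarith [mul_nonneg hE (sq_nonneg (1 - x))]
  nlinarith

end Weights
-- The curve, its two sides and the domain
namespace Weights

variable (W : Weights)

/-- The kernel. -/
def K (x y : ℂ) : ℂ :=
  W.A * (x * y ^ 2) + W.B * x + W.C * (x ^ 2 * y ^ 2 + y) + W.E * (1 + x ^ 2 * y) - x * y

/-- The curve `ℒ`. -/
def curve : Set ℂ := {y | ∃ x ∈ Icc W.x₁ W.x₂, W.K x y = 0}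

/-- The domain delimited by the curve and avoiding `+∞`. -/
def domain : Set ℂ :=
  {y | y ∉ W.curve ∧ ¬ ∀ᶠ R : ℝ in atTop, (R : ℂ) ∈ connectedComponentIn W.curveᶜ y}

/-- The points on the curve or on its outer side. -/
def outer : Set ℂ :=
  {y | W.c W.x₁ ≤ W.a W.x₁ * Complex.normSq y} ∪
    {y | ∃ x ∈ Icc W.x₁ W.x₂, W.a x * Complex.normSq y = W.c x ∧ 0 ≤ 2 * W.a x * y.re + W.b x}

/-- The points on the curve or on its inner side. -/
def inner : Set ℂ :=
  {y | W.a W.x₂ * Complex.normSq y ≤ W.c W.x₂} ∪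
    {y | ∃ x ∈ Icc W.x₁ W.x₂, W.a x * Complex.normSq y = W.c x ∧ 2 * W.a x * y.re + W.b x ≤ 0}

variable {W}

lemma K_ofReal (x : ℝ) (y : ℂ) : W.K x y = W.a x * y ^ 2 + W.b x * y + W.c x := by
  simp only [K, a, b, c]; push_cast; ring

/-- Since d(x) ≤ 0, the real quadratic has a conjugate or double pair of roots, so modulus and real
part can be read off from Vieta. -/
lemma K_eq_zero_iff {x : ℝ} {y : ℂ} (hx : x ∈ Icc W.x₁ W.x₂) : W.K x y = 0 ↔
    W.a x * Complex.normSq y = W.c x ∧ 2 * W.a x * y.re + W.b x = 0 := by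
  rw [K_ofReal, Complex.ext_iff, Complex.normSq_apply]
  simp only [Complex.add_re, Complex.add_im, Complex.ofReal_re, Complex.ofReal_im,
    Complex.zero_re, Complex.zero_im, pow_two, Complex.mul_re, Complex.mul_im]
  constructor
  · rintro ⟨h1, h2⟩
    have h3 : 2 * W.a x * y.re + W.b x = 0 := by
      by_cases him : y.im = 0
      · rw [him] at h1
        have hd := d_nonpos hx
        have : (2 * W.a x * y.re + W.b x) ^ 2 = W.d x := by
          unfold d; linear_combination 4 * W.a x * h1
        exact pow_eq_zero_iff two_ne_zero |>.1 (le_antisymm (this ▸ hd) (sq_nonneg _))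
      · refine (mul_eq_zero.1 ?_).resolve_right him
        linear_combination h2
    exact ⟨by linear_combination h3 * y.re - h1, h3⟩
  · rintro ⟨h1, h2⟩
    exact ⟨by linear_combination h2 * y.re - h1, by linear_combination h2 * y.im⟩

lemma mem_curve_iff {y : ℂ} : y ∈ W.curve ↔ ∃ x ∈ Icc W.x₁ W.x₂,
    W.a x * Complex.normSq y = W.c x ∧ 2 * W.a x * y.re + W.b x = 0 :=
  exists_congr fun _ => and_congr_right fun hx => K_eq_zero_iff hx

/-- The squared radius c/a of the circle carrying the points of parameter x is strictly decreasing.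
The inequalities are kept free of division because a(x₁) may vanish, in which case the radius is
infinite. -/
lemma lt_of_le_of_lt_point {x x' n : ℝ} (hx : W.x₁ ≤ x) (h : W.c x ≤ W.a x * n)
    (hxx : x < x') : W.c x' < W.a x' * n := by
  have hx0 := W.x₁_nonneg.trans hx
  have hc := c_pos' hx
  have ha : 0 < W.a x := by
    rcases (a_nonneg (W := W) hx0).eq_or_lt with h0 | h0
    · rw [← h0] at h; linarith
    · exact h0
  have h1 := cross_lt hx0 hc hxx
  have ha' := (W.a_pos (hx0.trans_lt hxx)).le
  have h2 : W.a x * W.c x' < W.a x * (W.a x' * n) := by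
    nlinarith [mul_le_mul_of_nonneg_left h ha']
  exact lt_of_mul_lt_mul_left h2 ha.le

lemma lt_of_le_of_gt_point {x x' n : ℝ} (hx : W.x₁ ≤ x)
    (h : W.a x' * n ≤ W.c x') (hxx : x < x') : W.a x * n < W.c x := by
  by_contra! h'
  exact absurd (lt_of_le_of_lt_point hx h' hxx) (by linarith)

/-- The modulus of a point of the curve determines its parameter. -/
lemma eq_of_norm_eq {x x' n : ℝ} (hx : W.x₁ ≤ x) (hx' : W.x₁ ≤ x')
    (h : W.a x * n = W.c x) (h' : W.a x' * n = W.c x') : x = x' := by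
  rcases lt_trichotomy x x' with hlt | heq | hlt
  · exact absurd (lt_of_le_of_lt_point hx h.ge hlt) (by linarith)
  · exact heq
  · exact absurd (lt_of_le_of_lt_point hx' h'.ge hlt) (by linarith)

lemma isClosed_exists_Icc {p q : ℝ} {P : ℝ → ℂ → Prop}
    (h : IsClosed {z : ℝ × ℂ | P z.1 z.2}) : IsClosed {y : ℂ | ∃ x ∈ Icc p q, P x y} := by
  have h1 : IsClosed {z : Icc p q × ℂ | P z.1 z.2} :=
    h.preimage (f := fun z : Icc p q × ℂ => ((z.1 : ℝ), z.2)) (by fun_prop)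
  convert isClosedMap_snd_of_compactSpace _ h1 using 1
  ext y
  simp

lemma isClosed_outer : IsClosed W.outer := by
  have ha := W.continuous_a; have hb := W.continuous_b; have hc := W.continuous_c
  refine (isClosed_le continuous_const (by fun_prop)).union (isClosed_exists_Icc ?_)
  have h1 : IsClosed {z : ℝ × ℂ | W.a z.1 * Complex.normSq z.2 = W.c z.1} :=
    isClosed_eq (by fun_prop) (by fun_prop)
  have h2 : IsClosed {z : ℝ × ℂ | 0 ≤ 2 * W.a z.1 * z.2.re + W.b z.1} :=
    isClosed_le (by fun_prop) (by fun_prop)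
  exact h1.inter h2

lemma isClosed_inner : IsClosed W.inner := by
  have ha := W.continuous_a; have hb := W.continuous_b; have hc := W.continuous_c
  refine (isClosed_le (by fun_prop) continuous_const).union (isClosed_exists_Icc ?_)
  have h1 : IsClosed {z : ℝ × ℂ | W.a z.1 * Complex.normSq z.2 = W.c z.1} :=
    isClosed_eq (by fun_prop) (by fun_prop)
  have h2 : IsClosed {z : ℝ × ℂ | 2 * W.a z.1 * z.2.re + W.b z.1 ≤ 0} :=
    isClosed_le (by fun_prop) (by fun_prop)
  exact h1.inter h2

/-- If |y| lies between the extreme radii, the intermediate value theorem puts y on the circle of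
some x, and comparing Re y with -b/(2a) decides the side. -/
lemma inner_union_outer : W.inner ∪ W.outer = univ := by
  refine eq_univ_of_forall fun y => ?_
  by_contra hy
  simp only [inner, outer, mem_union, mem_ofPred_eq, not_or] at hy
  obtain ⟨⟨h1, h2⟩, h3, h4⟩ := hy
  have hcont : ContinuousOn (fun x => W.a x * Complex.normSq y - W.c x) (Icc W.x₁ W.x₂) :=
    ((W.continuous_a.mul continuous_const).sub W.continuous_c).continuousOn
  obtain ⟨x, hx, hx0⟩ := intermediate_value_Icc W.x₁_lt_x₂.le hcont
    (⟨by linarith, by linarith⟩ : (0 : ℝ) ∈ Icc _ _)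
  rcases le_total 0 (2 * W.a x * y.re + W.b x) with h | h
  · exact h4 ⟨x, hx, by simpa [sub_eq_zero] using hx0, h⟩
  · exact h2 ⟨x, hx, by simpa [sub_eq_zero] using hx0, h⟩

lemma curve_subset_inner : W.curve ⊆ W.inner := fun y hy => by
  obtain ⟨x, hx, h1, h2⟩ := mem_curve_iff.1 hy
  exact Or.inr ⟨x, hx, h1, h2.le⟩

lemma curve_subset_outer : W.curve ⊆ W.outer := fun y hy => by
  obtain ⟨x, hx, h1, h2⟩ := mem_curve_iff.1 hy
  exact Or.inr ⟨x, hx, h1, h2.ge⟩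

lemma left_mem : W.x₁ ∈ Icc W.x₁ W.x₂ := ⟨le_rfl, W.x₁_lt_x₂.le⟩
lemma right_mem : W.x₂ ∈ Icc W.x₁ W.x₂ := ⟨W.x₁_lt_x₂.le, le_rfl⟩

lemma a_pos_of_eq {x n : ℝ} (hx : W.x₁ ≤ x) (h : W.a x * n = W.c x) : 0 < W.a x := by
  have hc := c_pos' hx
  rcases (a_nonneg (W := W) (W.x₁_nonneg.trans hx)).eq_or_lt with h0 | h0
  · rw [← h0] at h; linarith
  · exact h0

lemma re_sq_le_normSq (y : ℂ) : y.re ^ 2 ≤ Complex.normSq y := by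
  rw [Complex.normSq_apply]; nlinarith [mul_self_nonneg y.im]

/-- On the circle of an x, both half-conditions together give the equation of the curve. A point
satisfying one radial condition must have an extreme radius; there d = 0, and |Re y| ≤ |y| supplies
the missing inequality. -/
lemma inner_inter_outer : W.inner ∩ W.outer = W.curve := by
  refine Subset.antisymm ?_ fun y hy => ⟨curve_subset_inner hy, curve_subset_outer hy⟩
  rintro y ⟨hi | ⟨x, hx, h1, h2⟩, ho | ⟨x', hx', h1', h2'⟩⟩
  · exact absurd (lt_of_le_of_lt_point le_rfl ho W.x₁_lt_x₂)
      (not_lt.2 hi)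
  · have hxe : x' = W.x₂ := by
      rcases hx'.2.lt_or_eq with h | h
      · exact absurd (lt_of_le_of_gt_point hx'.1 hi h) (by linarith)
      · exact h
    subst hxe
    refine mem_curve_iff.2 ⟨_, right_mem, h1', le_antisymm ?_ h2'⟩
    have hd := W.d_x₂
    unfold d at hd
    have ha := a_pos_of_eq hx'.1 h1'
    have hb := W.b_x₂
    have : (2 * W.a W.x₂ * y.re) ^ 2 ≤ (-W.b W.x₂) ^ 2 := by
      nlinarith [mul_le_mul_of_nonneg_left (re_sq_le_normSq y) (sq_nonneg (W.a W.x₂))]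
    have := abs_le_of_sq_le_sq this (by linarith)
    linarith [(abs_le.1 this).2]
  · have hxe : x = W.x₁ := by
      rcases hx.1.lt_or_eq with h | h
      · exact absurd (lt_of_le_of_lt_point le_rfl ho h) (by linarith)
      · exact h.symm
    subst hxe
    refine mem_curve_iff.2 ⟨_, left_mem, h1, le_antisymm h2 ?_⟩
    have hd := W.d_x₁
    unfold d at hd
    have ha := a_pos_of_eq hx.1 h1
    have hb := W.b_x₁
    have : (2 * W.a W.x₁ * y.re) ^ 2 ≤ (W.b W.x₁) ^ 2 := by
      nlinarith [mul_le_mul_of_nonneg_left (re_sq_le_normSq y) (sq_nonneg (W.a W.x₁))]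
    have := abs_le_of_sq_le_sq this hb
    linarith [(abs_le.1 this).1]
  · obtain rfl := eq_of_norm_eq hx.1 hx'.1 h1 h1'
    exact mem_curve_iff.2 ⟨x, hx, h1, le_antisymm h2 h2'⟩

lemma mem_outer_of_re_le {y z : ℂ} (hy : y ∈ W.outer) (hn : Complex.normSq z = Complex.normSq y)
    (hre : y.re ≤ z.re) : z ∈ W.outer := by
  rcases hy with h | ⟨x, hx, h1, h2⟩
  · exact Or.inl (by rw [mem_ofPred_eq, hn]; exact h)
  · refine Or.inr ⟨x, hx, by rw [hn]; exact h1, ?_⟩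
    have := mul_le_mul_of_nonneg_left hre (a_nonneg (W := W) (W.x₁_nonneg.trans hx.1))
    linarith

lemma mem_inner_of_re_le {y z : ℂ} (hy : y ∈ W.inner) (hn : Complex.normSq z = Complex.normSq y)
    (hre : z.re ≤ y.re) : z ∈ W.inner := by
  rcases hy with h | ⟨x, hx, h1, h2⟩
  · exact Or.inl (by rw [mem_ofPred_eq, hn]; exact h)
  · refine Or.inr ⟨x, hx, by rw [hn]; exact h1, ?_⟩
    have := mul_le_mul_of_nonneg_left hre (a_nonneg (W := W) (W.x₁_nonneg.trans hx.1))
    linarith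

/-- A negative real that is outer because of some x satisfies b ≥ 2ar, so d(x) ≥ 0 and x is an
endpoint; b(x₂) < 0 leaves only x₁. The positive real axis is treated in the same way with x₂. -/
lemma neg_ofReal_mem_outer {r : ℝ} (hr : 0 ≤ r) :
    (-r : ℂ) ∈ W.outer ↔ W.c W.x₁ ≤ W.a W.x₁ * r ^ 2 := by
  have hn : Complex.normSq (-r : ℂ) = r ^ 2 := by
    rw [Complex.normSq_neg, Complex.normSq_ofReal]; ring
  refine ⟨?_, fun h => Or.inl (by rw [mem_ofPred_eq, hn]; exact h)⟩
  rintro (h | ⟨x, hx, h1, h2⟩)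
  · rwa [mem_ofPred_eq, hn] at h
  · rw [hn] at h1
    simp only [Complex.neg_re, Complex.ofReal_re] at h2
    have ha := a_pos_of_eq hx.1 h1
    have har : 0 ≤ 2 * W.a x * r := by positivity
    have hd : 0 ≤ W.d x := by unfold d; nlinarith
    rcases eq_or_eq_of_d_nonneg hx hd with h | h
    · rw [← h, h1]
    · have := W.b_x₂
      rw [← h] at this
      linarith

lemma ofReal_mem_inner {r : ℝ} (hr : 0 ≤ r) :
    (r : ℂ) ∈ W.inner ↔ W.a W.x₂ * r ^ 2 ≤ W.c W.x₂ := by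
  have hn : Complex.normSq (r : ℂ) = r ^ 2 := by
    rw [Complex.normSq_ofReal]; ring
  refine ⟨?_, fun h => Or.inl (by rw [mem_ofPred_eq, hn]; exact h)⟩
  rintro (h | ⟨x, hx, h1, h2⟩)
  · rwa [mem_ofPred_eq, hn] at h
  · rw [hn] at h1
    simp only [Complex.ofReal_re] at h2
    have ha := a_pos_of_eq hx.1 h1
    have hc := c_pos' hx.1
    have hr0 : 0 < r := lt_of_le_of_ne hr (by rintro rfl; simp at h1; linarith)
    have har : 0 < 2 * W.a x * r := by positivity
    have hd : 0 ≤ W.d x := by unfold d; nlinarith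
    rcases eq_or_eq_of_d_nonneg hx hd with h | h
    · have := W.b_x₁
      rw [← h] at this
      linarith
    · rw [← h, h1]

/-- The point of the circle of radius `r` with real part `u`, on the side given by the sign `s`. -/
def circlePoint (r s u : ℝ) : ℂ := ⟨u, s * Real.sqrt (r ^ 2 - u ^ 2)⟩

lemma continuous_circlePoint (r s : ℝ) : Continuous (circlePoint r s) := by
  have : circlePoint r s = fun u : ℝ =>
      (u : ℂ) + (s * Real.sqrt (r ^ 2 - u ^ 2) : ℝ) * Complex.I := by
    funext u
    apply Complex.ext <;> simp [circlePoint]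
  rw [this]
  fun_prop

lemma normSq_circlePoint {r s u : ℝ} (hs : s ^ 2 = 1) (hu : u ^ 2 ≤ r ^ 2) :
    Complex.normSq (circlePoint r s u) = r ^ 2 := by
  have := Real.sq_sqrt (sub_nonneg.2 hu)
  simp only [circlePoint, Complex.normSq_mk]
  linear_combination hs * Real.sqrt (r ^ 2 - u ^ 2) ^ 2 + this

lemma exists_circlePoint_eq (y : ℂ) : ∃ s : ℝ, s ^ 2 = 1 ∧ circlePoint ‖y‖ s y.re = y := by
  have h : Real.sqrt (‖y‖ ^ 2 - y.re ^ 2) = |y.im| := by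
    rw [Complex.sq_norm, Complex.normSq_apply, ← Real.sqrt_sq_eq_abs]
    congr 1; ring
  rcases le_total 0 y.im with h0 | h0
  · exact ⟨1, by norm_num, Complex.ext rfl (by simp only [circlePoint, h, abs_of_nonneg h0]; ring)⟩
  · exact ⟨-1, by norm_num, Complex.ext rfl (by simp only [circlePoint, h, abs_of_nonpos h0]; ring)⟩

/-- Moving left on a circle stays inside, so y is rotated to -|y|; from there the negative axis
leads to 0. -/
lemma isPreconnected_compl_outer_aux {y : ℂ} (hy : y ∈ W.outerᶜ) :
    ∃ T ⊆ W.outerᶜ, (0 : ℂ) ∈ T ∧ y ∈ T ∧ IsPreconnected T := by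
  obtain ⟨s, hs, hsy⟩ := exists_circlePoint_eq y
  have hre := abs_le.1 (Complex.abs_re_le_norm y)
  have hT1 : ∀ u ∈ Icc (-‖y‖) y.re, circlePoint ‖y‖ s u ∈ W.outerᶜ := by
    intro u hu hmem
    have h1 : u ^ 2 ≤ ‖y‖ ^ 2 := sq_le_sq' hu.1 (hu.2.trans hre.2)
    refine hy (mem_outer_of_re_le hmem ?_ hu.2)
    rw [normSq_circlePoint hs h1, Complex.sq_norm]
  have hend : circlePoint ‖y‖ s (-‖y‖) = (-‖y‖ : ℂ) := by
    apply Complex.ext <;> simp [circlePoint]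
  have hneg : (-‖y‖ : ℂ) ∈ W.outerᶜ := by
    rw [← hend]; exact hT1 _ ⟨le_rfl, hre.1⟩
  have hT2 : ∀ r ∈ Icc 0 ‖y‖, (-r : ℂ) ∈ W.outerᶜ := by
    intro r hr hmem
    refine hneg ((neg_ofReal_mem_outer (norm_nonneg y)).2
      (((neg_ofReal_mem_outer hr.1).1 hmem).trans ?_))
    exact mul_le_mul_of_nonneg_left (pow_le_pow_left₀ hr.1 hr.2 2) (a_nonneg W.x₁_nonneg)
  refine ⟨circlePoint ‖y‖ s '' Icc (-‖y‖) y.re ∪ (fun r : ℝ => (-r : ℂ)) '' Icc 0 ‖y‖, ?_, ?_, ?_,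
    ?_⟩
  · rintro _ (⟨u, hu, rfl⟩ | ⟨r, hr, rfl⟩)
    · exact hT1 u hu
    · exact hT2 r hr
  · exact Or.inr ⟨0, ⟨le_rfl, norm_nonneg y⟩, by simp⟩
  · exact Or.inl ⟨y.re, ⟨hre.1, le_rfl⟩, hsy⟩
  · refine IsPreconnected.union (-‖y‖ : ℂ) ⟨-‖y‖, ⟨le_rfl, hre.1⟩, hend⟩
      ⟨‖y‖, ⟨norm_nonneg y, le_rfl⟩, rfl⟩ ?_ ?_
    · exact isPreconnected_Icc.image _ (continuous_circlePoint _ _).continuousOn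
    · exact isPreconnected_Icc.image _ (by fun_prop)

lemma zero_notMem_outer : (0 : ℂ) ∉ W.outer := by
  have h := neg_ofReal_mem_outer (W := W) le_rfl
  simp only [Complex.ofReal_zero, neg_zero] at h
  rw [h]
  have := c_pos' (W := W) le_rfl
  simpa using this

lemma isPreconnected_compl_outer : IsPreconnected W.outerᶜ :=
  isPreconnected_of_forall 0 fun _ hy => isPreconnected_compl_outer_aux hy

/-- Mirror image of the inner case: y is rotated to |y| and then moved along the positive axis to
+∞. -/
lemma exists_ray_of_notMem_inner {y : ℂ} (hy : y ∈ W.innerᶜ) :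
    ∃ T ⊆ W.innerᶜ, y ∈ T ∧ IsPreconnected T ∧ ∀ R : ℝ, ‖y‖ ≤ R → (R : ℂ) ∈ T := by
  obtain ⟨s, hs, hsy⟩ := exists_circlePoint_eq y
  have hre := abs_le.1 (Complex.abs_re_le_norm y)
  have hT1 : ∀ u ∈ Icc y.re ‖y‖, circlePoint ‖y‖ s u ∈ W.innerᶜ := by
    intro u hu hmem
    have h1 : u ^ 2 ≤ ‖y‖ ^ 2 := sq_le_sq' (hre.1.trans hu.1) hu.2
    refine hy (mem_inner_of_re_le hmem ?_ hu.1)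
    rw [normSq_circlePoint hs h1, Complex.sq_norm]
  have hend : circlePoint ‖y‖ s ‖y‖ = (‖y‖ : ℂ) := by
    apply Complex.ext <;> simp [circlePoint]
  have hpos : (‖y‖ : ℂ) ∈ W.innerᶜ := by
    rw [← hend]; exact hT1 _ ⟨hre.2, le_rfl⟩
  have hT2 : ∀ r ∈ Ici ‖y‖, (r : ℂ) ∈ W.innerᶜ := by
    intro r hr hmem
    refine hpos ((ofReal_mem_inner (norm_nonneg y)).2 (le_trans ?_
      ((ofReal_mem_inner ((norm_nonneg y).trans hr)).1 hmem)))
    exact mul_le_mul_of_nonneg_left (pow_le_pow_left₀ (norm_nonneg y) hr 2)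
      (a_nonneg W.x₂_pos.le)
  refine ⟨circlePoint ‖y‖ s '' Icc y.re ‖y‖ ∪ (fun r : ℝ => (r : ℂ)) '' Ici ‖y‖, ?_, ?_, ?_, ?_⟩
  · rintro _ (⟨u, hu, rfl⟩ | ⟨r, hr, rfl⟩)
    · exact hT1 u hu
    · exact hT2 r hr
  · exact Or.inl ⟨y.re, ⟨le_rfl, hre.2⟩, hsy⟩
  · refine IsPreconnected.union (‖y‖ : ℂ) ⟨‖y‖, ⟨hre.2, le_rfl⟩, hend⟩
      ⟨‖y‖, self_mem_Ici, rfl⟩ ?_ ?_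
    · exact isPreconnected_Icc.image _ (continuous_circlePoint _ _).continuousOn
    · exact isPreconnected_Ici.image _ (by fun_prop)
  · exact fun R hR => Or.inr ⟨R, hR, rfl⟩

lemma eventually_ofReal_notMem_inner : ∀ᶠ R : ℝ in atTop, (R : ℂ) ∉ W.inner := by
  have ha := W.a_pos W.x₂_pos
  have : Tendsto (fun R : ℝ => W.a W.x₂ * R ^ 2) atTop atTop :=
    (tendsto_pow_atTop two_ne_zero).const_mul_atTop ha
  filter_upwards [this.eventually_gt_atTop (W.c W.x₂), eventually_ge_atTop 0] with R h1 h2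
  rw [ofReal_mem_inner h2]
  exact not_le.2 h1

lemma mem_inner_of_notMem_outer {y : ℂ} (h : y ∉ W.outer) : y ∈ W.inner :=
  (eq_univ_iff_forall.1 W.inner_union_outer y).resolve_right h

lemma mem_outer_of_notMem_inner {y : ℂ} (h : y ∉ W.inner) : y ∈ W.outer :=
  (eq_univ_iff_forall.1 W.inner_union_outer y).resolve_left h

lemma notMem_curve_iff {y : ℂ} : y ∉ W.curve ↔ y ∉ W.outer ∨ y ∉ W.inner := by
  rw [← inner_inter_outer, mem_inter_iff, not_and_or, or_comm]

/-- The domain is the complement of the outer side. -/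
theorem domain_eq : W.domain = W.outerᶜ := by
  ext y
  constructor
  · rintro ⟨hy, hcomp⟩ hout
    have hin : y ∈ W.innerᶜ := (notMem_curve_iff.1 hy).resolve_left (not_not.2 hout)
    obtain ⟨T, hT, hyT, hpre, hR⟩ := exists_ray_of_notMem_inner hin
    refine hcomp ((eventually_ge_atTop ‖y‖).mono fun R h => ?_)
    exact hpre.subset_connectedComponentIn hyT
      (hT.trans (compl_subset_compl.2 curve_subset_inner)) (hR R h)
  · intro hy
    refine ⟨fun h => hy (curve_subset_outer h), fun hcomp => ?_⟩
    have hyc : y ∈ W.curveᶜ := fun h => hy (curve_subset_outer h)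
    have hsub : connectedComponentIn W.curveᶜ y ⊆ W.outerᶜ := by
      refine isPreconnected_connectedComponentIn.subset_left_of_subset_union
        isClosed_outer.isOpen_compl (isClosed_inner (W := W)).isOpen_compl ?_ ?_
        ⟨y, mem_connectedComponentIn hyc, hy⟩
      · rw [disjoint_compl_left_iff_subset, compl_subset_iff_union, inner_union_outer]
      · intro z hz
        exact notMem_curve_iff.1 (connectedComponentIn_subset _ _ hz)
    obtain ⟨R, h1, h2⟩ := (hcomp.and W.eventually_ofReal_notMem_inner).exists
    exact hsub h1 (mem_outer_of_notMem_inner h2)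

lemma isOpen_domain : IsOpen W.domain := by
  rw [domain_eq]; exact isClosed_outer.isOpen_compl

lemma isPreconnected_domain : IsPreconnected W.domain := by
  rw [domain_eq]; exact isPreconnected_compl_outer

lemma zero_mem_domain : (0 : ℂ) ∈ W.domain := by
  rw [domain_eq]; exact zero_notMem_outer

lemma conj_mem_outer {y : ℂ} (hy : y ∈ W.outer) : starRingEnd ℂ y ∈ W.outer :=
  mem_outer_of_re_le hy (Complex.normSq_conj y) (Complex.conj_re y).ge

lemma conj_mem_domain {y : ℂ} (hy : y ∈ W.domain) : starRingEnd ℂ y ∈ W.domain := by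
  rw [domain_eq] at hy ⊢
  intro h
  exact hy (by simpa using conj_mem_outer h)

lemma conj_mem_curve {y : ℂ} (hy : y ∈ W.curve) : starRingEnd ℂ y ∈ W.curve := by
  obtain ⟨x, hx, h1, h2⟩ := mem_curve_iff.1 hy
  exact mem_curve_iff.2 ⟨x, hx, by rwa [Complex.normSq_conj], by rwa [Complex.conj_re]⟩

lemma notMem_outer_of_lt {y : ℂ} (h : W.a W.x₂ * Complex.normSq y < W.c W.x₂) :
    y ∉ W.outer := by
  rintro (h' | ⟨x, hx, h1, -⟩)
  · exact absurd (lt_of_le_of_lt_point le_rfl h' W.x₁_lt_x₂)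
      (by linarith)
  · rcases hx.2.lt_or_eq with hlt | rfl
    · exact absurd (lt_of_le_of_gt_point hx.1 h.le hlt) (by linarith)
    · linarith

lemma notMem_inner_of_lt {y : ℂ} (h : W.c W.x₁ < W.a W.x₁ * Complex.normSq y) :
    y ∉ W.inner := by
  rintro (h' | ⟨x, hx, h1, -⟩)
  · exact absurd (lt_of_le_of_gt_point le_rfl h' W.x₁_lt_x₂)
      (by linarith)
  · rcases hx.1.lt_or_eq with hlt | rfl
    · exact absurd (lt_of_le_of_lt_point le_rfl h.le hlt) (by linarith)
    · linarith

lemma im_eq_zero_of_d {x : ℝ} {y : ℂ} (hx : W.x₁ ≤ x) (h1 : W.a x * Complex.normSq y = W.c x)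
    (h2 : 2 * W.a x * y.re + W.b x = 0) (hd : W.d x = 0) : y.im = 0 := by
  have ha := a_pos_of_eq hx h1
  rw [Complex.normSq_apply] at h1
  unfold d at hd
  have : (2 * W.a x * y.im) ^ 2 = 0 := by
    linear_combination -hd + (W.b x - 2 * W.a x * y.re) * h2 + 4 * W.a x * h1
  have h3 := pow_eq_zero_iff two_ne_zero |>.1 this
  exact (mul_eq_zero.1 h3).resolve_left (by positivity)

lemma d_eq_zero_of_im {x : ℝ} {y : ℂ} (h1 : W.a x * Complex.normSq y = W.c x)
    (h2 : 2 * W.a x * y.re + W.b x = 0) (him : y.im = 0) : W.d x = 0 := by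
  rw [Complex.normSq_apply, him] at h1
  unfold d
  linear_combination (W.b x - 2 * W.a x * y.re) * h2 + 4 * W.a x * h1

/-- At a real point of the curve, which belongs to x₁ or x₂, radial displacement reaches both sides.
At a non-real point, displacement along the circle around 0 does. -/
lemma mem_closure_sides {y : ℂ} (hy : y ∈ W.curve) :
    y ∈ closure W.outerᶜ ∧ y ∈ closure W.innerᶜ := by
  obtain ⟨x, hx, h1, h2⟩ := mem_curve_iff.1 hy
  have ha := a_pos_of_eq hx.1 h1
  by_cases him : y.im = 0
  · have hd := d_eq_zero_of_im h1 h2 him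
    have hyre : y = (y.re : ℂ) := Complex.ext rfl (by simpa using him)
    have hnre : Complex.normSq y = y.re ^ 2 := by rw [Complex.normSq_apply, him]; ring
    have hre0 : y.re ≠ 0 := by
      intro h0
      rw [hnre, h0] at h1
      have := c_pos' hx.1
      simp at h1
      linarith
    have hsc : ∀ s : ℝ, Complex.normSq (s * y) = s ^ 2 * Complex.normSq y := by
      intro s; rw [Complex.normSq_mul, Complex.normSq_ofReal]; ring
    have hnpos : 0 < W.a x * Complex.normSq y := by rw [h1]; exact c_pos' hx.1
    have hcont : Continuous fun s : ℝ => (s * y : ℂ) := by fun_prop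
    have hlim : Tendsto (fun s : ℝ => (s * y : ℂ)) (𝓝 1) (𝓝 y) := by
      simpa using hcont.tendsto 1
    have hlt : ∀ᶠ s : ℝ in 𝓝[<] 1, 0 < s ∧ s < 1 := by
      filter_upwards [nhdsWithin_le_nhds (Ioi_mem_nhds one_pos), self_mem_nhdsWithin]
        with s h1 h2 using ⟨h1, h2⟩
    have hsmall : ∀ᶠ s : ℝ in 𝓝[<] 1, W.a x * Complex.normSq (s * y) < W.c x := by
      filter_upwards [hlt] with s hs
      rw [hsc]
      nlinarith [mul_pos hs.1 (sub_pos.2 hs.2), mul_pos hnpos (sub_pos.2 hs.2),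
        mul_pos hnpos (mul_pos hs.1 (sub_pos.2 hs.2))]
    have hlarge : ∀ᶠ s : ℝ in 𝓝[>] 1, W.c x < W.a x * Complex.normSq (s * y) := by
      filter_upwards [self_mem_nhdsWithin] with s (hs : 1 < s)
      rw [hsc]
      nlinarith [mul_pos hnpos (sub_pos.2 hs), mul_pos hnpos (mul_pos (sub_pos.2 hs)
        (sub_pos.2 hs))]
    have hlim1 := hlim.mono_left (nhdsWithin_le_nhds (s := Iio 1))
    have hlim2 := hlim.mono_left (nhdsWithin_le_nhds (s := Ioi 1))
    rcases eq_or_eq_of_d_nonneg hx hd.ge with rfl | rfl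
    · have hneg : y.re < 0 := by
        refine lt_of_le_of_ne ?_ hre0
        by_contra! hpos
        nlinarith [W.b_x₁, mul_pos ha hpos]
      refine ⟨mem_closure_of_tendsto hlim1 ?_, mem_closure_of_tendsto hlim2 ?_⟩
      · filter_upwards [hsmall, hlt] with s h3 h4
        have e : (s * y : ℂ) = (-((s * -y.re : ℝ) : ℂ)) := by
          conv_lhs => rw [hyre]
          push_cast; ring
        have e2 : Complex.normSq (s * y) = (s * -y.re) ^ 2 := by rw [hsc, hnre]; ring
        rw [mem_compl_iff, e, neg_ofReal_mem_outer (by nlinarith), ← e2]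
        exact not_le.2 h3
      · filter_upwards [hlarge] with s h3 using notMem_inner_of_lt h3
    · have hpos : 0 < y.re := by
        by_contra! hneg
        nlinarith [W.b_x₂, mul_nonneg ha.le (neg_nonneg.2 hneg)]
      refine ⟨mem_closure_of_tendsto hlim1 ?_, mem_closure_of_tendsto hlim2 ?_⟩
      · filter_upwards [hsmall] with s h3 using notMem_outer_of_lt h3
      · filter_upwards [hlarge, self_mem_nhdsWithin] with s h3 (h4 : 1 < s)
        have e : (s * y : ℂ) = ((s * y.re : ℝ) : ℂ) := by
          conv_lhs => rw [hyre]
          push_cast; ring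
        have e2 : Complex.normSq (s * y) = (s * y.re) ^ 2 := by rw [hsc, hnre]; ring
        rw [mem_compl_iff, e, ofReal_mem_inner (by nlinarith), ← e2]
        exact not_le.2 h3
  · obtain ⟨s, hs, hsy⟩ := exists_circlePoint_eq y
    have hre : y.re ^ 2 < ‖y‖ ^ 2 := by
      rw [Complex.sq_norm, Complex.normSq_apply]
      have : 0 < y.im ^ 2 := by positivity
      nlinarith
    have hd : W.d x ≠ 0 := fun h => him (im_eq_zero_of_d hx.1 h1 h2 h)
    have hx1 : W.x₁ < x := lt_of_le_of_ne hx.1 (by rintro rfl; exact hd W.d_x₁)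
    have hx2 : x < W.x₂ := lt_of_le_of_ne hx.2 (by rintro rfl; exact hd W.d_x₂)
    have hlim : Tendsto (circlePoint ‖y‖ s) (𝓝 y.re) (𝓝 y) := by
      conv_rhs => rw [← hsy]
      exact (continuous_circlePoint _ _).tendsto _
    have hnorm : ∀ᶠ u in 𝓝 y.re, Complex.normSq (circlePoint ‖y‖ s u) = Complex.normSq y := by
      have : ∀ᶠ u : ℝ in 𝓝 y.re, u ^ 2 < ‖y‖ ^ 2 :=
        ((continuous_pow 2).tendsto y.re).eventually (gt_mem_nhds hre)
      filter_upwards [this] with u hu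
      rw [normSq_circlePoint hs hu.le, Complex.sq_norm]
    refine ⟨mem_closure_of_tendsto (hlim.mono_left (nhdsWithin_le_nhds (s := Iio y.re))) ?_,
      mem_closure_of_tendsto (hlim.mono_left (nhdsWithin_le_nhds (s := Ioi y.re))) ?_⟩
    · filter_upwards [nhdsWithin_le_nhds hnorm, self_mem_nhdsWithin] with u h3 (h4 : u < y.re)
      rintro (h5 | ⟨x', hx', h5, h6⟩)
      · rw [mem_ofPred_eq, h3] at h5
        exact absurd (lt_of_le_of_lt_point le_rfl h5 hx1) (by linarith)
      · rw [h3] at h5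
        obtain rfl := eq_of_norm_eq hx.1 hx'.1 h1 h5
        simp only [circlePoint] at h6
        nlinarith
    · filter_upwards [nhdsWithin_le_nhds hnorm, self_mem_nhdsWithin] with u h3 (h4 : y.re < u)
      rintro (h5 | ⟨x', hx', h5, h6⟩)
      · rw [mem_ofPred_eq, h3] at h5
        exact absurd (lt_of_le_of_gt_point hx.1 h5 hx2) (by linarith)
      · rw [h3] at h5
        obtain rfl := eq_of_norm_eq hx.1 hx'.1 h1 h5
        simp only [circlePoint] at h6
        nlinarith

end Weights
-- Analytic charts at the points of the curve
namespace Weights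

variable (W : Weights)

/-- The derivative of the kernel with respect to `x`. -/
def Kx (x y : ℂ) : ℂ := 2 * (W.C * y ^ 2 + W.E * y) * x + (W.A * y ^ 2 + W.B - y)

/-- A local parametrization of a neighbourhood of `y₀` by a neighbourhood of `0`, which maps the
real axis to the curve, and the upper and lower sides to the two sides of the curve. -/
structure IsChart (y₀ : ℂ) (ψ : ℂ → ℂ) : Prop where
  analytic : AnalyticAt ℂ ψ 0
  deriv_ne : deriv ψ 0 ≠ 0
  zero : ψ 0 = y₀
  sides : ∀ᶠ z in 𝓝 (0 : ℂ), (z.im = 0 → ψ z ∈ W.curve) ∧ (0 < z.im → ψ z ∈ W.domain) ∧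
    (z.im < 0 → ψ z ∉ W.inner)

variable {W}

section CurvePoint

variable {x : ℝ} {y : ℂ} (hx : x ∈ Icc W.x₁ W.x₂) (hK : W.K x y = 0)
include hx hK

lemma a_pos_of_K : 0 < W.a x := a_pos_of_eq hx.1 ((K_eq_zero_iff hx).1 hK).1

lemma x_pos_of_K : 0 < x := by
  refine lt_of_le_of_ne (W.x₁_nonneg.trans hx.1) fun h => ?_
  have := a_pos_of_K hx hK
  rw [← h] at this
  simp [a] at this

lemma y_ne_zero_of_K : y ≠ 0 := by
  rintro rfl
  have h := ((K_eq_zero_iff hx).1 hK).1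
  have := c_pos' hx.1
  simp at h
  linarith

/-- Otherwise K reduces to x(Ay² + B - y) with y = -E/C ≤ 0, where all three terms are non-negative;
this forces y = 0, which is not on the curve. -/
lemma coeff_ne_zero_of_K : W.C * y + W.E ≠ 0 := by
  intro h
  have hx0 := x_pos_of_K hx hK
  have hb : (W.A * y ^ 2 + W.B - y : ℂ) = 0 := by
    have h1 : (W.A * y ^ 2 + W.B - y : ℂ) * x = 0 := by
      unfold K at hK
      linear_combination hK - (y * x ^ 2 + 1) * h
    exact (mul_eq_zero.1 h1).resolve_right (by exact_mod_cast hx0.ne')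
  have hC : W.C ≠ 0 := by
    intro hC
    have := W.CE_pos
    rw [hC] at h this
    simp at h this
    linarith
  have hC' : (W.C : ℂ) ≠ 0 := by exact_mod_cast hC
  have hy : y = ((-W.E / W.C : ℝ) : ℂ) := by
    push_cast
    field_simp
    linear_combination h
  set r := -W.E / W.C with hr
  have hr0 : r ≤ 0 := div_nonpos_of_nonpos_of_nonneg (by linarith [W.E_nonneg]) W.C_nonneg
  have hb' : W.A * r ^ 2 + W.B - r = 0 := by
    rw [hy] at hb
    exact_mod_cast hb
  have h1 : 0 ≤ W.A * r ^ 2 := mul_nonneg W.A_nonneg (sq_nonneg r)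
  have h2 := W.B_nonneg
  have : r = 0 := by linarith
  exact y_ne_zero_of_K hx hK (by rw [hy, this]; simp)

lemma sq_mul_ne_one_of_K : (x : ℂ) ^ 2 * y ≠ 1 := by
  intro h
  have hx0 := x_pos_of_K hx hK
  obtain ⟨h1, h2⟩ := (K_eq_zero_iff hx).1 hK
  have hy : y = ((x ^ 2)⁻¹ : ℝ) := by
    have : (x : ℂ) ≠ 0 := by exact_mod_cast hx0.ne'
    push_cast
    field_simp
    linear_combination h
  have hre : y.re = (x ^ 2)⁻¹ := by rw [hy, Complex.ofReal_re]
  refine not_critical (W := W) (y := y.re) hx0 (hx.2.trans_lt W.x₂_lt_one) ?_ h2 ?_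
  · have : Complex.normSq y = y.re ^ 2 := by
      rw [hre, hy, Complex.normSq_ofReal]; ring
    rw [this] at h1
    linear_combination y.re * h2 - h1
  · rw [hre]; field_simp

/-- As a quadratic in x, the kernel has leading coefficient y(Cy + E) and constant term Cy + E, so
x·K_x = (Cy + E)(x²y - 1) where K = 0. -/
lemma Kx_ne_zero_of_K : W.Kx x y ≠ 0 := by
  intro h
  have h1 : (W.C * y + W.E) * ((x : ℂ) ^ 2 * y - 1) = x * W.Kx x y := by
    unfold Kx
    unfold K at hK
    linear_combination -hK
  rw [h, mul_zero] at h1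
  rcases mul_eq_zero.1 h1 with h2 | h2
  · exact coeff_ne_zero_of_K hx hK h2
  · exact sq_mul_ne_one_of_K hx hK (sub_eq_zero.1 h2)

end CurvePoint

/-- Vieta: the two roots in x have product 1/y. -/
lemma eq_or_mul_eq_one_of_K {x x' y : ℂ} (hy : W.C * y + W.E ≠ 0) (h : W.K x y = 0)
    (h' : W.K x' y = 0) : x = x' ∨ x' * (x * y) = 1 := by
  by_cases hxx : x = x'
  · exact Or.inl hxx
  right
  have hsub : x - x' ≠ 0 := sub_ne_zero.2 hxx
  have h1 : (W.A * y ^ 2 + W.B - y : ℂ) + (W.C * y + W.E) * (y * (x + x')) = 0 := by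
    refine (mul_eq_zero.1 ?_).resolve_left hsub
    unfold K at h h'
    linear_combination h - h'
  have h2 : (W.C * y + W.E) * (x' * (x * y) - 1) = 0 := by
    unfold K at h
    linear_combination x * h1 - h
  exact sub_eq_zero.1 ((mul_eq_zero.1 h2).resolve_left hy)

/-- A parametrization by points of the kernel curve whose first coordinate is in the real interval
exactly on the real axis yields a chart, possibly after a rotation by `π`. -/
lemma isChart_or_isChart_neg {ξ ψ : ℂ → ℂ} {x₀ : ℝ} {y₀ : ℂ} (hx₀ : x₀ ∈ Icc W.x₁ W.x₂)
    (hK₀ : W.K x₀ y₀ = 0) (hξ : ContinuousAt ξ 0) (hψ : AnalyticAt ℂ ψ 0) (hψ' : deriv ψ 0 ≠ 0)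
    (hξ0 : ξ 0 = x₀) (hψ0 : ψ 0 = y₀) (hK : ∀ᶠ z in 𝓝 0, W.K (ξ z) (ψ z) = 0)
    (hreal : ∀ᶠ z : ℂ in 𝓝 0, z.im = 0 ↔ ∃ x ∈ Icc W.x₁ W.x₂, ξ z = (x : ℝ)) :
    W.IsChart y₀ ψ ∨ W.IsChart y₀ fun z => ψ (-z) := by
  have hx0 : (x₀ : ℂ) ≠ 0 := by exact_mod_cast (x_pos_of_K hx₀ hK₀).ne'
  have hy0 := y_ne_zero_of_K hx₀ hK₀
  have hcurve : y₀ ∈ W.curve := ⟨x₀, hx₀, hK₀⟩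
  have hψc : ContinuousAt ψ 0 := hψ.continuousAt
  have hprod : ContinuousAt (fun z => (ξ z * ψ z)⁻¹) 0 :=
    (hξ.mul hψc).inv₀ (by rw [Pi.mul_apply, hξ0, hψ0]; exact mul_ne_zero hx0 hy0)
  have hclosed : IsClosed ((fun x : ℝ => (x : ℂ)) '' Icc W.x₁ W.x₂) :=
    (isCompact_Icc.image Complex.continuous_ofReal).isClosed
  -- The second root in x over ψ(z) is 1/(ξ(z)ψ(z)). If at z = 0 it were in [x₁, x₂], it would equal
  -- x₀, giving x₀²y₀ = 1. So near 0 only ξ(z) decides whether ψ(z) is on the curve.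
  have hnot : (ξ 0 * ψ 0)⁻¹ ∉ (fun x : ℝ => (x : ℂ)) '' Icc W.x₁ W.x₂ := by
    rintro ⟨x', hx', he⟩
    simp only [hξ0, hψ0] at he
    have hne : (x' : ℂ) * (x₀ * y₀) = 1 := by
      rw [he]; exact inv_mul_cancel₀ (mul_ne_zero hx0 hy0)
    have hK' : W.K x' y₀ = 0 := by
      have h1 : (x₀ : ℂ) ^ 2 * y₀ * W.K x' y₀ = 0 := by
        unfold K at hK₀ ⊢
        linear_combination hK₀ + (W.C * y₀ + W.E) * (x' * (x₀ * y₀) + 1) * hne +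
          (W.A * y₀ ^ 2 + W.B - y₀) * x₀ * hne
      exact (mul_eq_zero.1 h1).resolve_left (mul_ne_zero (pow_ne_zero 2 hx0) hy0)
    have := eq_of_norm_eq hx'.1 hx₀.1 ((K_eq_zero_iff hx').1 hK').1 ((K_eq_zero_iff hx₀).1 hK₀).1
    rw [this] at hne
    exact sq_mul_ne_one_of_K hx₀ hK₀ (by linear_combination hne)
  have hoff : ∀ᶠ z in 𝓝 (0 : ℂ), (ξ z * ψ z)⁻¹ ∉ (fun x : ℝ => (x : ℂ)) '' Icc W.x₁ W.x₂ :=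
    hprod.eventually (hclosed.isOpen_compl.mem_nhds hnot)
  have hcoef : ∀ᶠ z in 𝓝 (0 : ℂ), W.C * ψ z + W.E ≠ 0 := by
    have : ContinuousAt (fun z => (W.C : ℂ) * ψ z + W.E) 0 :=
      (continuousAt_const.mul hψc).add continuousAt_const
    exact this.eventually_ne (by rw [hψ0]; exact coeff_ne_zero_of_K hx₀ hK₀)
  have hiff : ∀ᶠ z in 𝓝 (0 : ℂ), z.im = 0 ↔ ψ z ∈ W.curve := by
    filter_upwards [hoff, hcoef, hK, hreal] with z h1 h2 h3 h4
    rw [h4]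
    constructor
    · rintro ⟨x, hx, he⟩
      exact ⟨x, hx, he ▸ h3⟩
    · rintro ⟨x, hx, hx'⟩
      rcases eq_or_mul_eq_one_of_K h2 h3 hx' with he | he
      · exact ⟨x, hx, he⟩
      · exact absurd ⟨x, hx, eq_inv_of_mul_eq_one_left he⟩ h1
  obtain ⟨δ, hδ, hball⟩ := Metric.eventually_nhds_iff_ball.1
    (hiff.and (hψ.eventually_analyticAt))
  have hcont : ContinuousOn ψ (Metric.ball 0 δ) := fun z hz =>
    (hball z hz).2.continuousAt.continuousWithinAt
  have hside : ∀ S : Set ℂ, Convex ℝ S → S ⊆ Metric.ball 0 δ → (∀ z ∈ S, z.im ≠ 0) →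
      ψ '' S ⊆ W.outerᶜ ∨ ψ '' S ⊆ W.innerᶜ := by
    intro S hS hSb him
    refine (hS.isPreconnected.image ψ (hcont.mono hSb)).subset_or_subset
      isClosed_outer.isOpen_compl isClosed_inner.isOpen_compl ?_ ?_
    · rw [disjoint_compl_left_iff_subset, compl_subset_iff_union, inner_union_outer]
    · rintro _ ⟨z, hz, rfl⟩
      exact notMem_curve_iff.1 fun h => him z hz ((hball z (hSb hz)).1.2 h)
  have hup := hside (upperBall δ) (convex_upperBall δ) inter_subset_left
    fun z hz => ne_of_gt hz.2
  have hlow := hside (lowerBall δ) (convex_lowerBall δ) inter_subset_left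
    fun z hz => ne_of_lt hz.2
  have hnhds : ψ '' Metric.ball 0 δ ∈ 𝓝 y₀ := by
    have := hψ.hasStrictDerivAt.map_nhds_eq hψ'
    rw [hψ0] at this
    rw [← this]
    exact image_mem_map (Metric.ball_mem_nhds 0 hδ)
  obtain ⟨hcl1, hcl2⟩ := mem_closure_sides hcurve
  have hsplit : ∀ z ∈ Metric.ball (0 : ℂ) δ, z ∈ upperBall δ ∨ z ∈ lowerBall δ ∨
      ψ z ∈ W.curve := by
    intro z hz
    rcases lt_trichotomy z.im 0 with h | h | h
    · exact Or.inr (Or.inl ⟨hz, h⟩)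
    · exact Or.inr (Or.inr ((hball z hz).1.1 h))
    · exact Or.inl ⟨hz, h⟩
  -- Each half-ball goes to one side by connectedness. The same side twice is impossible, since y₀
  -- is in the closure of both sides; the remaining two cases differ by z ↦ -z.
  rcases hup with hu | hu <;> rcases hlow with hl | hl
  · exfalso
    obtain ⟨w, ⟨z, hz, rfl⟩, hw⟩ := mem_closure_iff_nhds.1 hcl2 _ hnhds
    rcases hsplit z hz with h | h | h
    · exact hw (mem_inner_of_notMem_outer (hu ⟨z, h, rfl⟩))
    · exact hw (mem_inner_of_notMem_outer (hl ⟨z, h, rfl⟩))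
    · exact hw (curve_subset_inner h)
  · left
    refine ⟨hψ, hψ', hψ0, ?_⟩
    filter_upwards [Metric.ball_mem_nhds 0 hδ] with z hz
    refine ⟨(hball z hz).1.1, fun h => ?_, fun h => hl ⟨z, ⟨hz, h⟩, rfl⟩⟩
    rw [domain_eq]
    exact hu ⟨z, ⟨hz, h⟩, rfl⟩
  · right
    have hψneg : AnalyticAt ℂ ψ (-0) := by rwa [neg_zero]
    refine ⟨hψneg.comp_of_eq analyticAt_id.neg rfl, ?_, by simpa using hψ0, ?_⟩
    · rw [deriv_comp_neg]
      simpa using hψ'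
    · filter_upwards [Metric.ball_mem_nhds 0 hδ] with z hz
      have hz' : -z ∈ Metric.ball (0 : ℂ) δ := by simpa using hz
      refine ⟨fun h => (hball _ hz').1.1 (by simpa using h), fun h => ?_, fun h => ?_⟩
      · rw [domain_eq]
        exact hl ⟨-z, ⟨hz', by simpa using h⟩, rfl⟩
      · exact hu ⟨-z, ⟨hz', by simpa using h⟩, rfl⟩
  · exfalso
    obtain ⟨w, ⟨z, hz, rfl⟩, hw⟩ := mem_closure_iff_nhds.1 hcl1 _ hnhds
    rcases hsplit z hz with h | h | h
    · exact hw (mem_outer_of_notMem_inner (hu ⟨z, h, rfl⟩))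
    · exact hw (mem_outer_of_notMem_inner (hl ⟨z, h, rfl⟩))
    · exact hw (curve_subset_outer h)

/-- Such a parametrization also determines the tangent direction. -/
lemma exists_isChart_of_param {ξ ψ : ℂ → ℂ} {x₀ ρ : ℝ} {y₀ : ℂ} (hx₀ : x₀ ∈ Icc W.x₁ W.x₂)
    (hK₀ : W.K x₀ y₀ = 0) (hξ : ContinuousAt ξ 0) (hψ : AnalyticAt ℂ ψ 0) (hρ : ρ ≠ 0)
    (hψ' : deriv ψ 0 = Complex.I * ρ * W.Kx x₀ y₀)
    (hξ0 : ξ 0 = x₀) (hψ0 : ψ 0 = y₀) (hK : ∀ᶠ z in 𝓝 0, W.K (ξ z) (ψ z) = 0)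
    (hreal : ∀ᶠ z : ℂ in 𝓝 0, z.im = 0 ↔ ∃ x ∈ Icc W.x₁ W.x₂, ξ z = (x : ℝ)) :
    ∃ (φ : ℂ → ℂ) (σ : ℝ), W.IsChart y₀ φ ∧ deriv φ 0 = Complex.I * σ * W.Kx x₀ y₀ := by
  have hne : deriv ψ 0 ≠ 0 := by
    rw [hψ']
    exact mul_ne_zero (mul_ne_zero Complex.I_ne_zero (by exact_mod_cast hρ))
      (Kx_ne_zero_of_K hx₀ hK₀)
  rcases isChart_or_isChart_neg hx₀ hK₀ hξ hψ hne hξ0 hψ0 hK hreal with h | h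
  · exact ⟨ψ, ρ, h, hψ'⟩
  · refine ⟨_, -ρ, h, ?_⟩
    rw [deriv_comp_neg, neg_zero, hψ']
    push_cast; ring

/-- Solving the kernel equation for `y`. -/
lemma K_eq_zero_of_sq {x q : ℂ} (ha : W.A * x + W.C * x ^ 2 ≠ 0)
    (hq : q ^ 2 = (W.C + W.E * x ^ 2 - x) ^ 2 - 4 * (W.A * x + W.C * x ^ 2) * (W.B * x + W.E)) :
    W.K x ((-(W.C + W.E * x ^ 2 - x) + q) / (2 * (W.A * x + W.C * x ^ 2))) = 0 := by
  set α := W.A * x + W.C * x ^ 2 with hα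
  set y := (-(W.C + W.E * x ^ 2 - x) + q) / (2 * α) with hy
  have h1 : 2 * α * y = -(W.C + W.E * x ^ 2 - x) + q := by
    rw [hy]; field_simp
  have h2 : 4 * α * W.K x y = 0 := by
    have e : W.K x y = α * y ^ 2 + (W.C + W.E * x ^ 2 - x) * y + (W.B * x + W.E) := by
      unfold K; rw [hα]; ring
    rw [e]
    linear_combination (2 * α * y + (W.C + W.E * x ^ 2 - x) + q) * h1 + hq
  exact (mul_eq_zero.1 h2).resolve_left (by simpa using ha)

end Weights
namespace Weights

variable {W : Weights}

/-- Here x = x₀ + z itself is a parameter, as d(x₀) ≠ 0. Differentiating K = 0 gives K_x + K_y ψ' =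
0, and K_y = 2ay₀ + b is purely imaginary. -/
lemma exists_isChart_interior {x₀ : ℝ} {y₀ : ℂ} (hx₀ : x₀ ∈ Ioo W.x₁ W.x₂)
    (hK₀ : W.K x₀ y₀ = 0) :
    ∃ (φ : ℂ → ℂ) (σ : ℝ), W.IsChart y₀ φ ∧ deriv φ 0 = Complex.I * σ * W.Kx x₀ y₀ := by
  have hx₀' := Ioo_subset_Icc_self hx₀
  obtain ⟨h1, h2⟩ := (K_eq_zero_iff hx₀').1 hK₀
  have hd := d_neg hx₀
  have ha := a_pos_of_K hx₀' hK₀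
  set m : ℝ := 2 * W.a x₀ * y₀.im with hm
  have hmd : m ^ 2 = -W.d x₀ := by
    rw [Complex.normSq_apply] at h1
    unfold d
    linear_combination (W.b x₀ - 2 * W.a x₀ * y₀.re) * h2 + 4 * W.a x₀ * h1
  have hm0 : m ≠ 0 := by
    intro h; rw [h] at hmd; simp at hmd; linarith
  have hm0' : (m : ℂ) ≠ 0 := by exact_mod_cast hm0
  have hqy : 2 * W.a x₀ * y₀ + W.b x₀ = Complex.I * m := by
    apply Complex.ext
    · simp; linear_combination h2
    · simp [hm]
  set α : ℂ → ℂ := fun z => W.A * (x₀ + z) + W.C * (x₀ + z) ^ 2 with hα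
  set β : ℂ → ℂ := fun z => W.C + W.E * (x₀ + z) ^ 2 - (x₀ + z) with hβ
  set D : ℂ → ℂ := fun z => β z ^ 2 - 4 * α z * (W.B * (x₀ + z) + W.E) with hD
  have hα0 : α 0 = W.a x₀ := by simp [hα, a]
  have hβ0 : β 0 = W.b x₀ := by simp [hβ, b]
  have hD0 : D 0 = W.d x₀ := by simp [hD, hα0, hβ0, d, c]
  have hα0' : α 0 ≠ 0 := by rw [hα0]; exact_mod_cast ha.ne'
  have hD0' : D 0 ≠ 0 := by rw [hD0]; exact_mod_cast hd.ne
  have hαan : AnalyticAt ℂ α 0 := by rw [hα]; fun_prop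
  have hβan : AnalyticAt ℂ β 0 := by rw [hβ]; fun_prop
  have hDan : AnalyticAt ℂ D 0 := by rw [hD]; fun_prop
  -- The branch of √d near x₀ with value 2ay₀ + b at x₀; normalising by D 0 keeps the principal root
  -- away from its cut.
  set q : ℂ → ℂ := fun z => Complex.I * m * (D z / D 0) ^ (2⁻¹ : ℂ) with hq
  have hqan : AnalyticAt ℂ q 0 := by
    refine analyticAt_const.mul ((hDan.div analyticAt_const hD0').cpow analyticAt_const ?_)
    simp [div_self hD0']
  have hq2 : ∀ z, q z ^ 2 = D z := by
    intro z
    have : ((D z / D 0) ^ (2⁻¹ : ℂ)) ^ 2 = D z / D 0 := by simp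
    have hmc : (m : ℂ) ^ 2 = -D 0 := by rw [hD0]; exact_mod_cast hmd
    rw [hq]
    simp only [mul_pow, Complex.I_sq, this, hmc]
    field_simp
  have hq0 : q 0 = Complex.I * m := by simp [hq, div_self hD0']
  set ψ : ℂ → ℂ := fun z => (-β z + q z) / (2 * α z) with hψ
  have hψan : AnalyticAt ℂ ψ 0 :=
    (hβan.neg.add hqan).div (analyticAt_const.mul hαan) (by simpa using hα0')
  have hψ0 : ψ 0 = y₀ := by
    rw [hψ]
    simp only
    rw [hq0, ← hqy, hα0, hβ0]
    have : (W.a x₀ : ℂ) ≠ 0 := by exact_mod_cast ha.ne'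
    field_simp; ring
  have hK : ∀ᶠ z in 𝓝 0, W.K (x₀ + z) (ψ z) = 0 := by
    filter_upwards [hαan.continuousAt.eventually_ne hα0'] with z hz
    exact K_eq_zero_of_sq hz (hq2 z)
  have hderiv : deriv ψ 0 = Complex.I * (m⁻¹ : ℝ) * W.Kx x₀ y₀ := by
    have hX : HasDerivAt (fun z : ℂ => (x₀ : ℂ) + z) 1 0 := (hasDerivAt_id 0).const_add _
    have hY := hψan.differentiableAt.hasDerivAt
    have hXY := ((((hX.mul (hY.pow 2)).const_mul (W.A : ℂ)).add (hX.const_mul (W.B : ℂ))).add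
      ((((hX.pow 2).mul (hY.pow 2)).add hY).const_mul (W.C : ℂ))).add
      ((((hX.pow 2).mul hY).const_add 1).const_mul (W.E : ℂ)) |>.sub (hX.mul hY)
    have h0 : HasDerivAt (fun _ : ℂ => (0 : ℂ)) _ 0 := hXY.congr_of_eventuallyEq
      (hK.mono fun z hz => hz.symm)
    have h3 := h0.unique (hasDerivAt_const 0 0)
    simp only [Pi.pow_apply, add_zero, hψ0] at h3
    have h4 : W.Kx x₀ y₀ + (2 * W.a x₀ * y₀ + W.b x₀) * deriv ψ 0 = 0 := by
      unfold Kx a b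
      push_cast at h3 ⊢
      linear_combination h3
    rw [hqy] at h4
    have hI := Complex.I_sq
    push_cast
    field_simp
    linear_combination -Complex.I * h4 + (m * deriv ψ 0) * hI
  refine exists_isChart_of_param (ξ := fun z => x₀ + z) hx₀' hK₀ (by fun_prop) hψan
    (inv_ne_zero hm0) hderiv (by simp) hψ0 hK ?_
  filter_upwards [Metric.ball_mem_nhds (0 : ℂ)
    (lt_min (sub_pos.2 hx₀.1) (sub_pos.2 hx₀.2))] with z hz
  rw [mem_ball_zero_iff, lt_min_iff] at hz
  constructor
  · intro him
    have habs := abs_le.1 (Complex.abs_re_le_norm z)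
    exact ⟨x₀ + z.re, ⟨by linarith, by linarith⟩, Complex.ext (by simp) (by simpa using him)⟩
  · rintro ⟨x, -, hx⟩
    simpa using congrArg Complex.im hx

/-- The quotient of `d(x) - d(x₀)` by `x - x₀`. -/
def dQuot {R : Type*} [CommRing R] (A B C E x₀ x : R) : R :=
  E ^ 2 * (x ^ 3 + x ^ 2 * x₀ + x * x₀ ^ 2 + x₀ ^ 3) - (2 * E + 4 * C * B) * (x ^ 2 + x * x₀ + x₀ ^ 2)
    + (1 + 2 * C * E - 4 * (A * B + C * E)) * (x + x₀) - (2 * C + 4 * A * E)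

lemma d_sub_eq (x₀ x : ℝ) :
    W.d x - W.d x₀ = (x - x₀) * dQuot W.A W.B W.C W.E x₀ x := by
  unfold d a b c dQuot; ring

/-- At a simple root of d the substitution x = x₀ + σz² makes √d(x) analytic in z, and x is in [x₁,
x₂] exactly when z is real, σ being the inward direction. -/
lemma exists_isChart_endpoint {x₀ σ : ℝ} {y₀ : ℂ} (hx₀ : x₀ ∈ Icc W.x₁ W.x₂)
    (hd : W.d x₀ = 0) (hσ2 : σ ^ 2 = 1) (hσ : σ * dQuot W.A W.B W.C W.E x₀ x₀ ≤ 0)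
    (hnear : ∀ᶠ s : ℝ in 𝓝 0, x₀ + σ * s ∈ Icc W.x₁ W.x₂ ↔ 0 ≤ s)
    (hK₀ : W.K x₀ y₀ = 0) :
    ∃ (φ : ℂ → ℂ) (σ : ℝ), W.IsChart y₀ φ ∧ deriv φ 0 = Complex.I * σ * W.Kx x₀ y₀ := by
  obtain ⟨h1, h2⟩ := (K_eq_zero_iff hx₀).1 hK₀
  have ha := a_pos_of_K hx₀ hK₀
  have him := im_eq_zero_of_d hx₀.1 h1 h2 hd
  have hyre : y₀ = (y₀.re : ℂ) := Complex.ext rfl (by simpa using him)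
  -- At the double root y₀ one has d'(x₀) = -4a(x₀)K_x(x₀, y₀), so non-vanishing of K_x shows that
  -- the root of d is simple.
  have hKxre : ∃ κ : ℝ, W.Kx x₀ y₀ = κ ∧ dQuot W.A W.B W.C W.E x₀ x₀ = -4 * W.a x₀ * κ := by
    refine ⟨2 * (W.C * y₀.re ^ 2 + W.E * y₀.re) * x₀ + (W.A * y₀.re ^ 2 + W.B - y₀.re), ?_, ?_⟩
    · rw [hyre]; simp [Kx]
    · have h3 : W.a x₀ * y₀.re ^ 2 + W.b x₀ * y₀.re + W.c x₀ = 0 := by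
        rw [Complex.normSq_apply, him] at h1
        linear_combination h2 * y₀.re - h1
      unfold a b c at h3
      unfold a b at h2
      unfold dQuot a
      linear_combination (2 * (2 * W.E * x₀ - 1) + 4 * (W.A + 2 * W.C * x₀) * y₀.re) * h2 -
        4 * (W.A + 2 * W.C * x₀) * h3
  obtain ⟨κ, hκ, hκQ⟩ := hKxre
  have hκ0 : κ ≠ 0 := by
    intro h
    exact Kx_ne_zero_of_K hx₀ hK₀ (by rw [hκ, h, Complex.ofReal_zero])
  set e₀ : ℝ := dQuot W.A W.B W.C W.E x₀ x₀ with he₀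
  have he0 : e₀ ≠ 0 := by
    rw [hκQ]; exact mul_ne_zero (by linarith) hκ0
  set μ : ℝ := Real.sqrt (-(σ * e₀)) with hμ
  have hμ2 : μ ^ 2 = -(σ * e₀) := Real.sq_sqrt (by linarith)
  have hσ0 : σ ≠ 0 := by rintro rfl; simp at hσ2
  have hμ0 : μ ≠ 0 := by
    intro h
    rw [h] at hμ2
    have : σ * e₀ = 0 := by linarith
    exact (mul_ne_zero hσ0 he0) this
  set ξ : ℂ → ℂ := fun z => x₀ + σ * z ^ 2 with hξ
  set α : ℂ → ℂ := fun z => W.A * ξ z + W.C * ξ z ^ 2 with hα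
  set β : ℂ → ℂ := fun z => W.C + W.E * ξ z ^ 2 - ξ z with hβ
  set D : ℂ → ℂ := fun z => dQuot (W.A : ℂ) W.B W.C W.E x₀ (ξ z) with hD
  have hξ0 : ξ 0 = x₀ := by simp [hξ]
  have hα0 : α 0 = W.a x₀ := by simp [hα, a, hξ0]
  have hβ0 : β 0 = W.b x₀ := by simp [hβ, b, hξ0]
  have hD0 : D 0 = e₀ := by simp only [hD, hξ0, he₀, dQuot]; push_cast; ring
  have hα0' : α 0 ≠ 0 := by rw [hα0]; exact_mod_cast ha.ne'
  have hD0' : D 0 ≠ 0 := by rw [hD0]; exact_mod_cast he0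
  have hξan : AnalyticAt ℂ ξ 0 := by rw [hξ]; fun_prop
  have hαan : AnalyticAt ℂ α 0 := by rw [hα]; fun_prop
  have hβan : AnalyticAt ℂ β 0 := by rw [hβ]; fun_prop
  have hDan : AnalyticAt ℂ D 0 := by simp only [hD, dQuot]; fun_prop
  set p : ℂ → ℂ := fun z => (D z / D 0) ^ (2⁻¹ : ℂ) with hp
  have hpan : AnalyticAt ℂ p 0 := by
    refine (hDan.div analyticAt_const hD0').cpow analyticAt_const ?_
    simp [div_self hD0']
  have hp0 : p 0 = 1 := by simp [hp, div_self hD0']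
  set q : ℂ → ℂ := fun z => Complex.I * μ * z * p z with hq
  have hqan : AnalyticAt ℂ q 0 := (analyticAt_const.mul analyticAt_id).mul hpan
  have hq2 : ∀ z, q z ^ 2 = β z ^ 2 - 4 * α z * (W.B * ξ z + W.E) := by
    intro z
    have h3 : p z ^ 2 = D z / D 0 := by simp [hp]
    have h4 : (μ : ℂ) ^ 2 = -(σ * D 0) := by rw [hD0]; exact_mod_cast hμ2
    have hd' : (((W.C + W.E * x₀ ^ 2 - x₀) ^ 2 -
        4 * (W.A * x₀ + W.C * x₀ ^ 2) * (W.B * x₀ + W.E) : ℝ) : ℂ) = 0 := by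
      exact_mod_cast hd
    have h5 : q z ^ 2 = (ξ z - x₀) * D z := by
      rw [hq]
      simp only [mul_pow, Complex.I_sq, h3, h4, hξ]
      field_simp
      ring
    rw [h5]
    push_cast at hd'
    simp only [hD, hβ, hα, dQuot]
    linear_combination -hd'
  have hq0 : q 0 = 0 := by simp [hq]
  set ψ : ℂ → ℂ := fun z => (-β z + q z) / (2 * α z) with hψ
  have hψan : AnalyticAt ℂ ψ 0 :=
    (hβan.neg.add hqan).div (analyticAt_const.mul hαan) (by simpa using hα0')
  have haC : (W.a x₀ : ℂ) ≠ 0 := by exact_mod_cast ha.ne'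
  have hψ0 : ψ 0 = y₀ := by
    have : (W.b x₀ : ℂ) = -(2 * W.a x₀ * y₀) := by
      rw [hyre]
      exact_mod_cast (by linarith : W.b x₀ = -(2 * W.a x₀ * y₀.re))
    rw [hψ]
    simp only
    rw [hq0, hα0, hβ0, this]
    field_simp
    ring
  have hK : ∀ᶠ z in 𝓝 0, W.K (ξ z) (ψ z) = 0 := by
    filter_upwards [hαan.continuousAt.eventually_ne hα0'] with z hz
    exact K_eq_zero_of_sq hz (hq2 z)
  have hderiv : deriv ψ 0 = Complex.I * (μ / (2 * W.a x₀ * κ) : ℝ) * W.Kx x₀ y₀ := by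
    have dξ : HasDerivAt ξ 0 0 := by
      have := (((hasDerivAt_id (0 : ℂ)).pow 2).const_mul (σ : ℂ)).const_add (x₀ : ℂ)
      exact this.congr_deriv (by simp)
    have dα : HasDerivAt α 0 0 := by
      exact ((dξ.const_mul (W.A : ℂ)).add ((dξ.pow 2).const_mul (W.C : ℂ))).congr_deriv (by simp)
    have dβ : HasDerivAt β 0 0 :=
      ((((dξ.pow 2).const_mul (W.E : ℂ)).const_add (W.C : ℂ)).sub dξ).congr_deriv (by simp)
    have dq : HasDerivAt q (Complex.I * μ) 0 :=
      (((hasDerivAt_id (0 : ℂ)).const_mul (Complex.I * μ)).mul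
        hpan.differentiableAt.hasDerivAt).congr_deriv (by simp [hp0])
    have := (dβ.neg.add dq).div (dα.const_mul (2 : ℂ)) (by simpa using hα0')
    have h6 : deriv ψ 0 = _ := this.deriv
    rw [h6, hκ, hα0]
    have hκC : (κ : ℂ) ≠ 0 := by exact_mod_cast hκ0
    push_cast
    field_simp
    ring
  have hρ : μ / (2 * W.a x₀ * κ) ≠ 0 :=
    div_ne_zero hμ0 (mul_ne_zero (by positivity) hκ0)
  refine exists_isChart_of_param (ξ := ξ) hx₀ hK₀ hξan.continuousAt hψan hρ hderiv hξ0 hψ0 hK ?_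
  have hlim : Tendsto (fun z : ℂ => (z ^ 2).re) (𝓝 0) (𝓝 0) := by
    have : Continuous fun z : ℂ => (z ^ 2).re := by fun_prop
    simpa using this.tendsto 0
  filter_upwards [hlim.eventually hnear] with z hz
  have hre : (z ^ 2).re = z.re ^ 2 - z.im ^ 2 := by rw [pow_two, Complex.mul_re]; ring
  have him2 : (z ^ 2).im = 2 * z.re * z.im := by rw [pow_two, Complex.mul_im]; ring
  constructor
  · intro h
    refine ⟨x₀ + σ * (z ^ 2).re, hz.2 (by rw [hre, h]; nlinarith [sq_nonneg z.re]), ?_⟩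
    apply Complex.ext
    · simp [hξ]
    · simp [hξ, him2, h]
  · rintro ⟨x, hx, he⟩
    have h3 := congrArg Complex.im he
    have h4 := congrArg Complex.re he
    simp only [hξ, Complex.add_im, Complex.add_re, Complex.im_ofReal_mul, Complex.re_ofReal_mul,
      Complex.ofReal_re, Complex.ofReal_im, zero_add, mul_eq_zero, hσ0, false_or, him2] at h3 h4
    rw [← h4] at hx
    have h5 := hz.1 hx
    rw [hre] at h5
    by_contra hne
    have h6 : z.re = 0 := by
      rcases h3 with h3 | h3
      · simpa using h3
      · exact absurd h3 hne
    rw [h6] at h5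
    have : 0 < z.im ^ 2 := by positivity
    linarith

/-- Every point of the curve has a chart, with a known tangent direction. -/
theorem exists_isChart {x₀ : ℝ} {y₀ : ℂ} (hx₀ : x₀ ∈ Icc W.x₁ W.x₂) (hK₀ : W.K x₀ y₀ = 0) :
    ∃ (φ : ℂ → ℂ) (σ : ℝ), W.IsChart y₀ φ ∧ deriv φ 0 = Complex.I * σ * W.Kx x₀ y₀ := by
  have hlt := W.x₁_lt_x₂
  have hcont : Continuous fun x : ℝ => dQuot W.A W.B W.C W.E x₀ x := by unfold dQuot; fun_prop
  rcases hx₀.1.eq_or_lt with h | h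
  · refine exists_isChart_endpoint (σ := 1) hx₀ (by rw [← h, d_x₁]) (by norm_num) ?_ ?_ hK₀
    -- The diagonal value of `dQuot` is d'(x₀); the other sign would make d positive just inside the
    -- interval.
    · by_contra! hpos
      rw [one_mul] at hpos
      have h1 : ∀ᶠ x in 𝓝[>] x₀, 0 < dQuot W.A W.B W.C W.E x₀ x :=
        nhdsWithin_le_nhds ((hcont.tendsto x₀).eventually (lt_mem_nhds hpos))
      have h2 : ∀ᶠ x in 𝓝[>] x₀, x < W.x₂ := nhdsWithin_le_nhds (Iio_mem_nhds (by linarith))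
      obtain ⟨x, ⟨h3, h4⟩, h5⟩ := ((h1.and h2).and self_mem_nhdsWithin).exists
      have h5' : x₀ < x := h5
      have h6 := d_sub_eq (W := W) x₀ x
      have h7 := d_neg (W := W) (x := x) ⟨by linarith, h4⟩
      have h8 : W.d x₀ = 0 := by rw [← h, d_x₁]
      nlinarith [mul_pos (sub_pos.2 h5') h3]
    · filter_upwards [Iio_mem_nhds (sub_pos.2 hlt)] with s (hs : s < _)
      rw [← h]
      constructor
      · intro h'; linarith [h'.1]
      · intro h'; exact ⟨by linarith, by linarith⟩
  rcases hx₀.2.eq_or_lt with h' | h'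
  · refine exists_isChart_endpoint (σ := -1) hx₀ (by rw [h', d_x₂]) (by norm_num) ?_ ?_ hK₀
    · by_contra! hpos
      have hpos' : dQuot W.A W.B W.C W.E x₀ x₀ < 0 := by linarith
      have h1 : ∀ᶠ x in 𝓝[<] x₀, dQuot W.A W.B W.C W.E x₀ x < 0 :=
        nhdsWithin_le_nhds ((hcont.tendsto x₀).eventually (gt_mem_nhds hpos'))
      have h2 : ∀ᶠ x in 𝓝[<] x₀, W.x₁ < x := nhdsWithin_le_nhds (Ioi_mem_nhds h)
      obtain ⟨x, ⟨h3, h4⟩, h5⟩ := ((h1.and h2).and self_mem_nhdsWithin).exists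
      have h5' : x < x₀ := h5
      have h6 := d_sub_eq (W := W) x₀ x
      have h7 := d_neg (W := W) (x := x) ⟨h4, by linarith⟩
      have h8 : W.d x₀ = 0 := by rw [h', d_x₂]
      nlinarith [mul_pos_of_neg_of_neg (sub_neg.2 h5') h3]
    · filter_upwards [Iio_mem_nhds (sub_pos.2 hlt)] with s (hs : s < _)
      rw [h']
      constructor
      · intro h''; linarith [h''.2]
      · intro h''; exact ⟨by linarith, by linarith⟩
  · exact exists_isChart_interior ⟨h, h'⟩ hK₀

end Weights

/-! ### Boundary behaviour of conformal maps and of g/g' -/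

/-- A conformal map onto the unit disc tends to the unit circle along any filter leaving every
compact subset of its domain. -/
lemma tendsto_norm_one_of_bijOn {G : Set ℂ} {g : ℂ → ℂ} {l : Filter ℂ} (hG : IsOpen G)
    (hg : AnalyticOnNhd ℂ g G) (hb : BijOn g G (Metric.ball 0 1)) (hl : G ∈ l)
    (hd : ∀ y ∈ G, Disjoint (𝓝 y) l) : Tendsto (fun y => ‖g y‖) l (𝓝 1) := by
  refine tendsto_order.2 ⟨fun a ha => ?_, fun a ha => ?_⟩
  -- By compactness it suffices to separate each ζ = g(y) from the image filter; g is open at y and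
  -- injective, so disjoint sets in 𝓝 y and l have disjoint images.
  · have hdis : Disjoint (𝓝ˢ (Metric.closedBall (0 : ℂ) a)) (map g l) := by
      rw [(isCompact_closedBall (0 : ℂ) a).disjoint_nhdsSet_left]
      intro ζ hζ
      obtain ⟨y, hy, rfl⟩ := hb.surjOn
        (Metric.closedBall_subset_ball ha hζ : ζ ∈ Metric.ball 0 1)
      obtain ⟨V, hV, V', hV', hVV⟩ := Filter.disjoint_iff.1 (hd y hy)
      have hne := deriv_ne_zero_of_injOn (hg y hy) (hG.mem_nhds hy) hb.injOn
      have hmap := (hg y hy).hasStrictDerivAt.map_nhds_eq hne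
      have h1 : g '' (V ∩ G) ∈ 𝓝 (g y) := by
        rw [← hmap]
        exact image_mem_map (inter_mem hV (hG.mem_nhds hy))
      refine Filter.disjoint_iff.2 ⟨_, h1, g '' (V' ∩ G), image_mem_map (inter_mem hV' hl), ?_⟩
      rw [Set.disjoint_left]
      rintro _ ⟨u, ⟨hu, hu'⟩, rfl⟩ ⟨v, ⟨hv, hv'⟩, hvu⟩
      rw [hb.injOn hv' hu' hvu] at hv
      exact Set.disjoint_left.1 hVV hu hv
    obtain ⟨s, hs, s', hs', hss⟩ := Filter.disjoint_iff.1 hdis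
    filter_upwards [mem_map.1 hs'] with y hy
    by_contra! hle
    exact Set.disjoint_left.1 hss (subset_of_mem_nhdsSet hs (by simpa using hle)) hy
  · filter_upwards [hl] with y hy
    exact (by simpa using hb.mapsTo hy : ‖g y‖ < 1).trans ha

lemma zero_mem_closure_upper : (0 : ℂ) ∈ closure {z : ℂ | 0 < z.im} :=
  closure_mono inter_subset_right (mem_closure_upperBall (δ := 1) (by simp) (by simp))

instance neBot_upper : (𝓝[{z : ℂ | 0 < z.im}] (0 : ℂ)).NeBot :=
  mem_closure_iff_nhdsWithin_neBot.1 zero_mem_closure_upper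

namespace Weights

variable {W : Weights}

lemma notMem_domain_of_mem_curve {y : ℂ} (hy : y ∈ W.curve) : y ∉ W.domain := fun h => h.1 hy

lemma disjoint_nhds_of_mem_curve {y y₀ : ℂ} (hy₀ : y₀ ∈ W.curve) (hy : y ∈ W.domain) :
    Disjoint (𝓝 y) (𝓝[W.domain] y₀) :=
  (disjoint_nhds_nhds.2 (by rintro rfl; exact notMem_domain_of_mem_curve hy₀ hy)).mono_right
    nhdsWithin_le_nhds

namespace IsChart

variable {y₀ : ℂ} {ψ : ℂ → ℂ} (h : W.IsChart y₀ ψ)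
include h

lemma mem_curve : y₀ ∈ W.curve := by
  have := h.sides.self_of_nhds.1 (by simp)
  rwa [h.zero] at this

lemma map_nhds : map ψ (𝓝 0) = 𝓝 y₀ := by
  rw [← h.zero]
  exact h.analytic.hasStrictDerivAt.map_nhds_eq h.deriv_ne

/-- Limits from within the domain thereby become limits at 0 from the upper half-plane. -/
lemma nhdsWithin_domain : 𝓝[W.domain] y₀ = map ψ (𝓝[{z | 0 < z.im}] 0) := by
  have h1 : 𝓝[{z : ℂ | 0 < z.im}] 0 = 𝓝[ψ ⁻¹' W.domain] 0 := by
    rw [nhdsWithin_eq_iff_eventuallyEq]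
    filter_upwards [h.sides] with z hz
    refine propext ⟨fun h1 => hz.2.1 h1, fun h1 => ?_⟩
    by_contra h2
    rcases (not_lt.1 h2).lt_or_eq with h3 | h3
    · have := hz.2.2 h3
      have h4 : ψ z ∈ W.domain := h1
      rw [domain_eq] at h4
      exact this (mem_inner_of_notMem_outer h4)
    · exact notMem_domain_of_mem_curve (hz.1 h3) h1
  rw [h1, nhdsWithin, nhdsWithin, ← h.map_nhds, ← comap_principal, Filter.push_pull]

lemma tendsto_iff {F : ℂ → ℂ} {l : Filter ℂ} :
    Tendsto F (𝓝[W.domain] y₀) l ↔ Tendsto (fun z => F (ψ z)) (𝓝[{z | 0 < z.im}] 0) l := by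
  rw [h.nhdsWithin_domain, tendsto_map'_iff]
  rfl

lemma neBot : (𝓝[W.domain] y₀).NeBot := by
  rw [h.nhdsWithin_domain]
  infer_instance

/-- A ball on which the chart is analytic and respects the sides of the curve. -/
lemma exists_ball : ∃ δ > 0, ∀ z ∈ Metric.ball (0 : ℂ) δ, AnalyticAt ℂ ψ z ∧
    (z.im = 0 → ψ z ∈ W.curve) ∧ (0 < z.im → ψ z ∈ W.domain) :=
  Metric.eventually_nhds_iff_ball.1 <| (h.analytic.eventually_analyticAt.and h.sides).mono
    fun _ hz => ⟨hz.1, hz.2.1, hz.2.2.1⟩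

end IsChart

lemma exists_chart {y : ℂ} (hy : y ∈ W.curve) : ∃ ψ, W.IsChart y ψ := by
  obtain ⟨x, hx, hK⟩ := hy
  obtain ⟨φ, -, hφ, -⟩ := exists_isChart hx hK
  exact ⟨φ, hφ⟩

lemma neBot_of_mem_curve {y : ℂ} (hy : y ∈ W.curve) : (𝓝[W.domain] y).NeBot := by
  obtain ⟨φ, hφ⟩ := exists_chart hy
  exact hφ.neBot

lemma mem_closure_domain {y : ℂ} (hy : y ∈ W.curve) : y ∈ closure W.domain :=
  mem_closure_iff_nhdsWithin_neBot.2 (neBot_of_mem_curve hy)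

lemma tendsto_upperBall {ψ : ℂ → ℂ} {δ : ℝ} (hball : ∀ z ∈ Metric.ball (0 : ℂ) δ,
    AnalyticAt ℂ ψ z ∧ (z.im = 0 → ψ z ∈ W.curve) ∧ (0 < z.im → ψ z ∈ W.domain))
    {x : ℝ} (hx : |x| < δ) :
    Tendsto ψ (𝓝[upperBall δ] (x : ℂ)) (𝓝[W.domain] (ψ x)) := by
  have hx' : (x : ℂ) ∈ Metric.ball (0 : ℂ) δ := by simpa using hx
  refine tendsto_nhdsWithin_iff.2
    ⟨(hball _ hx').1.continuousAt.tendsto.mono_left nhdsWithin_le_nhds, ?_⟩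
  filter_upwards [self_mem_nhdsWithin] with z hz
  exact (hball z hz.1).2.2 hz.2

lemma upperBall_neBot {δ x : ℝ} (hx : |x| < δ) : (𝓝[upperBall δ] (x : ℂ)).NeBot :=
  mem_closure_iff_nhdsWithin_neBot.1 (mem_closure_upperBall (by simpa using hx) (by simp))

lemma nhdsWithin_upperBall {δ : ℝ} (hδ : 0 < δ) :
    𝓝[upperBall δ] (0 : ℂ) = 𝓝[{z | 0 < z.im}] 0 := by
  rw [upperBall, inter_comm]
  exact nhdsWithin_inter_of_mem' (nhdsWithin_le_nhds (Metric.ball_mem_nhds 0 hδ))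

/-- A function on the domain which tends to the unit circle at the boundary extends, in a chart,
analytically across the curve. -/
lemma IsChart.exists_extension_circle {y₀ : ℂ} {ψ : ℂ → ℂ} (h : W.IsChart y₀ ψ) {g : ℂ → ℂ}
    (hg : AnalyticOnNhd ℂ g W.domain) (hlt : ∀ y ∈ W.domain, ‖g y‖ < 1)
    (hlim : ∀ y ∈ W.curve, Tendsto (fun z => ‖g z‖) (𝓝[W.domain] y) (𝓝 1)) :
    ∃ Γ : ℂ → ℂ, AnalyticAt ℂ Γ 0 ∧ (∀ᶠ x : ℝ in 𝓝 0, ‖Γ x‖ = 1) ∧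
      ∀ᶠ z in 𝓝 (0 : ℂ), 0 < z.im → Γ z = g (ψ z) := by
  obtain ⟨δ₀, hδ₀, hball₀⟩ := h.exists_ball
  have h0 := hlim y₀ h.mem_curve
  rw [h.nhdsWithin_domain, tendsto_map'_iff] at h0
  have hhalf : ∀ᶠ z in 𝓝 (0 : ℂ), 0 < z.im → 1 / 2 ≤ ‖g (ψ z)‖ := by
    have := h0.eventually (lt_mem_nhds (by norm_num : (1 / 2 : ℝ) < 1))
    rw [eventually_nhdsWithin_iff] at this
    exact this.mono fun z hz h => (hz h).le
  obtain ⟨δ₁, hδ₁, hball₁⟩ := Metric.eventually_nhds_iff_ball.1 hhalf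
  set δ := min δ₀ δ₁ with hδdef
  have hδ : 0 < δ := lt_min hδ₀ hδ₁
  have hball : ∀ z ∈ Metric.ball (0 : ℂ) δ,
      AnalyticAt ℂ ψ z ∧ (z.im = 0 → ψ z ∈ W.curve) ∧ (0 < z.im → ψ z ∈ W.domain) :=
    fun z hz => hball₀ z (Metric.ball_subset_ball (min_le_left _ _) hz)
  have hge : ∀ z ∈ upperBall δ, 1 / 2 ≤ ‖g (ψ z)‖ := fun z hz =>
    hball₁ z (Metric.ball_subset_ball (min_le_right _ _) hz.1) hz.2
  have hne : ∀ z ∈ upperBall δ, g (ψ z) ≠ 0 := fun z hz h0 => by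
    have := hge z hz
    rw [h0, norm_zero] at this
    linarith
  have hconj : ∀ z ∈ lowerBall δ, starRingEnd ℂ z ∈ upperBall δ := fun z hz =>
    ⟨by simpa using hz.1, by simpa using hz.2⟩
  have hfd : ∀ z ∈ upperBall δ, DifferentiableAt ℂ (fun z => g (ψ z)) z := fun z hz =>
    ((hg _ ((hball z hz.1).2.2 hz.2)).differentiableAt).comp z (hball z hz.1).1.differentiableAt
  have hnormlim : ∀ x : ℝ, |x| < δ →
      Tendsto (fun z => ‖g (ψ z)‖) (𝓝[upperBall δ] (x : ℂ)) (𝓝 1) := fun x hx =>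
    (hlim _ ((hball x (by simpa using hx)).2.1 (by simp))).comp (tendsto_upperBall hball hx)
  -- The second function is the reflection in the unit circle. The lower bound 1/2 for |g∘ψ| keeps
  -- it bounded by 2.
  have hm : Matching (fun z => g (ψ z))
      (fun z => (starRingEnd ℂ (g (ψ (starRingEnd ℂ z))))⁻¹) δ 2 := by
    refine ⟨fun z hz => (hfd z hz).differentiableWithinAt, fun z hz => ?_, fun z hz => ?_,
      fun z hz => ?_, fun x hx => ?_⟩
    · have h1 := (hfd _ (hconj z hz)).conj_conj
      rw [Complex.conj_conj] at h1
      refine (h1.inv ?_).differentiableWithinAt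
      simpa using hne _ (hconj z hz)
    · exact (hlt _ ((hball z hz.1).2.2 hz.2)).le.trans one_le_two
    · have h1 := hge _ (hconj z hz)
      rw [norm_inv, RCLike.norm_conj]
      exact inv_le_of_inv_le₀ two_pos (by rw [← one_div]; exact h1)
    · have h1 := hnormlim x hx
      rw [tendsto_zero_iff_norm_tendsto_zero]
      have h2 : Tendsto (fun z => |‖g (ψ z)‖ ^ 2 - 1| / ‖g (ψ z)‖) (𝓝[upperBall δ] (x : ℂ))
          (𝓝 (|1 ^ 2 - 1| / 1)) := (((h1.pow 2).sub_const 1).abs).div h1 one_ne_zero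
      simp only [one_pow, sub_self, abs_zero, zero_div] at h2
      refine h2.congr' ?_
      filter_upwards [self_mem_nhdsWithin] with z hz
      have h3 := hne z hz
      have h3' : starRingEnd ℂ (g (ψ z)) ≠ 0 := (_root_.map_ne_zero _).2 h3
      have h4 : g (ψ z) - (starRingEnd ℂ (g (ψ z)))⁻¹ =
          ((‖g (ψ z)‖ ^ 2 - 1 : ℝ) : ℂ) / starRingEnd ℂ (g (ψ z)) := by
        rw [Complex.ofReal_sub, Complex.ofReal_pow, ← Complex.mul_conj']
        field_simp
        simp
      simp only [Complex.conj_conj]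
      rw [h4, norm_div, RCLike.norm_conj, Complex.norm_real, Real.norm_eq_abs]
  obtain ⟨Γ, hΓ, hΓu, -⟩ := hm.exists_extension
  refine ⟨Γ, hΓ.analyticAt (Metric.ball_mem_nhds 0 hδ), ?_, ?_⟩
  · have hev : ∀ᶠ x : ℝ in 𝓝 0, |x| < δ := by
      have := (continuous_abs.tendsto (0 : ℝ)).eventually (gt_mem_nhds (by simpa using hδ))
      exact this
    filter_upwards [hev] with x hx
    have hx' : (x : ℂ) ∈ Metric.ball (0 : ℂ) δ := by simpa using hx
    have := upperBall_neBot hx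
    have hc : ContinuousAt Γ x := (hΓ.differentiableAt (Metric.isOpen_ball.mem_nhds hx')).continuousAt
    refine tendsto_nhds_unique (hc.norm.tendsto.mono_left
      (nhdsWithin_le_nhds (s := upperBall δ))) ((hnormlim x hx).congr' ?_)
    filter_upwards [self_mem_nhdsWithin] with z hz
    rw [hΓu hz]
  · filter_upwards [Metric.ball_mem_nhds (0 : ℂ) hδ] with z hz him
    exact hΓu ⟨hz, him⟩

/-- The boundary values of `g / g'` for a conformal map `g` onto the disc. -/
theorem exists_tendsto_div_deriv {g : ℂ → ℂ} (hg : AnalyticOnNhd ℂ g W.domain)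
    (hb : BijOn g W.domain (Metric.ball 0 1)) {x₀ : ℝ} {y₀ : ℂ} (hx₀ : x₀ ∈ Icc W.x₁ W.x₂)
    (hK₀ : W.K x₀ y₀ = 0) : ∃ s : ℝ, s ≠ 0 ∧
      Tendsto (fun y => g y / deriv g y) (𝓝[W.domain] y₀) (𝓝 (s * W.Kx x₀ y₀)) := by
  obtain ⟨ψ, σ, hψ, hψ'⟩ := exists_isChart hx₀ hK₀
  have hlt : ∀ y ∈ W.domain, ‖g y‖ < 1 := fun y hy => by simpa using hb.mapsTo hy
  obtain ⟨Γ, hΓ, hΓ1, hΓg⟩ := hψ.exists_extension_circle hg hlt fun y hy =>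
    tendsto_norm_one_of_bijOn isOpen_domain hg hb self_mem_nhdsWithin
      fun z hz => disjoint_nhds_of_mem_curve hy hz
  have hΓ0 : ‖Γ 0‖ = 1 := by simpa using hΓ1.self_of_nhds
  have hΓd : deriv Γ 0 ≠ 0 := by
    refine deriv_ne_zero_of_norm_lt_one hΓ hΓ0 ?_
    filter_upwards [hΓg, hψ.sides] with z h1 h2 h3
    rw [h1 h3]
    exact hlt _ (h2.2.1 h3)
  -- |Γ|² is constant on the real axis, so Γ' is orthogonal to Γ there.
  have hre : (deriv Γ 0 * starRingEnd ℂ (Γ 0)).re = 0 := by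
    have h1 : HasDerivAt (fun x : ℝ => Γ x) (deriv Γ 0) 0 := by
      have := hΓ.differentiableAt.hasDerivAt
      exact HasDerivAt.comp_ofReal (z := 0) (by simpa using this)
    have h2 := h1.norm_sq
    have h3 : HasDerivAt (fun _ : ℝ => (1 : ℝ)) _ 0 := h2.congr_of_eventuallyEq <| by
      filter_upwards [hΓ1] with x hx
      simp [hx]
    have h4 := h3.unique (hasDerivAt_const 0 1)
    rw [Complex.inner, Complex.ofReal_zero] at h4
    linarith
  set τ : ℝ := (deriv Γ 0 * starRingEnd ℂ (Γ 0)).im with hτ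
  have hΓτ : deriv Γ 0 = Complex.I * τ * Γ 0 := by
    have h1 : deriv Γ 0 * starRingEnd ℂ (Γ 0) = Complex.I * τ := by
      apply Complex.ext
      · simpa using hre
      · simp [hτ]
    have h2 : Γ 0 * starRingEnd ℂ (Γ 0) = 1 := by
      rw [Complex.mul_conj', hΓ0]; simp
    linear_combination (-deriv Γ 0) * h2 + Γ 0 * h1
  have hΓne : Γ 0 ≠ 0 := norm_ne_zero_iff.1 (by rw [hΓ0]; exact one_ne_zero)
  have hτ0 : τ ≠ 0 := by
    intro h
    rw [h] at hΓτ
    simp at hΓτ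
    exact hΓd hΓτ
  have hσ0 : σ ≠ 0 := by
    rintro rfl
    exact hψ.deriv_ne (by simpa using hψ')
  -- By the chain rule g/g' at ψ(z) equals Γψ'/Γ'; at 0 the factors i and Γ(0) cancel and (σ/τ)K_x
  -- is left.
  refine ⟨σ / τ, div_ne_zero hσ0 hτ0, ?_⟩
  have hval : ((σ / τ : ℝ) : ℂ) * W.Kx x₀ y₀ = Γ 0 * deriv ψ 0 / deriv Γ 0 := by
    rw [hΓτ, hψ']
    have h1 : (τ : ℂ) ≠ 0 := by exact_mod_cast hτ0
    have := Complex.I_ne_zero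
    push_cast
    field_simp
  rw [hval, hψ.tendsto_iff]
  have hlimit : Tendsto (fun z => Γ z * deriv ψ z / deriv Γ z) (𝓝[{z | 0 < z.im}] 0)
      (𝓝 (Γ 0 * deriv ψ 0 / deriv Γ 0)) :=
    ((hΓ.continuousAt.mul hψ.analytic.deriv.continuousAt).div hΓ.deriv.continuousAt
      hΓd).tendsto.mono_left nhdsWithin_le_nhds
  refine hlimit.congr' ?_
  have hev := hΓg.eventually_nhds
  filter_upwards [nhdsWithin_le_nhds hev, nhdsWithin_le_nhds hψ.sides,
    nhdsWithin_le_nhds hψ.analytic.eventually_analyticAt,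
    nhdsWithin_le_nhds (hψ.analytic.deriv.continuousAt.eventually_ne hψ.deriv_ne),
    self_mem_nhdsWithin] with z h1 h2 h3 h4 h5
  have h5' : 0 < z.im := h5
  have hup : ∀ᶠ w in 𝓝 z, 0 < w.im :=
    (isOpen_lt continuous_const Complex.continuous_im).mem_nhds h5'
  have heq : Γ =ᶠ[𝓝 z] fun w => g (ψ w) := by
    filter_upwards [h1, hup] with w h6 h7 using h6 h7
  have hdΓ : deriv Γ z = deriv g (ψ z) * deriv ψ z := by
    rw [heq.deriv_eq]
    exact deriv_comp z (hg _ (h2.2.1 h5')).differentiableAt h3.differentiableAt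
  rw [hdΓ, heq.self_of_nhds, mul_div_mul_right _ _ h4]

lemma K_conj (x : ℝ) (y : ℂ) : W.K x (starRingEnd ℂ y) = starRingEnd ℂ (W.K x y) := by
  simp [K]

/-- Completing the square in x: K_x² is the discriminant plus 4ãK. -/
lemma Kx_sq {x y : ℂ} (h : W.K x y = 0) : W.Kx x y ^ 2 =
    (W.A * y ^ 2 + W.B - y) ^ 2 - 4 * (W.C * y ^ 2 + W.E * y) * (W.C * y + W.E) := by
  unfold K at h
  unfold Kx
  linear_combination 4 * (W.C * y ^ 2 + W.E * y) * h

lemma tendsto_conj_domain (y : ℂ) : Tendsto (starRingEnd ℂ) (𝓝[W.domain] (starRingEnd ℂ y))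
    (𝓝[W.domain] y) := by
  refine tendsto_nhdsWithin_iff.2 ⟨?_, ?_⟩
  · have := (Complex.continuous_conj.tendsto (starRingEnd ℂ y)).mono_left
      (nhdsWithin_le_nhds (s := W.domain))
    rwa [Complex.conj_conj] at this
  · filter_upwards [self_mem_nhdsWithin] with z hz using conj_mem_domain hz

lemma deriv_conj_of_symm {g : ℂ → ℂ}
    (hs : ∀ y ∈ W.domain, g (starRingEnd ℂ y) = starRingEnd ℂ (g y)) {y : ℂ} (hy : y ∈ W.domain) :
    deriv g (starRingEnd ℂ y) = starRingEnd ℂ (deriv g y) := by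
  have h1 : g =ᶠ[𝓝 (starRingEnd ℂ y)] starRingEnd ℂ ∘ g ∘ starRingEnd ℂ := by
    filter_upwards [isOpen_domain.mem_nhds (conj_mem_domain hy)] with z hz
    have := hs _ (conj_mem_domain hz)
    simpa using this
  rw [h1.deriv_eq, deriv_conj_conj]
  simp

/-- The decoupling property of `g / g'`. -/
theorem exists_boundary_values {g : ℂ → ℂ} (hg : AnalyticOnNhd ℂ g W.domain)
    (hb : BijOn g W.domain (Metric.ball 0 1))
    (hs : ∀ y ∈ W.domain, g (starRingEnd ℂ y) = starRingEnd ℂ (g y)) :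
    ∃ F : ℂ → ℂ, (∀ y ∈ W.curve,
        Tendsto (fun y => g y / deriv g y) (𝓝[W.domain] y) (𝓝 (F y)) ∧ F y ≠ 0) ∧
      ∀ x ∈ Icc W.x₁ W.x₂, ∀ y, W.K (x : ℝ) y = 0 →
        F (starRingEnd ℂ y) / F y = starRingEnd ℂ (W.Kx x y) / W.Kx x y := by
  have hex : ∀ y, ∃ v : ℂ, ∀ x ∈ Icc W.x₁ W.x₂, W.K (x : ℝ) y = 0 →
      Tendsto (fun y => g y / deriv g y) (𝓝[W.domain] y) (𝓝 v) ∧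
        ∃ s : ℝ, s ≠ 0 ∧ v = s * W.Kx x y := by
    intro y
    by_cases hy : y ∈ W.curve
    · obtain ⟨x, hx, hK⟩ := hy
      obtain ⟨s, hs, hlim⟩ := exists_tendsto_div_deriv hg hb hx hK
      refine ⟨_, fun x' hx' hK' => ⟨hlim, s, hs, ?_⟩⟩
      rw [eq_of_norm_eq hx.1 hx'.1 ((K_eq_zero_iff hx).1 hK).1 ((K_eq_zero_iff hx').1 hK').1]
    · exact ⟨0, fun x hx hK => absurd ⟨x, hx, hK⟩ hy⟩
  choose F hF using hex
  have hF0 : ∀ x ∈ Icc W.x₁ W.x₂, ∀ y, W.K (x : ℝ) y = 0 → F y ≠ 0 := by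
    intro x hx y hK
    obtain ⟨-, s, hs0, hv⟩ := hF y x hx hK
    rw [hv]
    exact mul_ne_zero (by exact_mod_cast hs0) (Kx_ne_zero_of_K hx hK)
  refine ⟨F, fun y ⟨x, hx, hK⟩ => ⟨(hF y x hx hK).1, hF0 x hx y hK⟩, fun x hx y hK => ?_⟩
  have hKc : W.K x (starRingEnd ℂ y) = 0 := by rw [K_conj, hK, map_zero]
  have h1 := (hF y x hx hK).1
  have h2 := (hF _ x hx hKc).1
  have hne : (𝓝[W.domain] (starRingEnd ℂ y)).NeBot := neBot_of_mem_curve ⟨x, hx, hKc⟩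
  have h3 : F (starRingEnd ℂ y) = starRingEnd ℂ (F y) := by
    refine tendsto_nhds_unique h2 ?_
    refine (((Complex.continuous_conj.tendsto _).comp h1).comp (tendsto_conj_domain y)).congr' ?_
    filter_upwards [self_mem_nhdsWithin] with z hz
    simp only [Function.comp, map_div₀]
    rw [← hs _ (conj_mem_domain hz), ← deriv_conj_of_symm hs (conj_mem_domain hz),
      Complex.conj_conj]
  obtain ⟨-, s, hs0, hv⟩ := hF y x hx hK
  have hs0' : (s : ℂ) ≠ 0 := by exact_mod_cast hs0
  -- The factor s is real, so it cancels from the ratio.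
  rw [h3, hv, map_mul, Complex.conj_ofReal, mul_div_mul_left _ _ hs0']

end Weights

/-! ### The discriminant in x and its square root -/

/-- The square root of `(y - p) (y - q)` which is analytic off the segment `[p, q]`. -/
def segmentSqrt (p q : ℝ) (y : ℂ) : ℂ := (y - q) * ((y - p) / (y - q)) ^ (2⁻¹ : ℂ)

lemma cpow_half_sq (z : ℂ) : (z ^ (2⁻¹ : ℂ)) ^ 2 = z := by
  have := Complex.cpow_nat_inv_pow z two_ne_zero
  exact_mod_cast this

lemma cpow_half_ofReal_pos {u : ℝ} (hu : 0 < u) :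
    ∃ v : ℝ, 0 < v ∧ (u : ℂ) ^ (2⁻¹ : ℂ) = v := by
  refine ⟨u ^ (2⁻¹ : ℝ), by positivity, ?_⟩
  rw [Complex.ofReal_cpow hu.le]
  norm_num

lemma segmentSqrt_sq {p q : ℝ} {y : ℂ} (h : y ≠ q) :
    segmentSqrt p q y ^ 2 = (y - p) * (y - q) := by
  have := sub_ne_zero.2 h
  rw [segmentSqrt, mul_pow, cpow_half_sq]
  field_simp

/-- The Möbius map y ↦ (y - p)/(y - q) takes values in (-∞, 0] only on the segment between p and q.
-/
lemma segmentSqrt_ratio_mem {p q : ℝ} {y : ℂ}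
    (h : ∀ u : ℝ, y = u → ¬ ((p ≤ u ∧ u ≤ q) ∨ (q ≤ u ∧ u ≤ p))) :
    (y - p) / (y - q) ∈ Complex.slitPlane := by
  have hq : y - q ≠ 0 := sub_ne_zero.2 fun h' => by have := h q h'; grind
  rw [Complex.mem_slitPlane_iff_not_le_zero]
  intro hle
  obtain ⟨u, hu, hu'⟩ : ∃ u : ℝ, u ≤ 0 ∧ (y - p) / (y - q) = u := by
    rw [Complex.le_def] at hle
    exact ⟨_, hle.1, Complex.ext rfl (by simpa using hle.2)⟩
  have h1 : y - p = u * (y - q) := by rw [← hu']; field_simp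
  have h2 : (1 - u : ℂ) ≠ 0 := by
    have : (1 - u : ℝ) ≠ 0 := by linarith
    exact_mod_cast this
  have h3 : y = (((p - u * q) / (1 - u) : ℝ) : ℂ) := by
    push_cast
    field_simp
    linear_combination h1
  refine h _ h3 ?_
  have h4 : 0 < 1 - u := by linarith
  rcases le_total p q with hpq | hpq
  · left
    constructor
    · rw [le_div_iff₀ h4]; nlinarith
    · rw [div_le_iff₀ h4]; nlinarith
  · right
    constructor
    · rw [le_div_iff₀ h4]; nlinarith
    · rw [div_le_iff₀ h4]; nlinarith

lemma analyticAt_segmentSqrt {p q : ℝ} {y : ℂ}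
    (h : ∀ u : ℝ, y = u → ¬ ((p ≤ u ∧ u ≤ q) ∨ (q ≤ u ∧ u ≤ p))) :
    AnalyticAt ℂ (segmentSqrt p q) y := by
  have hq : y - q ≠ 0 := sub_ne_zero.2 fun h' => by have := h q h'; grind
  unfold segmentSqrt
  exact (by fun_prop : AnalyticAt ℂ (fun y : ℂ => y - q) y).mul
    (((by fun_prop : AnalyticAt ℂ (fun y : ℂ => y - p) y).div (by fun_prop) hq).cpow
      analyticAt_const (segmentSqrt_ratio_mem h))

lemma segmentSqrt_ofReal_pos {p q u : ℝ} (hp : p < u) (hq : q < u) :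
    ∃ v : ℝ, 0 < v ∧ segmentSqrt p q u = v := by
  obtain ⟨v, hv, hv'⟩ := cpow_half_ofReal_pos (div_pos (sub_pos.2 hp) (sub_pos.2 hq))
  refine ⟨(u - q) * v, mul_pos (sub_pos.2 hq) hv, ?_⟩
  push_cast at hv' ⊢
  rw [segmentSqrt, hv']

lemma segmentSqrt_ofReal_neg {p q u : ℝ} (hp : u < p) (hq : u < q) :
    ∃ v : ℝ, 0 < v ∧ -segmentSqrt p q u = v := by
  obtain ⟨v, hv, hv'⟩ := cpow_half_ofReal_pos (div_pos (sub_pos.2 hp) (sub_pos.2 hq))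
  refine ⟨(q - u) * v, mul_pos (sub_pos.2 hq) hv, ?_⟩
  push_cast at hv' ⊢
  rw [segmentSqrt, ← neg_sub (q : ℂ) u, ← neg_sub (p : ℂ) u, neg_div_neg_eq, hv']
  ring

/-- A real polynomial function of degree at most three with four zeros vanishes identically. -/
lemma cubic_eq_zero {u₀ u₁ u₂ u₃ : ℝ} {s : Finset ℝ} (hs : 3 < s.card)
    (h : ∀ x ∈ s, u₃ * x ^ 3 + u₂ * x ^ 2 + u₁ * x + u₀ = 0) (y : ℂ) :
    u₃ * y ^ 3 + u₂ * y ^ 2 + u₁ * y + u₀ = 0 := by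
  have h0 : (C u₃ * X ^ 3 + C u₂ * X ^ 2 + C u₁ * X + C u₀ : ℝ[X]) = 0 := by
    refine Polynomial.eq_zero_of_natDegree_lt_card_of_eval_eq_zero' _ s (fun x hx => ?_)
      (lt_of_le_of_lt (by compute_degree) hs)
    simpa using h x hx
  have := congrArg (aeval y) h0
  simpa using this

/-- A real polynomial function of degree at most two with three zeros vanishes identically. -/
lemma quadratic_eq_zero {u₀ u₁ u₂ : ℝ} {s : Finset ℝ} (hs : 2 < s.card)
    (h : ∀ x ∈ s, u₂ * x ^ 2 + u₁ * x + u₀ = 0) (y : ℂ) :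
    u₂ * y ^ 2 + u₁ * y + u₀ = 0 := by
  have h0 : (C u₂ * X ^ 2 + C u₁ * X + C u₀ : ℝ[X]) = 0 := by
    refine Polynomial.eq_zero_of_natDegree_lt_card_of_eval_eq_zero' _ s (fun x hx => ?_)
      (lt_of_le_of_lt (by compute_degree) hs)
    simpa using h x hx
  have := congrArg (aeval y) h0
  simpa using this

namespace Weights

variable (W : Weights)

/-- The discriminant of the kernel with respect to `x`. -/
def dY (y : ℝ) : ℝ := (W.A * y ^ 2 + W.B - y) ^ 2 - 4 * y * (W.C * y + W.E) ^ 2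

/-- The real points where the discriminant with respect to `x` is not positive. -/
def cuts : Set ℂ := {z | ∃ y : ℝ, W.dY y ≤ 0 ∧ z = y}

lemma continuous_dY : Continuous W.dY := by unfold dY; fun_prop

lemma dY_one_pos : 0 < W.dY 1 := by
  have hA := W.A_nonneg; have hB := W.B_nonneg; have hC := W.C_nonneg; have hE := W.E_nonneg
  have ht := W.total_lt
  unfold dY
  nlinarith

lemma dY_neg_of_eq {y : ℝ} (hy : 0 < y) (h : W.A * y ^ 2 + W.B - y = 0) : W.dY y < 0 := by
  have hC := W.C_nonneg; have hE := W.E_nonneg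
  have : 0 < W.C * y + W.E := by
    rcases hE.lt_or_eq with h | h
    · have := mul_nonneg hC hy.le; linarith
    · have : 0 < W.C := by have := W.CE_pos; linarith
      rw [← h]; positivity
  unfold dY
  rw [h]
  have : 0 < 4 * y * (W.C * y + W.E) ^ 2 := by positivity
  linarith

/-- If B > 0, the middle coefficient Ay² + B - y vanishes somewhere in (0, 1), and only the negative
term -4y(Cy + E)² is left there. If B = 0, then E > 0 and the discriminant behaves like -4E²y near
0. -/
lemma exists_dY_neg_lt_one : ∃ y, 0 < y ∧ y < 1 ∧ W.dY y < 0 := by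
  have hA := W.A_nonneg; have hB := W.B_nonneg; have hC := W.C_nonneg; have hE := W.E_nonneg
  have ht := W.total_lt
  rcases hB.lt_or_eq with h | h
  · have hc : ContinuousOn (fun y => W.A * y ^ 2 + W.B - y) (Icc 0 1) := by fun_prop
    obtain ⟨y, hy, hy0⟩ := intermediate_value_Icc' zero_le_one hc
      (show (0 : ℝ) ∈ Icc _ _ by constructor <;> simp <;> linarith)
    have hy0' : W.A * y ^ 2 + W.B - y = 0 := hy0
    have h1 : 0 < y := by have := mul_nonneg hA (sq_nonneg y); linarith
    refine ⟨y, h1, lt_of_le_of_ne hy.2 ?_, W.dY_neg_of_eq h1 hy0'⟩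
    rintro rfl
    linarith
  · have hE' : 0 < W.E := by have := W.BE_pos; linarith
    have hc : ContinuousAt (fun y => y * (W.A * y - 1) ^ 2 - 4 * (W.C * y + W.E) ^ 2) 0 := by
      fun_prop
    have h0 : (fun y => y * (W.A * y - 1) ^ 2 - 4 * (W.C * y + W.E) ^ 2) 0 < 0 := by
      simp; positivity
    have h1 := (hc.eventually (gt_mem_nhds h0)).filter_mono (nhdsWithin_le_nhds (s := Ioi 0))
    obtain ⟨y, hy, hy'⟩ := (h1.and (Ioo_mem_nhdsGT one_pos)).exists
    refine ⟨y, hy'.1, hy'.2, ?_⟩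
    have : W.dY y = y * (y * (W.A * y - 1) ^ 2 - 4 * (W.C * y + W.E) ^ 2) := by
      unfold dY; rw [← h]; ring
    rw [this]
    exact mul_neg_of_pos_of_neg hy'.1 hy

/-- The weights obtained by the reflection `(i, j) ↦ (-i, -j)` of the steps. -/
def reflect : Weights where
  A := W.B
  B := W.A
  C := W.E
  E := W.C
  A_nonneg := W.B_nonneg
  B_nonneg := W.A_nonneg
  C_nonneg := W.E_nonneg
  E_nonneg := W.C_nonneg
  AC_pos := W.BE_pos
  BE_pos := W.AC_pos
  CE_pos := by have := W.CE_pos; linarith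
  total_lt := by have := W.total_lt; linarith

lemma dY_reflect_inv {y : ℝ} (hy : y ≠ 0) : W.reflect.dY y⁻¹ * y ^ 4 = W.dY y := by
  simp only [dY, reflect]
  field_simp
  ring

lemma exists_dY_neg_gt_one : ∃ y, 1 < y ∧ W.dY y < 0 := by
  obtain ⟨z, h0, h1, hz⟩ := W.reflect.exists_dY_neg_lt_one
  refine ⟨z⁻¹, (one_lt_inv₀ h0).2 h1, ?_⟩
  rw [← W.dY_reflect_inv (inv_pos.2 h0).ne', inv_inv]
  exact mul_neg_of_neg_of_pos hz (by positivity)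

/-- Intermediate values for the sign pattern ≥ 0, < 0, > 0, < 0 at 0, p, 1, q. The reflected weights
and y ↦ 1/y transport the behaviour near 0 to infinity, which yields η₄; it is finite only if A > 0.
-/
lemma exists_dY_roots : ∃ η₁ η₂ η₃ : ℝ, η₁ < η₂ ∧ η₂ < 1 ∧ -1 < η₂ ∧ 1 < η₃ ∧ W.dY η₁ = 0 ∧
    W.dY η₂ = 0 ∧ W.dY η₃ = 0 ∧ (0 < W.A → ∃ η₄, η₃ < η₄ ∧ W.dY η₄ = 0) := by
  obtain ⟨p, hp0, hp1, hp⟩ := W.exists_dY_neg_lt_one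
  obtain ⟨q, hq1, hq⟩ := W.exists_dY_neg_gt_one
  have h0 : 0 ≤ W.dY 0 := by unfold dY; nlinarith [sq_nonneg W.B]
  have h1 := W.dY_one_pos
  have hc := W.continuous_dY
  obtain ⟨η₁, h₁, h₁'⟩ := intermediate_value_Icc' hp0.le hc.continuousOn
    (show (0 : ℝ) ∈ Icc _ _ from ⟨hp.le, h0⟩)
  obtain ⟨η₂, h₂, h₂'⟩ := intermediate_value_Ioo hp1.le hc.continuousOn
    (show (0 : ℝ) ∈ Ioo _ _ from ⟨hp, h1⟩)
  obtain ⟨η₃, h₃, h₃'⟩ := intermediate_value_Ioo' hq1.le hc.continuousOn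
    (show (0 : ℝ) ∈ Ioo _ _ from ⟨hq, h1⟩)
  refine ⟨η₁, η₂, η₃, h₁.2.trans_lt h₂.1, h₂.2, by linarith [h₂.1], h₃.1, h₁', h₂', h₃', ?_⟩
  intro hA
  have h4 : 0 ≤ W.reflect.dY 0 := by unfold dY; nlinarith [sq_nonneg W.reflect.B]
  have hq0 : 0 < q := by linarith
  have h5 : W.reflect.dY q⁻¹ < 0 := by
    have := W.dY_reflect_inv hq0.ne'
    by_contra! hcon
    have := mul_nonneg hcon (by positivity : 0 ≤ q ^ 4)
    linarith
  obtain ⟨z, hz, hz'⟩ := intermediate_value_Icc' (inv_pos.2 hq0).le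
    W.reflect.continuous_dY.continuousOn (show (0 : ℝ) ∈ Icc _ _ from ⟨h5.le, h4⟩)
  have hz0 : 0 < z := by
    refine lt_of_le_of_ne hz.1 fun h => ?_
    rw [← h] at hz'
    simp [dY, reflect] at hz'
    exact hA.ne' hz'
  have hzq : z ≠ q⁻¹ := by rintro rfl; linarith
  refine ⟨z⁻¹, h₃.2.trans ?_, ?_⟩
  · rw [lt_inv_comm₀ hq0 hz0]
    exact lt_of_le_of_ne hz.2 hzq
  · rw [← W.dY_reflect_inv (inv_pos.2 hz0).ne', inv_inv, hz', zero_mul]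

/-- The discriminant at a complex point. -/
def dYc (y : ℂ) : ℂ := (W.A * y ^ 2 + W.B - y) ^ 2 - 4 * y * (W.C * y + W.E) ^ 2

lemma dYc_ofReal (y : ℝ) : W.dYc y = W.dY y := by simp only [dYc, dY]; push_cast; ring

/-- The difference of the two sides has degree at most 3, as the leading terms A²y⁴ cancel, and it
has four real zeros. -/
lemma dYc_factor_of_pos {η₁ η₂ η₃ η₄ : ℝ} (h12 : η₁ < η₂) (h23 : η₂ < η₃) (h34 : η₃ < η₄)
    (h₁ : W.dY η₁ = 0) (h₂ : W.dY η₂ = 0) (h₃ : W.dY η₃ = 0) (h₄ : W.dY η₄ = 0) (y : ℂ) :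
    W.dYc y = W.A ^ 2 * ((y - η₁) * (y - η₂)) * ((y - η₃) * (y - η₄)) := by
  have hcard : 3 < ({η₁, η₂, η₃, η₄} : Finset ℝ).card := by
    rw [Finset.card_insert_of_notMem, Finset.card_insert_of_notMem, Finset.card_pair] <;> grind
  have := cubic_eq_zero (u₃ := -(2 * W.A + 4 * W.C ^ 2) + W.A ^ 2 * (η₁ + η₂ + η₃ + η₄))
    (u₂ := 1 + 2 * W.A * W.B - 8 * W.C * W.E - W.A ^ 2 *
      (η₁ * η₂ + η₁ * η₃ + η₁ * η₄ + η₂ * η₃ + η₂ * η₄ + η₃ * η₄))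
    (u₁ := -(2 * W.B + 4 * W.E ^ 2) + W.A ^ 2 *
      (η₁ * η₂ * η₃ + η₁ * η₂ * η₄ + η₁ * η₃ * η₄ + η₂ * η₃ * η₄))
    (u₀ := W.B ^ 2 - W.A ^ 2 * (η₁ * η₂ * η₃ * η₄)) hcard (fun x hx => by
      have hx0 : W.dY x - W.A ^ 2 * ((x - η₁) * (x - η₂)) * ((x - η₃) * (x - η₄)) = 0 := by
        simp only [Finset.mem_insert, Finset.mem_singleton] at hx
        rcases hx with rfl | rfl | rfl | rfl <;> simp [*]
      rw [← hx0, dY]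
      ring) y
  push_cast at this
  rw [dYc]
  linear_combination this

lemma dYc_factor_of_eq_zero {η₁ η₂ η₃ : ℝ} (hA : W.A = 0) (h12 : η₁ < η₂) (h23 : η₂ < η₃)
    (h₁ : W.dY η₁ = 0) (h₂ : W.dY η₂ = 0) (h₃ : W.dY η₃ = 0) (y : ℂ) :
    W.dYc y = (2 * W.C) ^ 2 * ((y - η₁) * (y - η₂)) * (η₃ - y) := by
  have hcard : 2 < ({η₁, η₂, η₃} : Finset ℝ).card := by
    rw [Finset.card_insert_of_notMem, Finset.card_pair] <;> grind
  have := quadratic_eq_zero (u₂ := 1 - 8 * W.C * W.E - 4 * W.C ^ 2 * (η₁ + η₂ + η₃))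
    (u₁ := -(2 * W.B + 4 * W.E ^ 2) + 4 * W.C ^ 2 * (η₁ * η₂ + η₁ * η₃ + η₂ * η₃))
    (u₀ := W.B ^ 2 - 4 * W.C ^ 2 * (η₁ * η₂ * η₃)) hcard (fun x hx => by
      have hx0 : W.dY x - (2 * W.C) ^ 2 * ((x - η₁) * (x - η₂)) * (η₃ - x) = 0 := by
        simp only [Finset.mem_insert, Finset.mem_singleton] at hx
        rcases hx with rfl | rfl | rfl <;> simp [*]
      rw [← hx0, dY, hA]
      ring) y
  push_cast at this
  rw [dYc, hA]
  push_cast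
  linear_combination this

variable {W}

lemma notMem_segment_of_notMem_cuts {p q : ℝ}
    (h : ∀ u : ℝ, (p ≤ u ∧ u ≤ q) ∨ (q ≤ u ∧ u ≤ p) → W.dY u ≤ 0) {y : ℂ} (hy : y ∉ W.cuts)
    (u : ℝ) (hu : y = u) : ¬ ((p ≤ u ∧ u ≤ q) ∨ (q ≤ u ∧ u ≤ p)) :=
  fun h' => hy ⟨u, h u h', hu⟩

variable (W)

/-- The determination of the square root of the discriminant which is positive on the middle
interval. -/
theorem exists_sqrt_dYc : ∃ (r : ℂ → ℂ) (η₂ η₃ : ℝ), |η₂| < 1 ∧ W.dY η₂ = 0 ∧ 1 < η₃ ∧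
    W.dY η₃ = 0 ∧ AnalyticOnNhd ℂ r W.cutsᶜ ∧ (∀ y ∈ W.cutsᶜ, r y ^ 2 = W.dYc y) ∧
    ∀ y : ℝ, η₂ < y → y < η₃ → ∃ v : ℝ, 0 < v ∧ r y = v := by
  obtain ⟨η₁, η₂, η₃, h12, h2, h2', h3, h₁, h₂, h₃, hex⟩ := W.exists_dY_roots
  have h23 := h2.trans h3
  have hcut : ∀ {η : ℝ}, W.dY η = 0 → ∀ y ∈ W.cutsᶜ, y ≠ (η : ℂ) :=
    fun hη y hy h => hy ⟨_, hη.le, h⟩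
  rcases W.A_nonneg.lt_or_eq with hA | hA
  · obtain ⟨η₄, h34, h₄⟩ := hex hA
    have hfac := W.dYc_factor_of_pos h12 h23 h34 h₁ h₂ h₃ h₄
    have hfac' : ∀ u : ℝ, W.dY u =
        W.A ^ 2 * ((u - η₁) * (u - η₂)) * ((u - η₃) * (u - η₄)) := fun u => by
      have := hfac u
      rw [dYc_ofReal] at this
      exact_mod_cast this
    have hA2 : 0 ≤ W.A ^ 2 := sq_nonneg _
    have hs1 : ∀ u : ℝ, (η₁ ≤ u ∧ u ≤ η₂) ∨ (η₂ ≤ u ∧ u ≤ η₁) → W.dY u ≤ 0 := by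
      intro u hu
      rw [hfac']
      refine mul_nonpos_of_nonpos_of_nonneg (mul_nonpos_of_nonneg_of_nonpos hA2 ?_) ?_
      · exact mul_nonpos_of_nonneg_of_nonpos (by grind) (by grind)
      · exact mul_nonneg_of_nonpos_of_nonpos (by grind) (by grind)
    have hs2 : ∀ u : ℝ, (η₄ ≤ u ∧ u ≤ η₃) ∨ (η₃ ≤ u ∧ u ≤ η₄) → W.dY u ≤ 0 := by
      intro u hu
      rw [hfac']
      refine mul_nonpos_of_nonneg_of_nonpos (mul_nonneg hA2 ?_) ?_
      · exact mul_nonneg (by grind) (by grind)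
      · exact mul_nonpos_of_nonneg_of_nonpos (by grind) (by grind)
    -- The minus sign is needed because `segmentSqrt` is negative on the real axis to the left of
    -- its segment.
    refine ⟨fun y => W.A * segmentSqrt η₁ η₂ y * -segmentSqrt η₄ η₃ y, η₂, η₃,
      abs_lt.2 ⟨h2', h2⟩, h₂, h3, h₃, fun y hy => ?_, fun y hy => ?_, fun y hy hy' => ?_⟩
    · exact (analyticAt_const.mul (analyticAt_segmentSqrt
        (notMem_segment_of_notMem_cuts hs1 hy))).mul (analyticAt_segmentSqrt
        (notMem_segment_of_notMem_cuts hs2 hy)).neg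
    · rw [mul_pow, mul_pow, neg_sq, segmentSqrt_sq (hcut h₂ y hy), segmentSqrt_sq (hcut h₃ y hy),
        hfac]
      ring
    · obtain ⟨v, hv, hv'⟩ := segmentSqrt_ofReal_pos (h12.trans hy) hy
      obtain ⟨u, hu, hu'⟩ := segmentSqrt_ofReal_neg (hy'.trans h34) hy'
      refine ⟨W.A * v * u, by positivity, ?_⟩
      simp only [hv', hu']
      push_cast
      ring
  · have hC : 0 < W.C := by have := W.AC_pos; linarith
    have hfac := W.dYc_factor_of_eq_zero hA.symm h12 h23 h₁ h₂ h₃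
    have hfac' : ∀ u : ℝ, W.dY u = (2 * W.C) ^ 2 * ((u - η₁) * (u - η₂)) * (η₃ - u) := fun u => by
      have := hfac u
      rw [dYc_ofReal] at this
      exact_mod_cast this
    have hC2 : 0 ≤ (2 * W.C) ^ 2 := sq_nonneg _
    have hs1 : ∀ u : ℝ, (η₁ ≤ u ∧ u ≤ η₂) ∨ (η₂ ≤ u ∧ u ≤ η₁) → W.dY u ≤ 0 := by
      intro u hu
      rw [hfac']
      refine mul_nonpos_of_nonpos_of_nonneg (mul_nonpos_of_nonneg_of_nonpos hC2 ?_) (by grind)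
      exact mul_nonpos_of_nonneg_of_nonpos (by grind) (by grind)
    have hs2 : ∀ u : ℝ, η₃ ≤ u → W.dY u ≤ 0 := by
      intro u hu
      rw [hfac']
      refine mul_nonpos_of_nonneg_of_nonpos (mul_nonneg hC2 ?_) (by grind)
      exact mul_nonneg (by grind) (by grind)
    refine ⟨fun y => 2 * W.C * segmentSqrt η₁ η₂ y * (η₃ - y) ^ (2⁻¹ : ℂ), η₂, η₃,
      abs_lt.2 ⟨h2', h2⟩, h₂, h3, h₃, fun y hy => ?_, fun y hy => ?_, fun y hy hy' => ?_⟩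
    · refine (analyticAt_const.mul (analyticAt_segmentSqrt
        (notMem_segment_of_notMem_cuts hs1 hy))).mul
        ((by fun_prop : AnalyticAt ℂ (fun y : ℂ => η₃ - y) y).cpow analyticAt_const ?_)
      rw [Complex.mem_slitPlane_iff_not_le_zero, Complex.le_def]
      rintro ⟨hre, him⟩
      simp at hre him
      exact hy ⟨y.re, hs2 _ hre, Complex.ext rfl (by simpa using him)⟩
    · rw [mul_pow, mul_pow, cpow_half_sq, segmentSqrt_sq (hcut h₂ y hy), hfac]
    · obtain ⟨v, hv, hv'⟩ := segmentSqrt_ofReal_pos (h12.trans hy) hy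
      obtain ⟨u, hu, hu'⟩ := cpow_half_ofReal_pos (sub_pos.2 hy')
      refine ⟨2 * W.C * v * u, by positivity, ?_⟩
      push_cast at hu'
      simp only [hv', hu']
      push_cast
      ring

variable {W}

lemma isOpen_compl_cuts : IsOpen W.cutsᶜ := by
  have h : W.cuts = Complex.ofReal '' {y | W.dY y ≤ 0} := by
    ext z
    exact ⟨fun ⟨y, hy, h⟩ => ⟨y, hy, h.symm⟩, fun ⟨y, hy, h⟩ => ⟨y, hy, h.symm⟩⟩
  rw [h, isOpen_compl_iff]
  exact Complex.isometry_ofReal.isClosedEmbedding.isClosedMap _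
    (isClosed_le W.continuous_dY continuous_const)

lemma notMem_cuts_of_im_ne_zero {y : ℂ} (h : y.im ≠ 0) : y ∉ W.cuts := by
  rintro ⟨u, -, rfl⟩
  simp at h

lemma one_notMem_cuts : (1 : ℂ) ∉ W.cuts := by
  rintro ⟨u, hu, h⟩
  have : u = 1 := by exact_mod_cast h.symm
  have := W.dY_one_pos
  grind

lemma segment_one_subset_compl_cuts {y : ℂ} (h : y.im ≠ 0) : segment ℝ 1 y ⊆ W.cutsᶜ := by
  rintro _ ⟨a, b, ha, hb, hab, rfl⟩
  rcases hb.eq_or_lt with rfl | hb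
  · have : a = 1 := by linarith
    subst this
    simpa using one_notMem_cuts
  · refine notMem_cuts_of_im_ne_zero ?_
    simp [hb.ne', h]

/-- Non-real points are joined to 1 by a segment; a real point off the cuts is first lifted by i. -/
lemma isPreconnected_compl_cuts : IsPreconnected W.cutsᶜ := by
  refine isPreconnected_of_forall 1 fun y hy => ?_
  by_cases him : y.im = 0
  · have h1 : segment ℝ y (y + Complex.I) ⊆ W.cutsᶜ := by
      rintro _ ⟨a, b, ha, hb, hab, rfl⟩
      rcases hb.eq_or_lt with rfl | hb
      · have : a = 1 := by linarith
        subst this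
        simpa using hy
      · refine notMem_cuts_of_im_ne_zero ?_
        simp [hb.ne', him]
    have h2 : segment ℝ 1 (y + Complex.I) ⊆ W.cutsᶜ :=
      segment_one_subset_compl_cuts (by simp [him])
    exact ⟨_, union_subset h2 h1, Or.inl (left_mem_segment _ _ _),
      Or.inr (left_mem_segment _ _ _), (convex_segment _ _).isPreconnected.union _
        (right_mem_segment _ _ _) (right_mem_segment _ _ _) (convex_segment _ _).isPreconnected⟩
  · exact ⟨_, segment_one_subset_compl_cuts him, left_mem_segment _ _ _, right_mem_segment _ _ _,
      (convex_segment _ _).isPreconnected⟩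

lemma conj_mem_compl_cuts {y : ℂ} (hy : y ∈ W.cutsᶜ) : starRingEnd ℂ y ∈ W.cutsᶜ := by
  rintro ⟨u, hu, h⟩
  refine hy ⟨u, hu, ?_⟩
  rw [← Complex.conj_conj y, h, Complex.conj_ofReal]

/-- An analytic function off the cuts which is real near `1` on the real axis commutes with
conjugation. -/
lemma conj_of_real_near_one {r : ℂ → ℂ} (hr : AnalyticOnNhd ℂ r W.cutsᶜ)
    (h1 : ∀ᶠ y : ℝ in 𝓝 1, (r y).im = 0) {y : ℂ} (hy : y ∈ W.cutsᶜ) :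
    r (starRingEnd ℂ y) = starRingEnd ℂ (r y) := by
  have hr' : AnalyticOnNhd ℂ (starRingEnd ℂ ∘ r ∘ starRingEnd ℂ) W.cutsᶜ := by
    refine DifferentiableOn.analyticOnNhd (fun z hz => ?_) isOpen_compl_cuts
    have := (hr _ (conj_mem_compl_cuts hz)).differentiableAt.conj_conj
    rw [Complex.conj_conj] at this
    exact this.differentiableWithinAt
  have hfreq : ∃ᶠ z in 𝓝[≠] (1 : ℂ), r z = (starRingEnd ℂ ∘ r ∘ starRingEnd ℂ) z := by
    have ht : Tendsto (fun x : ℝ => (x : ℂ)) (𝓝[≠] 1) (𝓝[≠] (1 : ℂ)) := by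
      refine tendsto_nhdsWithin_iff.2 ⟨?_, ?_⟩
      · exact (Complex.continuous_ofReal.tendsto' 1 1 (by simp)).mono_left nhdsWithin_le_nhds
      · filter_upwards [self_mem_nhdsWithin] with x hx
        exact fun h => hx (Complex.ofReal_eq_one.1 h)
    refine ht.frequently (Eventually.frequently ?_)
    filter_upwards [nhdsWithin_le_nhds h1] with x hx
    simp only [Function.comp, Complex.conj_ofReal]
    exact (Complex.conj_eq_iff_im.2 hx).symm
  have := hr.eqOn_of_preconnected_of_frequently_eq hr' isPreconnected_compl_cuts
    one_notMem_cuts hfreq (conj_mem_compl_cuts hy)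
  simpa using this

lemma Kx_sq_eq_dYc {x y : ℂ} (h : W.K x y = 0) : W.Kx x y ^ 2 = W.dYc y := by
  rw [Kx_sq h, dYc]
  ring

/-- At a real point of the curve K_x is real and non-zero, and its square is the discriminant, which
is therefore positive. -/
lemma notMem_cuts_of_mem_curve {y : ℂ} (hy : y ∈ W.curve) : y ∉ W.cuts := by
  obtain ⟨x, hx, hK⟩ := hy
  rintro ⟨u, hu, rfl⟩
  have h1 := Kx_sq_eq_dYc hK
  have h2 := Kx_ne_zero_of_K hx hK
  obtain ⟨v, hv⟩ : ∃ v : ℝ, W.Kx x u = v := by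
    refine ⟨2 * (W.C * u ^ 2 + W.E * u) * x + (W.A * u ^ 2 + W.B - u), ?_⟩
    simp [Kx]
  rw [hv] at h1 h2
  rw [dYc_ofReal] at h1
  have h3 : v ^ 2 = W.dY u := by exact_mod_cast h1
  have h4 : v ≠ 0 := by exact_mod_cast h2
  have : 0 < v ^ 2 := by positivity
  linarith

/-- The ratio of the square roots of the discriminant at conjugate points of the curve. -/
lemma sqrt_ratio {r : ℂ → ℂ} (hr : AnalyticOnNhd ℂ r W.cutsᶜ)
    (hsq : ∀ y ∈ W.cutsᶜ, r y ^ 2 = W.dYc y) (h1 : ∀ᶠ y : ℝ in 𝓝 1, (r y).im = 0) {x : ℝ} {y : ℂ}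
    (hx : x ∈ Icc W.x₁ W.x₂) (hK : W.K x y = 0) :
    r y ≠ 0 ∧ r (starRingEnd ℂ y) / r y = starRingEnd ℂ (W.Kx x y) / W.Kx x y := by
  have hy := notMem_cuts_of_mem_curve (W := W) ⟨x, hx, hK⟩
  have h2 := Kx_ne_zero_of_K hx hK
  have h3 : r y ^ 2 = W.Kx x y ^ 2 := by rw [hsq y hy, Kx_sq_eq_dYc hK]
  rw [conj_of_real_near_one hr h1 hy]
  -- The undetermined sign of r = ±K_x cancels in the ratio, so it need not be followed along the
  -- curve.
  rcases sq_eq_sq_iff_eq_or_eq_neg.1 h3 with h | h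
  · rw [h]
    exact ⟨h2, rfl⟩
  · rw [h]
    exact ⟨neg_ne_zero.2 h2, by rw [map_neg, neg_div_neg_eq]⟩

end Weights
-- Gluing functions and their reflection across the curve
namespace Weights

variable (W : Weights)

/-- The filter of neighbourhoods, inside the domain, of the point `Y(x)` of the Riemann sphere. -/
def nhdsBranch (x : ℝ) : Filter ℂ :=
  if W.a x = 0 then cocompact ℂ ⊓ 𝓟 W.domain
  else 𝓝[W.domain] ((-W.b x / (2 * W.a x) : ℝ) : ℂ)

/-- The poles of `w` in the domain. -/
def poles (w : ℂ → ℂ) : Set ℂ := {y | y ∈ W.domain ∧ meromorphicOrderAt w y < 0}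

/-- A conformal gluing function with real boundary values. -/
structure IsGluing (w : ℂ → ℂ) : Prop where
  analytic : ∀ y ∈ W.domain \ W.poles w, AnalyticAt ℂ w y
  poles_subsingleton : (W.poles w).Subsingleton
  injOn : InjOn w (W.domain \ W.poles w)
  glue : ∀ y ∈ W.curve, ∃ u : ℝ, Tendsto w (𝓝[W.domain] y) (𝓝 (u : ℂ)) ∧
    Tendsto w (𝓝[W.domain] (starRingEnd ℂ y)) (𝓝 (u : ℂ))

open Classical in
/-- The conformal map obtained from a gluing function. -/
def glued (w : ℂ → ℂ) (W₁ W₂ : ℂ) (y : ℂ) : ℂ :=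
  if y ∈ W.poles w then 0 else hMap (2 / (W₂ - W₁) * (w y - (W₁ + W₂) / 2))

end Weights
namespace Weights

variable {W : Weights}

lemma isOpen_compl_poles {w : ℂ → ℂ} (h : (W.poles w).Subsingleton) : IsOpen (W.poles w)ᶜ :=
  h.finite.isClosed.isOpen_compl

namespace IsGluing

variable {w : ℂ → ℂ} (h : W.IsGluing w)
include h

lemma isOpen_diff : IsOpen (W.domain \ W.poles w) :=
  isOpen_domain.inter (isOpen_compl_poles h.poles_subsingleton)

lemma deriv_ne_zero {y : ℂ} (hy : y ∈ W.domain \ W.poles w) : deriv w y ≠ 0 :=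
  deriv_ne_zero_of_injOn (h.analytic y hy) (h.isOpen_diff.mem_nhds hy) h.injOn

lemma map_nhds {y : ℂ} (hy : y ∈ W.domain \ W.poles w) : map w (𝓝 y) = 𝓝 (w y) :=
  (h.analytic y hy).hasStrictDerivAt.map_nhds_eq (h.deriv_ne_zero hy)

lemma eventually_notMem_poles {y : ℂ} (hy : y ∈ W.curve) :
    ∀ᶠ z in 𝓝[W.domain] y, z ∈ W.domain \ W.poles w := by
  have h1 : y ∈ (W.poles w)ᶜ := fun hp => notMem_domain_of_mem_curve hy hp.1
  filter_upwards [nhdsWithin_le_nhds ((isOpen_compl_poles h.poles_subsingleton).mem_nhds h1),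
    self_mem_nhdsWithin] with z hz hz'
  exact ⟨hz', hz⟩

/-- The values in the domain differ from the boundary values along any filter that leaves every
neighbourhood of the point. -/
lemma ne_of_tendsto {y u : ℂ} {l : Filter ℂ} [l.NeBot] (hy : y ∈ W.domain \ W.poles w)
    (hl : W.domain \ W.poles w ∈ l) (hd : Disjoint (𝓝 y) l) (hu : Tendsto w l (𝓝 u)) :
    w y ≠ u := by
  rintro rfl
  obtain ⟨V, hV, V', hV', hVV⟩ := Filter.disjoint_iff.1 hd
  have h1 : w '' (V ∩ (W.domain \ W.poles w)) ∈ 𝓝 (w y) := by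
    rw [← h.map_nhds hy]
    exact image_mem_map (inter_mem hV (h.isOpen_diff.mem_nhds hy))
  obtain ⟨z, ⟨p, ⟨hp, hp'⟩, hpz⟩, hz, hz'⟩ :=
    ((hu.eventually h1).and (inter_mem hl hV' : _ ∈ l)).exists
  rw [h.injOn hp' hz hpz] at hp
  exact Set.disjoint_left.1 hVV hp hz'

/-- The boundary values. -/
lemma tendsto_extendFrom {y : ℂ} (hy : y ∈ W.curve) :
    Tendsto w (𝓝[W.domain] y) (𝓝 (extendFrom W.domain w y)) := by
  obtain ⟨u, hu, -⟩ := h.glue y hy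
  rwa [extendFrom_eq (mem_closure_domain hy) hu]

lemma extendFrom_im {y : ℂ} (hy : y ∈ W.curve) : (extendFrom W.domain w y).im = 0 := by
  obtain ⟨u, hu, -⟩ := h.glue y hy
  rw [extendFrom_eq (mem_closure_domain hy) hu, Complex.ofReal_im]

lemma extendFrom_conj {y : ℂ} (hy : y ∈ W.curve) :
    extendFrom W.domain w (starRingEnd ℂ y) = extendFrom W.domain w y := by
  obtain ⟨u, hu, hu'⟩ := h.glue y hy
  rw [extendFrom_eq (mem_closure_domain hy) hu,
    extendFrom_eq (mem_closure_domain (conj_mem_curve hy)) hu']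

lemma continuousOn_extendFrom : ContinuousOn (extendFrom W.domain w) W.curve :=
  _root_.continuousOn_extendFrom (fun _ hy => mem_closure_domain hy)
    fun _ hy => ⟨_, h.tendsto_extendFrom hy⟩

lemma ne_extendFrom {p y : ℂ} (hp : p ∈ W.domain \ W.poles w) (hy : y ∈ W.curve) :
    w p ≠ extendFrom W.domain w y :=
  have := neBot_of_mem_curve hy
  h.ne_of_tendsto hp (h.eventually_notMem_poles hy) (disjoint_nhds_of_mem_curve hy hp.1)
    (h.tendsto_extendFrom hy)

/-- A ball in a chart on which the gluing function is analytic and bounded. -/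
lemma exists_ball {y₀ : ℂ} {ψ : ℂ → ℂ} (hψ : W.IsChart y₀ ψ) : ∃ δ > 0, ∃ M,
    (∀ z ∈ Metric.ball (0 : ℂ) δ,
      AnalyticAt ℂ ψ z ∧ (z.im = 0 → ψ z ∈ W.curve) ∧ (0 < z.im → ψ z ∈ W.domain)) ∧
    ∀ z ∈ upperBall δ, ψ z ∈ W.domain \ W.poles w ∧ ‖w (ψ z)‖ ≤ M := by
  obtain ⟨δ₀, hδ₀, hball₀⟩ := hψ.exists_ball
  have hlim := h.tendsto_extendFrom hψ.mem_curve
  have hev : ∀ᶠ y in 𝓝[W.domain] y₀, y ∈ W.domain \ W.poles w ∧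
      ‖w y‖ ≤ ‖extendFrom W.domain w y₀‖ + 1 :=
    (h.eventually_notMem_poles hψ.mem_curve).and <|
      (hlim.norm.eventually (gt_mem_nhds (lt_add_one _))).mono fun _ h => h.le
  rw [hψ.nhdsWithin_domain, eventually_map, eventually_nhdsWithin_iff] at hev
  obtain ⟨δ₁, hδ₁, hball₁⟩ := Metric.eventually_nhds_iff_ball.1 hev
  exact ⟨min δ₀ δ₁, lt_min hδ₀ hδ₁, _,
    fun z hz => hball₀ z (Metric.ball_subset_ball (min_le_left _ _) hz),
    fun z hz => hball₁ z (Metric.ball_subset_ball (min_le_right _ _) hz.1) hz.2⟩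

/-- Schwarz reflection of a gluing function in a chart. -/
lemma exists_extension {y₀ : ℂ} {ψ : ℂ → ℂ} (hψ : W.IsChart y₀ ψ) : ∃ Φ : ℂ → ℂ,
    AnalyticAt ℂ Φ 0 ∧ Φ 0 = extendFrom W.domain w y₀ ∧
    ∀ᶠ z in 𝓝 (0 : ℂ), (z.im = 0 → ψ z ∈ W.curve ∧ Φ z = extendFrom W.domain w (ψ z)) ∧
      (0 < z.im → Φ z = w (ψ z)) ∧ (z.im < 0 → Φ z = starRingEnd ℂ (w (ψ (starRingEnd ℂ z)))) := by
  obtain ⟨δ, hδ, M, hball, hb⟩ := h.exists_ball hψ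
  have hconj : ∀ z ∈ lowerBall δ, starRingEnd ℂ z ∈ upperBall δ := fun z hz =>
    ⟨by simpa using hz.1, by simpa using hz.2⟩
  have hfd : ∀ z ∈ upperBall δ, DifferentiableAt ℂ (fun z => w (ψ z)) z := fun z hz =>
    (h.analytic _ (hb z hz).1).differentiableAt.comp z (hball z hz.1).1.differentiableAt
  have hlim : ∀ x : ℝ, |x| < δ → Tendsto (fun z => w (ψ z)) (𝓝[upperBall δ] (x : ℂ))
      (𝓝 (extendFrom W.domain w (ψ x))) := fun x hx =>
    (h.tendsto_extendFrom ((hball x (by simpa using hx)).2.1 (by simp))).comp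
      (tendsto_upperBall hball hx)
  have hm : Matching (fun z => w (ψ z))
      (fun z => starRingEnd ℂ (w (ψ (starRingEnd ℂ z)))) δ M := by
    refine ⟨fun z hz => (hfd z hz).differentiableWithinAt, fun z hz => ?_, fun z hz => (hb z hz).2,
      fun z hz => ?_, fun x hx => ?_⟩
    · have h1 := (hfd _ (hconj z hz)).conj_conj
      rw [Complex.conj_conj] at h1
      exact h1.differentiableWithinAt
    · rw [RCLike.norm_conj]
      exact (hb _ (hconj z hz)).2
    · have h1 := hlim x hx
      have h2 := (Complex.continuous_conj.tendsto _).comp h1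
      have h3 := h1.sub h2
      rw [Complex.conj_eq_iff_im.2
        (h.extendFrom_im ((hball x (by simpa using hx)).2.1 (by simp))), sub_self] at h3
      refine h3.congr fun z => ?_
      simp
  obtain ⟨Φ, hΦ, hΦu, hΦl⟩ := hm.exists_extension
  have hreal : ∀ x : ℝ, |x| < δ → Φ x = extendFrom W.domain w (ψ x) := fun x hx => by
    have hx' : (x : ℂ) ∈ Metric.ball (0 : ℂ) δ := by simpa using hx
    have := upperBall_neBot hx
    have hc : ContinuousAt Φ x :=
      (hΦ.differentiableAt (Metric.isOpen_ball.mem_nhds hx')).continuousAt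
    refine tendsto_nhds_unique (hc.tendsto.mono_left
      (nhdsWithin_le_nhds (s := upperBall δ))) ((hlim x hx).congr' ?_)
    filter_upwards [self_mem_nhdsWithin] with z hz
    rw [hΦu hz]
  refine ⟨Φ, hΦ.analyticAt (Metric.ball_mem_nhds 0 hδ), ?_, ?_⟩
  · have := hreal 0 (by simpa using hδ)
    rwa [Complex.ofReal_zero, hψ.zero] at this
  · filter_upwards [Metric.ball_mem_nhds (0 : ℂ) hδ] with z hz
    refine ⟨fun him => ⟨(hball z hz).2.1 him, ?_⟩, fun him => hΦu ⟨hz, him⟩,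
      fun him => hΦl ⟨hz, him⟩⟩
    have hzre : z = (z.re : ℂ) := Complex.ext (by simp) (by simpa using him)
    have := hreal z.re (by rw [hzre] at hz; simpa using hz)
    rwa [← hzre] at this

/-- A real number close to the boundary value at a point of the curve is either a boundary value,
or a value of the gluing function near the point. -/
lemma eventually_exists_eq {y₀ : ℂ} (hy₀ : y₀ ∈ W.curve) {U : Set ℂ} (hU : U ∈ 𝓝 y₀) :
    ∀ᶠ ρ : ℝ in 𝓝 (extendFrom W.domain w y₀).re,
      (∃ y ∈ W.curve, extendFrom W.domain w y = ρ) ∨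
        ∃ p ∈ U ∩ (W.domain \ W.poles w), w p = ρ := by
  obtain ⟨ψ, hψ⟩ := exists_chart hy₀
  obtain ⟨Φ, hΦ, hΦ0, hΦv⟩ := h.exists_extension hψ
  have hup : ∀ᶠ z in 𝓝[{z : ℂ | 0 < z.im}] 0, ψ z ∈ U ∩ (W.domain \ W.poles w) := by
    have : ∀ᶠ y in 𝓝[W.domain] y₀, y ∈ U ∩ (W.domain \ W.poles w) :=
      (nhdsWithin_le_nhds hU : U ∈ 𝓝[W.domain] y₀) |> fun h1 =>
        inter_mem h1 (h.eventually_notMem_poles hy₀)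
    rwa [hψ.nhdsWithin_domain, eventually_map] at this
  rw [eventually_nhdsWithin_iff] at hup
  -- Open mapping alternative: a constant Φ would make w locally constant in the domain. Otherwise Φ
  -- covers a neighbourhood, and reflection turns preimages in the lower half-plane of a real value
  -- into preimages in the upper one.
  rcases hΦ.eventually_constant_or_nhds_le_map_nhds with hcst | hopen
  · exfalso
    have h1 : ∀ᶠ z in 𝓝[{z : ℂ | 0 < z.im}] 0, w (ψ z) = Φ 0 := by
      rw [eventually_nhdsWithin_iff]
      filter_upwards [hcst, hΦv] with z h1 h2 h3
      rw [← h2.2.1 h3, h1]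
    have h2 : ∀ᶠ y in 𝓝[W.domain] y₀, w y = Φ 0 := by
      rwa [hψ.nhdsWithin_domain, eventually_map]
    have := neBot_of_mem_curve hy₀
    obtain ⟨y, hy, hy'⟩ := ((eventually_eventually_nhdsWithin.2 h2).and
      (h.eventually_notMem_poles hy₀)).exists
    rw [isOpen_domain.nhdsWithin_eq hy'.1] at hy
    have h3 : w =ᶠ[𝓝 y] fun _ => Φ 0 := hy
    exact h.deriv_ne_zero hy' (by rw [h3.deriv_eq, deriv_const])
  · obtain ⟨δ, hδ, hball⟩ := Metric.eventually_nhds_iff_ball.1 (hΦv.and hup)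
    have himg : Φ '' Metric.ball 0 δ ∈ 𝓝 (Φ 0) :=
      hopen (image_mem_map (Metric.ball_mem_nhds 0 hδ))
    have hval : Φ 0 = ((extendFrom W.domain w y₀).re : ℂ) := by
      rw [hΦ0]
      exact Complex.ext (by simp) (by simpa using h.extendFrom_im hy₀)
    rw [hval] at himg
    filter_upwards [Complex.continuous_ofReal.continuousAt.eventually himg] with ρ hρ
    obtain ⟨z, hz, hzρ⟩ := hρ
    obtain ⟨⟨h0, h1, h2⟩, h3⟩ := hball z hz
    rcases lt_trichotomy z.im 0 with him | him | him
    · right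
      have hz' : starRingEnd ℂ z ∈ Metric.ball (0 : ℂ) δ := by simpa using hz
      have him' : 0 < (starRingEnd ℂ z).im := by simpa using him
      refine ⟨_, (hball _ hz').2 him', ?_⟩
      rw [← Complex.conj_conj (w _), ← h2 him, hzρ, Complex.conj_ofReal]
    · left
      exact ⟨_, (h0 him).1, (h0 him).2.symm.trans hzρ⟩
    · right
      exact ⟨_, h3 him, (h1 him).symm.trans hzρ⟩

/-- At a non-real point of the curve, the boundary value is an interior point of the set of
boundary values. -/
lemma eventually_exists_extendFrom_eq {y₀ : ℂ} (hy₀ : y₀ ∈ W.curve)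
    (hne : y₀ ≠ starRingEnd ℂ y₀) : ∀ᶠ ρ : ℝ in 𝓝 (extendFrom W.domain w y₀).re,
      ∃ y ∈ W.curve, extendFrom W.domain w y = ρ := by
  obtain ⟨U, V, hU, hV, hyU, hyV, hUV⟩ := t2_separation hne
  have h1 := h.eventually_exists_eq hy₀ (hU.mem_nhds hyU)
  have h2 := h.eventually_exists_eq (conj_mem_curve hy₀) (hV.mem_nhds hyV)
  rw [h.extendFrom_conj hy₀] at h2
  filter_upwards [h1, h2] with ρ h1 h2
  rcases h1 with h1 | ⟨p, ⟨hp, hp'⟩, hpρ⟩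
  · exact h1
  rcases h2 with h2 | ⟨q, ⟨hq, hq'⟩, hqρ⟩
  · exact h2
  -- If ρ is not a boundary value, it is attained in the domain near y₀ and near its conjugate, in
  -- disjoint neighbourhoods.
  rw [h.injOn hp' hq' (hpρ.trans hqρ.symm)] at hp
  exact absurd hq (Set.disjoint_left.1 hUV hp)

/-- Near a point of the curve, the gluing function commutes with conjugation. -/
lemma eventually_conj {y₀ : ℂ} (hy₀ : y₀ ∈ W.curve) : ∀ᶠ y in 𝓝[W.domain] y₀,
    w (starRingEnd ℂ y) = starRingEnd ℂ (w y) := by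
  obtain ⟨ψ, hψ⟩ := exists_chart hy₀
  have hy₀c := conj_mem_curve hy₀
  have hctend : Tendsto (starRingEnd ℂ) (𝓝[W.domain] y₀) (𝓝[W.domain] (starRingEnd ℂ y₀)) := by
    simpa using tendsto_conj_domain (W := W) (starRingEnd ℂ y₀)
  have hbd : ∀ {y}, y ∈ W.curve → ∀ᶠ z in 𝓝[W.domain] y, z ∈ W.domain \ W.poles w ∧
      ‖w z‖ ≤ ‖extendFrom W.domain w y‖ + 1 := fun hy =>
    (h.eventually_notMem_poles hy).and <|
      ((h.tendsto_extendFrom hy).norm.eventually (gt_mem_nhds (lt_add_one _))).mono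
        fun _ h => h.le
  have hev := (hbd hy₀).and (hctend.eventually (hbd hy₀c))
  rw [hψ.nhdsWithin_domain, eventually_map, eventually_nhdsWithin_iff] at hev
  obtain ⟨δ₀, hδ₀, hball₀⟩ := hψ.exists_ball
  obtain ⟨δ₁, hδ₁, hball₁⟩ := Metric.eventually_nhds_iff_ball.1 hev
  set δ := min δ₀ δ₁
  have hδ : 0 < δ := lt_min hδ₀ hδ₁
  have hball : ∀ z ∈ Metric.ball (0 : ℂ) δ,
      AnalyticAt ℂ ψ z ∧ (z.im = 0 → ψ z ∈ W.curve) ∧ (0 < z.im → ψ z ∈ W.domain) :=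
    fun z hz => hball₀ z (Metric.ball_subset_ball (min_le_left _ _) hz)
  have hb : ∀ z ∈ upperBall δ, _ :=
    fun z hz => hball₁ z (Metric.ball_subset_ball (min_le_right _ _) hz.1) hz.2
  -- This difference has boundary values 0, by gluing and reality of w on the curve, so it extends
  -- by 0 across the axis and the identity theorem makes it vanish.
  have hm : Matching (fun z => w (ψ z) - starRingEnd ℂ (w (starRingEnd ℂ (ψ z)))) (fun _ => 0) δ
      ((‖extendFrom W.domain w y₀‖ + 1) +
        (‖extendFrom W.domain w (starRingEnd ℂ y₀)‖ + 1)) := by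
    refine ⟨fun z hz => ?_, differentiableOn_const _, fun z hz => ?_, fun z hz => ?_,
      fun x hx => ?_⟩
    · have h1 := (h.analytic _ (hb z hz).2.1).differentiableAt.conj_conj
      rw [Complex.conj_conj] at h1
      have h2 := (hball z hz.1).1.differentiableAt
      exact (((h.analytic _ (hb z hz).1.1).differentiableAt.comp z h2).sub
        (h1.comp z h2)).differentiableWithinAt
    · refine (norm_sub_le _ _).trans (add_le_add (hb z hz).1.2 ?_)
      rw [RCLike.norm_conj]
      exact (hb z hz).2.2
    · rw [norm_zero]
      positivity
    · have hxc : ψ x ∈ W.curve := (hball x (by simpa using hx)).2.1 (by simp)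
      have h1 := (h.tendsto_extendFrom hxc).comp (tendsto_upperBall hball hx)
      have hct : Tendsto (starRingEnd ℂ) (𝓝[W.domain] (ψ x))
          (𝓝[W.domain] (starRingEnd ℂ (ψ x))) := by
        simpa using tendsto_conj_domain (W := W) (starRingEnd ℂ (ψ x))
      have h2 := (Complex.continuous_conj.tendsto _).comp
        (((h.tendsto_extendFrom (conj_mem_curve hxc)).comp hct).comp (tendsto_upperBall hball hx))
      have h3 := h1.sub h2
      rw [h.extendFrom_conj hxc, Complex.conj_eq_iff_im.2 (h.extendFrom_im hxc), sub_self] at h3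
      refine h3.congr fun z => ?_
      simp
  obtain ⟨D, hD, hDu, hDl⟩ := hm.exists_extension
  have hDan : AnalyticOnNhd ℂ D (Metric.ball 0 δ) := hD.analyticOnNhd Metric.isOpen_ball
  have hlow : ((-(δ / 2) : ℝ) * Complex.I : ℂ) ∈ lowerBall δ := by
    refine ⟨?_, ?_⟩
    · rw [mem_ball_zero_iff, norm_mul, Complex.norm_I, mul_one, Complex.norm_real,
        Real.norm_eq_abs, abs_neg, abs_of_pos (by positivity)]
      linarith
    · simpa using hδ
  have hzero := hDan.eqOn_zero_of_preconnected_of_eventuallyEq_zero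
    (convex_ball 0 δ).isPreconnected hlow.1 (by
      filter_upwards [(isOpen_lowerBall δ).mem_nhds hlow] with z hz using hDl hz)
  rw [hψ.nhdsWithin_domain, eventually_map, ← nhdsWithin_upperBall hδ]
  filter_upwards [self_mem_nhdsWithin] with z hz
  have h1 := hzero hz.1
  rw [hDu hz] at h1
  have h2 : w (ψ z) = starRingEnd ℂ (w (starRingEnd ℂ (ψ z))) := sub_eq_zero.1 h1
  rw [h2, Complex.conj_conj]

end IsGluing
end Weights
-- Boundary values between the two branch points
namespace Weights

variable (W : Weights)

/-- The branch of the curve in the upper half-plane. -/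
def upperPoint (x : ℝ) : ℂ := ⟨-W.b x / (2 * W.a x), Real.sqrt (-W.d x) / (2 * W.a x)⟩

variable {W}

lemma normSq_upperPoint {x : ℝ} (hx : x ∈ Icc W.x₁ W.x₂) (ha : 0 < W.a x) :
    W.a x * Complex.normSq (W.upperPoint x) = W.c x := by
  have hs := Real.sq_sqrt (neg_nonneg.2 (d_nonpos hx))
  have : W.a x * Complex.normSq (W.upperPoint x) =
      (W.b x ^ 2 + Real.sqrt (-W.d x) ^ 2) / (4 * W.a x) := by
    rw [Complex.normSq_apply, upperPoint]
    field_simp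
    ring
  rw [this, hs, d]
  field_simp
  ring

lemma upperPoint_mem_curve {x : ℝ} (hx : x ∈ Icc W.x₁ W.x₂) (ha : 0 < W.a x) :
    W.upperPoint x ∈ W.curve := by
  refine mem_curve_iff.2 ⟨x, hx, normSq_upperPoint hx ha, ?_⟩
  simp only [upperPoint]
  field_simp
  ring

lemma eq_upperPoint_or {y : ℂ} (hy : y ∈ W.curve) : ∃ x ∈ Icc W.x₁ W.x₂, 0 < W.a x ∧
    (y = W.upperPoint x ∨ y = starRingEnd ℂ (W.upperPoint x)) := by
  obtain ⟨x, hx, h1, h2⟩ := mem_curve_iff.1 hy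
  have ha := a_pos_of_eq hx.1 h1
  have hre : y.re = (W.upperPoint x).re := by
    simp only [upperPoint]
    field_simp
    linarith
  have him : y.im ^ 2 = (W.upperPoint x).im ^ 2 := by
    have h3 := normSq_upperPoint hx ha
    rw [← h1] at h3
    have h4 := mul_left_cancel₀ ha.ne' h3
    rw [Complex.normSq_apply, Complex.normSq_apply, hre] at h4
    linarith
  refine ⟨x, hx, ha, ?_⟩
  rcases sq_eq_sq_iff_eq_or_eq_neg.1 him with h | h
  · exact Or.inl (Complex.ext hre h)
  · exact Or.inr (Complex.ext (by simpa using hre) (by simpa using h))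

lemma upperPoint_ne_conj {x : ℝ} (hx : x ∈ Ioo W.x₁ W.x₂) :
    W.upperPoint x ≠ starRingEnd ℂ (W.upperPoint x) := by
  have ha := W.a_pos (W.x₁_nonneg.trans_lt hx.1)
  have hs := Real.sqrt_pos.2 (neg_pos.2 (d_neg hx))
  intro h
  have h1 := Complex.conj_eq_iff_im.1 h.symm
  have : 0 < (W.upperPoint x).im := div_pos hs (by positivity)
  linarith

lemma upperPoint_of_d_eq_zero {x : ℝ} (hd : W.d x = 0) :
    W.upperPoint x = ((-W.b x / (2 * W.a x) : ℝ) : ℂ) := by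
  apply Complex.ext <;> simp [upperPoint, hd, -Complex.ofReal_div, -Complex.ofReal_mul,
    -Complex.ofReal_neg]

lemma continuousAt_upperPoint {x : ℝ} (ha : W.a x ≠ 0) : ContinuousAt W.upperPoint x := by
  have h1 := W.continuous_a
  have h2 := W.continuous_b
  have h3 := W.continuous_d
  have h4 : 2 * W.a x ≠ 0 := mul_ne_zero two_ne_zero ha
  have h5 : W.upperPoint = fun x => ((-W.b x / (2 * W.a x) : ℝ) : ℂ) +
      ((Real.sqrt (-W.d x) / (2 * W.a x) : ℝ) : ℂ) * Complex.I := by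
    funext x
    apply Complex.ext <;> simp [upperPoint, -Complex.ofReal_div]
  rw [h5]
  have h6 : ContinuousAt (fun x => -W.b x / (2 * W.a x)) x :=
    h2.neg.continuousAt.div (h1.const_mul 2).continuousAt h4
  have h7 : ContinuousAt (fun x => Real.sqrt (-W.d x) / (2 * W.a x)) x :=
    h3.neg.sqrt.continuousAt.div (h1.const_mul 2).continuousAt h4
  fun_prop

/-- When the branch point is a zero of `a`, the curve goes to infinity. -/
lemma tendsto_upperPoint_cocompact {x : ℝ} (hx : x ∈ Icc W.x₁ W.x₂) (ha : W.a x = 0) :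
    Tendsto W.upperPoint (𝓝[Icc W.x₁ W.x₂ \ {x}] x) (cocompact ℂ) := by
  rw [← Metric.cobounded_eq_cocompact, ← tendsto_norm_atTop_iff_cobounded]
  have hx0 : x = 0 := (a_eq_zero_iff hx.1).1 ha
  have hpos : ∀ x' ∈ Icc W.x₁ W.x₂ \ {x}, 0 < W.a x' := fun x' hx' =>
    W.a_pos (lt_of_le_of_ne (W.x₁_nonneg.trans hx'.1.1) (by rw [← hx0]; exact Ne.symm hx'.2))
  have h1 : Tendsto (fun x' => W.c x' * (W.a x')⁻¹) (𝓝[Icc W.x₁ W.x₂ \ {x}] x) atTop := by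
    refine Tendsto.pos_mul_atTop (c_pos' hx.1)
      (W.continuous_c.continuousAt.tendsto.mono_left nhdsWithin_le_nhds) ?_
    refine tendsto_inv_nhdsGT_zero.comp (tendsto_nhdsWithin_iff.2 ⟨?_, ?_⟩)
    · have := W.continuous_a.continuousAt.tendsto (x := x)
      rw [ha] at this
      exact this.mono_left nhdsWithin_le_nhds
    · filter_upwards [self_mem_nhdsWithin] with x' hx' using hpos x' hx'
  have h2 := Real.tendsto_sqrt_atTop.comp h1
  refine h2.congr' ?_
  filter_upwards [self_mem_nhdsWithin] with x' hx'
  have h3 := hpos x' hx'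
  have h4 := normSq_upperPoint hx'.1 h3
  have h5 : W.c x' * (W.a x')⁻¹ = ‖W.upperPoint x'‖ ^ 2 := by
    rw [← h4, Complex.normSq_eq_norm_sq]
    field_simp
  rw [Function.comp, h5, Real.sqrt_sq (norm_nonneg _)]

variable (W) in
/-- The boundary values along the upper half of the curve, from one branch point to the other. -/
def boundaryValue (w : ℂ → ℂ) (W₁ : ℂ) (x : ℝ) : ℂ :=
  if W.a x = 0 then W₁ else extendFrom W.domain w (W.upperPoint x)

variable {w : ℂ → ℂ} {W₁ W₂ : ℂ}

lemma boundaryValue_of_mem_Ioc {x : ℝ} (hx : x ∈ Ioc W.x₁ W.x₂) :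
    W.upperPoint x ∈ W.curve ∧
      W.boundaryValue w W₁ x = extendFrom W.domain w (W.upperPoint x) := by
  have ha := W.a_pos (W.x₁_nonneg.trans_lt hx.1)
  exact ⟨upperPoint_mem_curve ⟨hx.1.le, hx.2⟩ ha, by rw [boundaryValue, if_neg ha.ne']⟩

lemma boundaryValue_x₁ (h₁ : Tendsto w (W.nhdsBranch W.x₁) (𝓝 W₁)) : W.boundaryValue w W₁ W.x₁ = W₁ := by
  rw [boundaryValue]
  split_ifs with ha
  · rfl
  · have ha' : 0 < W.a W.x₁ := lt_of_le_of_ne (a_nonneg W.x₁_nonneg) (Ne.symm ha)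
    rw [nhdsBranch, if_neg ha, ← upperPoint_of_d_eq_zero W.d_x₁] at h₁
    exact extendFrom_eq (mem_closure_domain (upperPoint_mem_curve left_mem ha')) h₁

lemma boundaryValue_x₂ (h₂ : Tendsto w (W.nhdsBranch W.x₂) (𝓝 W₂)) : W.boundaryValue w W₁ W.x₂ = W₂ := by
  have ha := W.a_pos W.x₂_pos
  rw [boundaryValue, if_neg ha.ne']
  rw [nhdsBranch, if_neg ha.ne', ← upperPoint_of_d_eq_zero W.d_x₂] at h₂
  exact extendFrom_eq (mem_closure_domain (upperPoint_mem_curve right_mem ha)) h₂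

namespace IsGluing

variable {w : ℂ → ℂ} (h : W.IsGluing w) {W₁ W₂ : ℂ}
  (h₁ : Tendsto w (W.nhdsBranch W.x₁) (𝓝 W₁)) (h₂ : Tendsto w (W.nhdsBranch W.x₂) (𝓝 W₂))

include h

-- The only point where this is not continuity of the extension of w along the curve is a zero of a:
-- there the curve runs to infinity, and the limit of w at infinity has to control its boundary
-- values.
include h₁ in
lemma continuousOn_boundaryValue : ContinuousOn (W.boundaryValue w W₁) (Icc W.x₁ W.x₂) := by
  intro x hx
  by_cases ha : W.a x = 0
  · have hx0 : x = 0 := (a_eq_zero_iff hx.1).1 ha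
    have hx₁ : W.x₁ = x := le_antisymm hx.1 (hx0 ▸ W.x₁_nonneg)
    rw [← continuousWithinAt_sdiff_self, ContinuousWithinAt, boundaryValue, if_pos ha]
    rw [nhdsBranch, hx₁, if_pos ha] at h₁
    -- Neighbourhoods are taken closed so that they contain the boundary values, which are limits of
    -- values of w inside the domain.
    refine (closed_nhds_basis W₁).ge_iff.2 fun N ⟨hN, hNc⟩ => ?_
    have h3 := mem_map.1 (h₁ hN)
    rw [mem_inf_principal] at h3
    obtain ⟨K, hK, hKs⟩ := mem_cocompact.1 h3
    have h4 := (tendsto_upperPoint_cocompact hx ha).eventually hK.compl_mem_cocompact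
    refine mem_map.2 ?_
    filter_upwards [h4, self_mem_nhdsWithin] with x' h5 hx'
    have ha' : 0 < W.a x' := W.a_pos (lt_of_le_of_ne (W.x₁_nonneg.trans hx'.1.1)
      (by rw [← hx0]; exact Ne.symm hx'.2))
    have hc := upperPoint_mem_curve hx'.1 ha'
    have := neBot_of_mem_curve hc
    rw [mem_preimage, boundaryValue, if_neg ha'.ne']
    refine hNc.mem_of_tendsto (h.tendsto_extendFrom hc) ?_
    filter_upwards [nhdsWithin_le_nhds (hK.isClosed.isOpen_compl.mem_nhds h5),
      self_mem_nhdsWithin] with z hz hz'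
    exact hKs hz hz'
  · have hev : ∀ᶠ x' in 𝓝 x, W.a x' ≠ 0 := W.continuous_a.continuousAt.eventually_ne ha
    have hpos : ∀ x' ∈ Icc W.x₁ W.x₂, W.a x' ≠ 0 → 0 < W.a x' := fun x' hx' h =>
      lt_of_le_of_ne (a_nonneg (W.x₁_nonneg.trans hx'.1)) (Ne.symm h)
    have hcomp : Tendsto W.upperPoint (𝓝[Icc W.x₁ W.x₂] x) (𝓝[W.curve] (W.upperPoint x)) := by
      refine tendsto_nhdsWithin_iff.2
        ⟨(continuousAt_upperPoint ha).tendsto.mono_left nhdsWithin_le_nhds, ?_⟩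
      filter_upwards [nhdsWithin_le_nhds hev, self_mem_nhdsWithin] with x' h1 h2
      exact upperPoint_mem_curve h2 (hpos x' h2 h1)
    have h5 := (h.continuousOn_extendFrom _ (upperPoint_mem_curve hx (hpos x hx ha))).tendsto.comp
      hcomp
    rw [ContinuousWithinAt, boundaryValue, if_neg ha]
    refine h5.congr' ?_
    filter_upwards [nhdsWithin_le_nhds hev] with x' hx'
    rw [boundaryValue, if_neg hx', Function.comp]

-- Reality on the curve passes to x₁ by continuity; this covers Y(x₁) = ∞, where reality is not
-- assumed.
include h₁ in
lemma boundaryValue_im {x : ℝ} (hx : x ∈ Icc W.x₁ W.x₂) :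
    (W.boundaryValue w W₁ x).im = 0 := by
  have hcl : x ∈ closure (Ioc W.x₁ W.x₂) := by
    rwa [closure_Ioc W.x₁_lt_x₂.ne]
  have hmaps : MapsTo (W.boundaryValue w W₁) (Ioc W.x₁ W.x₂) {z | z.im = 0} := fun x' hx' => by
    obtain ⟨h3, h4⟩ := boundaryValue_of_mem_Ioc (w := w) (W₁ := W₁) hx'
    rw [mem_ofPred_eq, h4]
    exact h.extendFrom_im h3
  have := ((h.continuousOn_boundaryValue h₁ x hx).mono Ioc_subset_Icc_self).mem_closure hcl hmaps
  rwa [(isClosed_eq Complex.continuous_im continuous_const).closure_eq] at this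

/-- By gluing, the upper half of the curve already carries all boundary values. -/
lemma extendFrom_mem_image {y : ℂ} (hy : y ∈ W.curve) :
    ∃ x ∈ Icc W.x₁ W.x₂, W.boundaryValue w W₁ x = extendFrom W.domain w y := by
  obtain ⟨x, hx, ha, rfl | rfl⟩ := eq_upperPoint_or hy
  · exact ⟨x, hx, by rw [boundaryValue, if_neg ha.ne']⟩
  · exact ⟨x, hx, by
      rw [boundaryValue, if_neg ha.ne', h.extendFrom_conj (upperPoint_mem_curve hx ha)]⟩

/-- Boundary values at interior parameters are interior boundary values. -/
lemma eventually_mem_image {x : ℝ} (hx : x ∈ Ioo W.x₁ W.x₂) :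
    ∀ᶠ ρ in 𝓝 (W.boundaryValue w W₁ x).re,
      ρ ∈ (fun x => (W.boundaryValue w W₁ x).re) '' Icc W.x₁ W.x₂ := by
  obtain ⟨h3, h4⟩ := boundaryValue_of_mem_Ioc (w := w) (W₁ := W₁) (Ioo_subset_Ioc_self hx)
  rw [h4]
  filter_upwards [h.eventually_exists_extendFrom_eq h3 (upperPoint_ne_conj hx)]
  rintro ρ ⟨y, hy, hyρ⟩
  obtain ⟨x', hx', hv⟩ := h.extendFrom_mem_image (W₁ := W₁) hy
  exact ⟨x', hx', by simp [hv, hyρ]⟩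

include h₁ h₂ in
/-- The boundary values fill the segment between the values at the branch points, which are
different. -/
theorem exists_segment : ∃ u₁ u₂ : ℝ, W₁ = u₁ ∧ W₂ = u₂ ∧ u₁ ≠ u₂ ∧
    (∀ y ∈ W.curve, ∃ ρ ∈ uIcc u₁ u₂, extendFrom W.domain w y = (ρ : ℝ)) ∧
    ∀ ρ ∈ uIcc u₁ u₂, ∃ x ∈ Icc W.x₁ W.x₂, W.boundaryValue w W₁ x = (ρ : ℝ) := by
  set V : ℝ → ℝ := fun x => (W.boundaryValue w W₁ x).re with hV
  have hcont : ContinuousOn V (Icc W.x₁ W.x₂) :=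
    Complex.continuous_re.comp_continuousOn (h.continuousOn_boundaryValue h₁)
  have hval : ∀ x ∈ Icc W.x₁ W.x₂, W.boundaryValue w W₁ x = V x := fun x hx =>
    Complex.ext (by simp [hV]) (by simpa using h.boundaryValue_im h₁ hx)
  have hint : ∀ x ∈ Ioo W.x₁ W.x₂, ∀ᶠ ρ in 𝓝 (V x), ρ ∈ V '' Icc W.x₁ W.x₂ := fun x hx =>
    h.eventually_mem_image hx
  have hle : W.x₁ ≤ W.x₂ := W.x₁_lt_x₂.le
  have hend : ∀ x ∈ Icc W.x₁ W.x₂, x ∉ Ioo W.x₁ W.x₂ → x = W.x₁ ∨ x = W.x₂ := by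
    intro x hx hx'
    by_contra! hcon
    exact hx' ⟨lt_of_le_of_ne hx.1 hcon.1.symm, lt_of_le_of_ne hx.2 hcon.2⟩
  obtain ⟨p, hp, hpmax⟩ := isCompact_Icc.exists_isMaxOn (nonempty_Icc.2 hle) hcont
  obtain ⟨q, hq, hqmin⟩ := isCompact_Icc.exists_isMinOn (nonempty_Icc.2 hle) hcont
  -- At an interior parameter the image of V is a neighbourhood of the value, so no extremum can be
  -- there; all values thus lie between those at the endpoints.
  have hp' : p = W.x₁ ∨ p = W.x₂ := hend p hp fun hpI => by
    obtain ⟨ρ, hρ, x, hx, rfl⟩ := ((frequently_gt_nhds (V p)).and_eventually (hint p hpI)).exists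
    exact absurd (hpmax hx) (not_le.2 hρ)
  have hq' : q = W.x₁ ∨ q = W.x₂ := hend q hq fun hqI => by
    obtain ⟨ρ, hρ, x, hx, rfl⟩ := ((frequently_lt_nhds (V q)).and_eventually (hint q hqI)).exists
    exact absurd (hqmin hx) (not_le.2 hρ)
  have hsub : ∀ x ∈ Icc W.x₁ W.x₂, V x ∈ uIcc (V W.x₁) (V W.x₂) := fun x hx => by
    have h3 : V x ≤ V p := hpmax hx
    have h4 : V q ≤ V x := hqmin hx
    rw [mem_uIcc]
    rcases hp' with rfl | rfl <;> rcases hq' with rfl | rfl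
    · have := hpmax right_mem
      have := hqmin right_mem
      simp only [mem_ofPred_eq] at *
      grind
    · exact Or.inr ⟨h4, h3⟩
    · exact Or.inl ⟨h4, h3⟩
    · have := hpmax left_mem
      have := hqmin left_mem
      simp only [mem_ofPred_eq] at *
      grind
  refine ⟨V W.x₁, V W.x₂, ?_, ?_, ?_, ?_, ?_⟩
  · rw [← hval _ left_mem, boundaryValue_x₁ h₁]
  · rw [← hval _ right_mem, boundaryValue_x₂ h₂]
  -- Equal end values would make V constant, but its image is a neighbourhood of any interior value.
  · intro heq
    have hconst : ∀ x ∈ Icc W.x₁ W.x₂, V x = V W.x₁ := fun x hx => by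
      have := hsub x hx
      rwa [← heq, uIcc_self, mem_singleton_iff] at this
    obtain ⟨m, hm⟩ := exists_between W.x₁_lt_x₂
    obtain ⟨ρ, hρ, x, hx, rfl⟩ := ((frequently_gt_nhds (V m)).and_eventually (hint m hm)).exists
    have h3 := hconst x hx
    have h4 := hconst m ⟨hm.1.le, hm.2.le⟩
    rw [h3, h4] at hρ
    exact lt_irrefl _ hρ
  · intro y hy
    obtain ⟨x, hx, hxy⟩ := h.extendFrom_mem_image (W₁ := W₁) hy
    exact ⟨V x, hsub x hx, by rw [← hxy, hval x hx]⟩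
  · intro ρ hρ
    obtain ⟨x, hx, rfl⟩ := intermediate_value_uIcc (by rwa [uIcc_of_le hle]) hρ
    rw [uIcc_of_le hle] at hx
    exact ⟨x, hx, hval x hx⟩

end IsGluing
end Weights
-- From a gluing function to the conformal map
namespace Weights

variable {W : Weights}

lemma closure_domain_subset : closure W.domain ⊆ W.domain ∪ W.curve := by
  intro y hy
  by_contra hcon
  simp only [mem_union, not_or] at hcon
  rcases notMem_curve_iff.1 hcon.2 with h | h
  · exact hcon.1 (by rw [domain_eq]; exact h)
  · obtain ⟨z, hz, hz'⟩ := mem_closure_iff_nhds.1 hy _ (isClosed_inner.isOpen_compl.mem_nhds h)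
    rw [domain_eq] at hz'
    exact hz (mem_inner_of_notMem_outer hz')

/-- An injective analytic map from the domain to the disc is onto if it tends to the unit circle
at the boundary. -/
lemma surjOn_ball {g : ℂ → ℂ} (hg : AnalyticOnNhd ℂ g W.domain) (hinj : InjOn g W.domain)
    (hmaps : MapsTo g W.domain (Metric.ball 0 1))
    (hcurve : ∀ y ∈ W.curve, Tendsto (fun z => ‖g z‖) (𝓝[W.domain] y) (𝓝 1))
    (hinf : Tendsto (fun z => ‖g z‖) (cocompact ℂ ⊓ 𝓟 W.domain) (𝓝 1)) :
    SurjOn g W.domain (Metric.ball 0 1) := by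
  have hopen : IsOpen (g '' W.domain) := by
    rw [isOpen_iff_mem_nhds]
    rintro _ ⟨y, hy, rfl⟩
    rw [← (hg y hy).hasStrictDerivAt.map_nhds_eq
      (deriv_ne_zero_of_injOn (hg y hy) (isOpen_domain.mem_nhds hy) hinj)]
    exact image_mem_map (isOpen_domain.mem_nhds hy)
  refine (convex_ball (0 : ℂ) 1).isPreconnected.subset_of_closure_inter_subset hopen
    ⟨g 0, hmaps zero_mem_domain, 0, zero_mem_domain, rfl⟩ ?_
  rintro ζ ⟨hζ, hζ1⟩
  have hζ1' : ‖ζ‖ < 1 := by simpa using hζ1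
  have hne : (comap g (𝓝 ζ) ⊓ 𝓟 W.domain).NeBot := by
    rw [← Filter.map_neBot_iff g, Filter.push_pull', map_principal]
    exact mem_closure_iff_clusterPt.1 hζ
  -- The image is open; to see that it is closed in the disc, an ultrafilter in the domain with g →
  -- ζ is taken. It converges to infinity, to the curve or inside the domain, and |ζ| < 1 excludes
  -- the first two.
  obtain ⟨𝒰, h𝒰⟩ := Ultrafilter.exists_le (comap g (𝓝 ζ) ⊓ 𝓟 W.domain)
  have hlim : Tendsto g 𝒰 (𝓝 ζ) := tendsto_iff_comap.2 (h𝒰.trans inf_le_left)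
  have hdom : ↑𝒰 ≤ 𝓟 W.domain := h𝒰.trans inf_le_right
  have hcontra : ∀ l : Filter ℂ, Tendsto (fun z => ‖g z‖) l (𝓝 1) → ¬ ↑𝒰 ≤ l := fun l hl hle => by
    have := tendsto_nhds_unique (hl.mono_left hle) hlim.norm
    linarith
  by_cases hco : ↑𝒰 ≤ cocompact ℂ
  · exact absurd (le_inf hco hdom) (hcontra _ hinf)
  · obtain ⟨K, hK, hK𝒰⟩ : ∃ K, IsCompact K ∧ K ∈ 𝒰 := by
      obtain ⟨s, hs, hs'⟩ := Filter.not_le.1 hco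
      obtain ⟨K, hK, hKs⟩ := mem_cocompact.1 hs
      refine ⟨K, hK, ?_⟩
      by_contra hcon
      exact hs' (mem_of_superset (Ultrafilter.compl_mem_iff_notMem.2 hcon) hKs)
    obtain ⟨y, -, hy⟩ := hK.ultrafilter_le_nhds 𝒰 (le_principal_iff.2 hK𝒰)
    have hycl : y ∈ closure W.domain := mem_closure_iff_ultrafilter.2
      ⟨𝒰, le_principal_iff.1 hdom, hy⟩
    rcases closure_domain_subset hycl with hyd | hyc
    · exact ⟨y, hyd, tendsto_nhds_unique ((hg y hyd).continuousAt.tendsto.mono_left hy) hlim⟩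
    · exact absurd (le_inf hy hdom) (hcontra _ (hcurve y hyc))

/-- If Y(x₁) is finite, the domain lies in the disc of squared radius c(x₁)/a(x₁), so infinity is
not a boundary point. -/
lemma cocompact_inf_domain_eq_bot (ha : 0 < W.a W.x₁) : cocompact ℂ ⊓ 𝓟 W.domain = ⊥ := by
  rw [← Metric.cobounded_eq_cocompact, inf_principal_eq_bot, ← Bornology.isBounded_def]
  refine isBounded_iff_forall_norm_le.2 ⟨Real.sqrt (W.c W.x₁ / W.a W.x₁), fun y hy => ?_⟩
  refine Real.le_sqrt_of_sq_le ?_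
  rw [le_div_iff₀ ha, ← Complex.normSq_eq_norm_sq]
  by_contra! hcon
  rw [domain_eq] at hy
  exact hy (Or.inl (by rw [mem_ofPred_eq]; linarith))

/-- The affine map which sends `u₁` and `u₂` to `-1` and `1`. -/
def rescale (W₁ W₂ z : ℂ) : ℂ := 2 / (W₂ - W₁) * (z - (W₁ + W₂) / 2)

section Rescale

variable {u₁ u₂ : ℝ} (hu : u₁ ≠ u₂)
include hu

lemma rescale_ofReal_mem {ρ : ℝ} (hρ : ρ ∈ uIcc u₁ u₂) :
    ∃ x : ℝ, |x| ≤ 1 ∧ rescale u₁ u₂ ρ = x := by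
  refine ⟨2 / (u₂ - u₁) * (ρ - (u₁ + u₂) / 2), ?_, by simp [rescale]⟩
  rw [abs_mul, abs_div, abs_two, div_mul_eq_mul_div,
    div_le_one (abs_pos.2 (sub_ne_zero.2 hu.symm))]
  rw [mem_uIcc] at hρ
  rcases hρ with h | h
  · rw [abs_of_nonneg (by linarith : 0 ≤ u₂ - u₁)]
    have : |ρ - (u₁ + u₂) / 2| ≤ (u₂ - u₁) / 2 := abs_le.2 ⟨by linarith, by linarith⟩
    linarith
  · rw [abs_of_nonpos (by linarith : u₂ - u₁ ≤ 0)]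
    have : |ρ - (u₁ + u₂) / 2| ≤ (u₁ - u₂) / 2 := abs_le.2 ⟨by linarith, by linarith⟩
    linarith

lemma rescale_injective : Function.Injective (rescale u₁ u₂) := by
  have h : (u₂ : ℂ) - u₁ ≠ 0 := sub_ne_zero.2 (by exact_mod_cast hu.symm)
  intro z z' hz
  have := mul_left_cancel₀ (div_ne_zero two_ne_zero h) hz
  simpa using this

lemma exists_of_rescale_mem {z : ℂ} (hz : rescale u₁ u₂ z ∈ unitSegment) :
    ∃ ρ ∈ uIcc u₁ u₂, z = (ρ : ℝ) := by
  obtain ⟨x, hx, hzx⟩ := hz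
  have h : (u₂ : ℂ) - u₁ ≠ 0 := sub_ne_zero.2 (by exact_mod_cast hu.symm)
  obtain ⟨hx1, hx2⟩ := abs_le.1 hx
  refine ⟨(u₁ + u₂) / 2 + x * (u₂ - u₁) / 2, ?_, ?_⟩
  · rw [mem_uIcc]
    rcases le_total u₁ u₂ with h | h
    · left; constructor <;> nlinarith
    · right; constructor <;> nlinarith
  · refine rescale_injective hu (hzx.trans ?_)
    rw [rescale]
    push_cast
    field_simp
    ring

lemma tendsto_rescale_cobounded :
    Tendsto (rescale u₁ u₂) (Bornology.cobounded ℂ) (Bornology.cobounded ℂ) := by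
  have h : (u₂ : ℂ) - u₁ ≠ 0 := sub_ne_zero.2 (by exact_mod_cast hu.symm)
  exact (tendsto_mul_left_cobounded (div_ne_zero two_ne_zero h)).comp
    (tendsto_sub_const_cobounded _)

end Rescale

lemma continuous_rescale (W₁ W₂ : ℂ) : Continuous (rescale W₁ W₂) := by
  unfold rescale; fun_prop

lemma rescale_conj (u₁ u₂ : ℝ) (z : ℂ) :
    rescale u₁ u₂ (starRingEnd ℂ z) = starRingEnd ℂ (rescale u₁ u₂ z) := by
  simp [rescale, Complex.conj_ofNat]

lemma glued_of_notMem {w : ℂ → ℂ} {W₁ W₂ y : ℂ} (hy : y ∉ W.poles w) :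
    W.glued w W₁ W₂ y = hMap (rescale W₁ W₂ (w y)) := if_neg hy

lemma glued_of_mem {w : ℂ → ℂ} {W₁ W₂ y : ℂ} (hy : y ∈ W.poles w) : W.glued w W₁ W₂ y = 0 :=
  if_pos hy

namespace IsGluing

variable {w : ℂ → ℂ} (h : W.IsGluing w) {W₁ W₂ : ℂ}
  (h₁ : Tendsto w (W.nhdsBranch W.x₁) (𝓝 W₁)) (h₂ : Tendsto w (W.nhdsBranch W.x₂) (𝓝 W₂))
include h

-- The image of w is open, so its complement is closed; it contains the boundary values for x in
-- (x₁, x₂] and therefore the limit at x₁, even when Y(x₁) = ∞.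
include h₁ in
lemma ne_boundaryValue {p : ℂ} (hp : p ∈ W.domain \ W.poles w) {x : ℝ} (hx : x ∈ Icc W.x₁ W.x₂) :
    w p ≠ W.boundaryValue w W₁ x := by
  have hopen : IsOpen (w '' (W.domain \ W.poles w)) := by
    rw [isOpen_iff_mem_nhds]
    rintro _ ⟨y, hy, rfl⟩
    rw [← h.map_nhds hy]
    exact image_mem_map (h.isOpen_diff.mem_nhds hy)
  have hcl : x ∈ closure (Ioc W.x₁ W.x₂) := by
    rwa [closure_Ioc W.x₁_lt_x₂.ne]
  have hmaps : MapsTo (W.boundaryValue w W₁) (Ioc W.x₁ W.x₂) (w '' (W.domain \ W.poles w))ᶜ := by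
    rintro x' hx' ⟨q, hq, hqx⟩
    obtain ⟨h3, h4⟩ := boundaryValue_of_mem_Ioc (w := w) (W₁ := W₁) hx'
    exact h.ne_extendFrom hq h3 (hqx.trans h4)
  have := ((h.continuousOn_boundaryValue h₁ x hx).mono Ioc_subset_Icc_self).mem_closure hcl hmaps
  rw [hopen.isClosed_compl.closure_eq] at this
  exact fun heq => this ⟨p, hp, heq⟩

include h₁ h₂ in
/-- The conformal map onto the disc obtained from a gluing function. -/
theorem isConformal : W₁ ≠ W₂ ∧ AnalyticOnNhd ℂ (W.glued w W₁ W₂) W.domain ∧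
    BijOn (W.glued w W₁ W₂) W.domain (Metric.ball 0 1) ∧
    ∀ y ∈ W.domain, W.glued w W₁ W₂ (starRingEnd ℂ y) =
      starRingEnd ℂ (W.glued w W₁ W₂ y) := by
  obtain ⟨u₁, u₂, rfl, rfl, hu, hcurve, hseg⟩ := h.exists_segment h₁ h₂
  set g := W.glued w u₁ u₂ with hgdef
  have hnot : ∀ y ∈ W.domain \ W.poles w, rescale u₁ u₂ (w y) ∉ unitSegment := fun y hy hmem => by
    obtain ⟨ρ, hρ, hyρ⟩ := exists_of_rescale_mem hu hmem
    obtain ⟨x, hx, hxρ⟩ := hseg ρ hρ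
    exact h.ne_boundaryValue h₁ hy hx (hyρ.trans hxρ.symm)
  have hev : ∀ y ∈ W.domain \ W.poles w, g =ᶠ[𝓝 y] fun z => hMap (rescale u₁ u₂ (w z)) :=
    fun y hy => by
      filter_upwards [h.isOpen_diff.mem_nhds hy] with z hz using glued_of_notMem hz.2
  have han : ∀ y ∈ W.domain \ W.poles w, AnalyticAt ℂ g y := fun y hy => by
    refine AnalyticAt.congr ?_ (hev y hy).symm
    have hr : AnalyticAt ℂ (fun z => rescale u₁ u₂ (w z)) y :=
      analyticAt_const.mul ((h.analytic y hy).sub analyticAt_const)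
    exact AnalyticAt.fun_comp (analyticAt_hMap (hnot y hy)) hr
  have hanal : AnalyticOnNhd ℂ g W.domain := fun y hy => by
    -- At the pole, w → ∞ and hence h → 0: the singularity is removable, with the prescribed value
    -- 0.
    by_cases hp : y ∈ W.poles w
    · have hsub : ∀ z, z ≠ y → z ∉ W.poles w := fun z hz hz' =>
        hz (h.poles_subsingleton hz' hp)
      refine Complex.analyticAt_of_differentiable_on_punctured_nhds_of_continuousAt ?_ ?_
      · filter_upwards [nhdsWithin_le_nhds (isOpen_domain.mem_nhds hy), self_mem_nhdsWithin]
          with z hz hz'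
        exact (han z ⟨hz, hsub z hz'⟩).differentiableAt
      · rw [continuousAt_iff_punctured_nhds]
        have h3 := (tendsto_hMap_cobounded.comp (tendsto_rescale_cobounded hu)).comp
          (tendsto_cobounded_of_meromorphicOrderAt_neg hp.2)
        rw [hgdef, glued_of_mem hp]
        refine h3.congr' ?_
        filter_upwards [self_mem_nhdsWithin] with z hz
        exact (glued_of_notMem (hsub z hz)).symm
    · exact han y ⟨hy, hp⟩
  have hinj : InjOn g W.domain := by
    intro y hy z hz hyz
    by_cases hyp : y ∈ W.poles w <;> by_cases hzp : z ∈ W.poles w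
    · exact h.poles_subsingleton hyp hzp
    · rw [hgdef, glued_of_mem hyp, glued_of_notMem hzp] at hyz
      exact absurd hyz.symm
        (hMap_ne_zero (ne_zero_of_notMem_unitSegment (hnot z ⟨hz, hzp⟩)))
    · rw [hgdef, glued_of_mem hzp, glued_of_notMem hyp] at hyz
      exact absurd hyz (hMap_ne_zero (ne_zero_of_notMem_unitSegment (hnot y ⟨hy, hyp⟩)))
    · rw [hgdef, glued_of_notMem hyp, glued_of_notMem hzp] at hyz
      exact h.injOn ⟨hy, hyp⟩ ⟨hz, hzp⟩ (rescale_injective hu (hMap_injOn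
        (ne_zero_of_notMem_unitSegment (hnot y ⟨hy, hyp⟩))
        (ne_zero_of_notMem_unitSegment (hnot z ⟨hz, hzp⟩)) hyz))
  have hmaps : MapsTo g W.domain (Metric.ball 0 1) := by
    intro y hy
    rw [mem_ball_zero_iff]
    by_cases hyp : y ∈ W.poles w
    · rw [hgdef, glued_of_mem hyp, norm_zero]
      exact one_pos
    · rw [hgdef, glued_of_notMem hyp]
      exact norm_hMap_lt_one (hnot y ⟨hy, hyp⟩)
  have hbdry : ∀ (l : Filter ℂ) (ρ : ℝ), ρ ∈ uIcc u₁ u₂ → W.domain \ W.poles w ∈ l →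
      Tendsto w l (𝓝 (ρ : ℂ)) → Tendsto (fun z => ‖g z‖) l (𝓝 1) := by
    intro l ρ hρ hl hw
    obtain ⟨x, hx, hxρ⟩ := rescale_ofReal_mem hu hρ
    have h3 : Tendsto (fun z => rescale u₁ u₂ (w z)) l (𝓝[unitSegmentᶜ] (x : ℂ)) := by
      refine tendsto_nhdsWithin_iff.2 ⟨?_, ?_⟩
      · rw [← hxρ]
        exact ((continuous_rescale _ _).tendsto _).comp hw
      · filter_upwards [hl] with z hz using hnot z hz
    refine ((tendsto_norm_hMap hx).comp h3).congr' ?_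
    filter_upwards [hl] with z hz
    rw [Function.comp, hgdef, glued_of_notMem hz.2]
  have hsurj : SurjOn g W.domain (Metric.ball 0 1) := by
    refine surjOn_ball hanal hinj hmaps (fun y hy => ?_) ?_
    · obtain ⟨ρ, hρ, hyρ⟩ := hcurve y hy
      have h3 := h.tendsto_extendFrom hy
      rw [hyρ] at h3
      exact hbdry _ ρ hρ (h.eventually_notMem_poles hy) h3
    · by_cases ha : W.a W.x₁ = 0
      · rw [nhdsBranch, if_pos ha] at h₁
        refine hbdry _ u₁ left_mem_uIcc ?_ h₁
        refine sdiff_mem (mem_inf_of_right (mem_principal_self _)) (mem_inf_of_left ?_)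
        exact h.poles_subsingleton.finite.isCompact.compl_mem_cocompact
      · rw [cocompact_inf_domain_eq_bot
          (lt_of_le_of_ne (a_nonneg W.x₁_nonneg) (Ne.symm ha))]
        exact tendsto_bot
  refine ⟨by exact_mod_cast hu, hanal, ⟨hmaps, hinj, hsurj⟩, ?_⟩
  have hanal' : AnalyticOnNhd ℂ (starRingEnd ℂ ∘ g ∘ starRingEnd ℂ) W.domain := by
    refine DifferentiableOn.analyticOnNhd (fun z hz => ?_) isOpen_domain
    have := (hanal _ (conj_mem_domain hz)).differentiableAt.conj_conj
    rw [Complex.conj_conj] at this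
    exact this.differentiableWithinAt
  have hy₀ : W.upperPoint W.x₂ ∈ W.curve := upperPoint_mem_curve right_mem (W.a_pos W.x₂_pos)
  have hctend : Tendsto (starRingEnd ℂ) (𝓝[W.domain] (W.upperPoint W.x₂))
      (𝓝[W.domain] (starRingEnd ℂ (W.upperPoint W.x₂))) := by
    simpa using tendsto_conj_domain (W := W) (starRingEnd ℂ (W.upperPoint W.x₂))
  -- The symmetry of w is known only near the curve, and this is enough: the identity theorem on the
  -- connected domain spreads it from Y(x₂), which is always finite.
  have hloc : ∀ᶠ y in 𝓝[W.domain] (W.upperPoint W.x₂),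
      g y = (starRingEnd ℂ ∘ g ∘ starRingEnd ℂ) y := by
    filter_upwards [h.eventually_conj hy₀, h.eventually_notMem_poles hy₀,
      hctend.eventually (h.eventually_notMem_poles (conj_mem_curve hy₀))] with y h3 h4 h5
    simp only [Function.comp, hgdef]
    rw [glued_of_notMem h4.2, glued_of_notMem h5.2, h3, rescale_conj, hMap_conj (hnot y h4),
      Complex.conj_conj]
  have := neBot_of_mem_curve hy₀
  obtain ⟨y, hy, hyd⟩ := ((eventually_eventually_nhdsWithin.2 hloc).and
    self_mem_nhdsWithin).exists
  rw [isOpen_domain.nhdsWithin_eq hyd] at hy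
  have heq := hanal.eqOn_of_preconnected_of_eventuallyEq hanal' isPreconnected_domain hyd hy
  intro z hz
  have := heq (conj_mem_domain hz)
  simpa using this

end IsGluing
end Weights

/-! ### Reduction of step sets to weights -/

/-- The multiplicity of a step in a step set. -/
def stepCount (H : Finset (ℤ × ℤ)) (s : ℤ × ℤ) : ℕ := if s ∈ H then 1 else 0

lemma stepCount_of_mem {H : Finset (ℤ × ℤ)} {s : ℤ × ℤ} (h : s ∈ H) : stepCount H s = 1 :=
  if_pos h

section Reduction

variable {H : Finset (ℤ × ℤ)} (hH : IsAdmissible H)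
include hH

lemma IsAdmissible.mem_cases {s : ℤ × ℤ} (hs : s ∈ H) : s = (1, 1) ∨ s = (-1, -1) ∨ s = (1, 0) ∨
    s = (0, 1) ∨ s = (-1, 0) ∨ s = (0, -1) := by
  obtain ⟨i, j⟩ := s
  obtain ⟨h1, h2⟩ := hH.small _ hs
  have h3 := hH.ne_zero
  have h4 := hH.no_antidiag
  simp only [abs_le] at h1 h2
  obtain ⟨h1, h1'⟩ := h1
  obtain ⟨h2, h2'⟩ := h2
  interval_cases i <;> interval_cases j <;> simp_all

lemma IsAdmissible.stepCount_swap (i j : ℤ) : stepCount H (i, j) = stepCount H (j, i) := by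
  have : (i, j) ∈ H ↔ (j, i) ∈ H := ⟨hH.symm i j, hH.symm j i⟩
  simp only [stepCount, this]

/-- Only six steps are possible and symmetry pairs four of them, so four multiplicities determine
the kernel, its coefficients and the cardinality. -/
lemma IsAdmissible.sum_transform {R : Type*} [CommSemiring R] (f : ℤ × ℤ → R) :
    ∑ s ∈ transform H, f s = stepCount H (1, 1) * f (0, 1) + stepCount H (-1, -1) * f (0, -1) +
      stepCount H (1, 0) * (f (1, 1) + f (-1, 0)) +
      stepCount H (-1, 0) * (f (-1, -1) + f (1, 0)) := by
  rw [transform, Finset.sum_image (by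
    rintro ⟨a, b⟩ - ⟨c, d⟩ - h
    simp only [Prod.mk.injEq] at h ⊢
    omega)]
  have hsub : H ⊆ {(1, 1), (-1, -1), (1, 0), (0, 1), (-1, 0), (0, -1)} := fun s hs => by
    simpa using hH.mem_cases hs
  have hcount : ∀ g : ℤ × ℤ → R, ∑ s ∈ H, g s =
      ∑ s ∈ {(1, 1), (-1, -1), (1, 0), (0, 1), (-1, 0), (0, -1)}, stepCount H s * g s := by
    intro g
    rw [← Finset.sum_subset hsub fun s _ hs => by simp [stepCount, hs]]
    exact Finset.sum_congr rfl fun s hs => by rw [stepCount_of_mem hs, Nat.cast_one, one_mul]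
  rw [hcount, Finset.sum_insert (by decide), Finset.sum_insert (by decide),
    Finset.sum_insert (by decide), Finset.sum_insert (by decide), Finset.sum_insert (by decide),
    Finset.sum_singleton, hH.stepCount_swap 0 1, hH.stepCount_swap 0 (-1)]
  norm_num
  ring

/-- The half-planes bounded by the antidiagonal give the first two inequalities, one bounded by the
diagonal gives the third. -/
lemma IsAdmissible.stepCount_pos_of_nondegenerate :
    0 < stepCount H (1, 1) + stepCount H (1, 0) ∧ 0 < stepCount H (-1, -1) + stepCount H (-1, 0) ∧
      0 < stepCount H (1, 0) + stepCount H (-1, 0) := by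
  have h1 := hH.stepCount_swap 0 1
  have h2 := hH.stepCount_swap 0 (-1)
  refine ⟨?_, ?_, ?_⟩
  · obtain ⟨s, hs, h⟩ := hH.nondegenerate (-1) (-1) (by simp)
    have := stepCount_of_mem hs
    rcases hH.mem_cases hs with rfl | rfl | rfl | rfl | rfl | rfl <;> norm_num at h <;> omega
  · obtain ⟨s, hs, h⟩ := hH.nondegenerate 1 1 (by simp)
    have := stepCount_of_mem hs
    rcases hH.mem_cases hs with rfl | rfl | rfl | rfl | rfl | rfl <;> norm_num at h <;> omega
  · obtain ⟨s, hs, h⟩ := hH.nondegenerate 1 (-1) (by simp)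
    have := stepCount_of_mem hs
    rcases hH.mem_cases hs with rfl | rfl | rfl | rfl | rfl | rfl <;> norm_num at h <;> omega

/-- The weights of an admissible step set. -/
def IsAdmissible.weights {t : ℝ} (ht₀ : 0 < t) (ht₁ : t < 1 / ((transform H).card : ℝ)) :
    Weights where
  A := t * stepCount H (1, 1)
  B := t * stepCount H (-1, -1)
  C := t * stepCount H (1, 0)
  E := t * stepCount H (-1, 0)
  A_nonneg := by positivity
  B_nonneg := by positivity
  C_nonneg := by positivity
  E_nonneg := by positivity
  AC_pos := by
    rw [← mul_add]
    exact mul_pos ht₀ (by exact_mod_cast hH.stepCount_pos_of_nondegenerate.1)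
  BE_pos := by
    rw [← mul_add]
    exact mul_pos ht₀ (by exact_mod_cast hH.stepCount_pos_of_nondegenerate.2.1)
  CE_pos := by
    rw [← mul_add]
    exact mul_pos ht₀ (by exact_mod_cast hH.stepCount_pos_of_nondegenerate.2.2)
  total_lt := by
    have hpos : (0 : ℝ) < (transform H).card := one_div_pos.1 (ht₀.trans ht₁)
    rw [lt_div_iff₀ hpos] at ht₁
    -- The weights with multiplicities add up to t·|S|.
    refine lt_of_eq_of_lt ?_ ht₁
    rw [Finset.card_eq_sum_ones, Nat.cast_sum, hH.sum_transform]
    push_cast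
    ring

variable {t : ℝ} (ht₀ : 0 < t) (ht₁ : t < 1 / ((transform H).card : ℝ))

lemma IsAdmissible.kernel_eq (x y : ℂ) :
    kernel (transform H) t x y = (hH.weights ht₀ ht₁).K x y := by
  rw [kernel, hH.sum_transform]
  simp only [Weights.K, IsAdmissible.weights]
  push_cast
  norm_num
  ring

lemma IsAdmissible.coeffInX_eval (x : ℝ) :
    (coeffInX (transform H) t 1).eval x = (hH.weights ht₀ ht₁).a x ∧
    (coeffInX (transform H) t 0).eval x = (hH.weights ht₀ ht₁).b x ∧
    (coeffInX (transform H) t (-1)).eval x = (hH.weights ht₀ ht₁).c x := by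
  have h2 : Int.toNat 2 = 2 := rfl
  refine ⟨?_, ?_, ?_⟩ <;> rw [coeffInX, Finset.sum_filter, hH.sum_transform] <;>
    simp only [Weights.a, Weights.b, Weights.c, IsAdmissible.weights] <;>
    norm_num [h2] <;> ring

lemma IsAdmissible.discX_eval (x : ℝ) :
    (discX (transform H) t).eval x = (hH.weights ht₀ ht₁).d x := by
  obtain ⟨h1, h2, h3⟩ := hH.coeffInX_eval ht₀ ht₁ x
  simp [discX, Weights.d, h1, h2, h3]

lemma IsAdmissible.discY_aeval (y : ℂ) :
    aeval y (discY (transform H) t) = (hH.weights ht₀ ht₁).dYc y := by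
  simp only [discY, coeffInY, Finset.sum_filter, hH.sum_transform, Weights.dYc,
    IsAdmissible.weights]
  push_cast
  have h4 : aeval y (4 : ℝ[X]) = 4 := map_ofNat _ 4
  norm_num [h4]
  ring

lemma IsAdmissible.discY_eval (y : ℝ) :
    (discY (transform H) t).eval y = (hH.weights ht₀ ht₁).dY y := by
  have h := hH.discY_aeval ht₀ ht₁ y
  rw [Weights.dYc_ofReal, ← Complex.coe_algebraMap, aeval_algebraMap_apply_eq_algebraMap_eval] at h
  exact_mod_cast h

lemma IsAdmissible.branch₁_discX :
    branch₁ (discX (transform H) t) = (hH.weights ht₀ ht₁).x₁ := by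
  simp only [branch₁, Weights.x₁, IsRoot.def, hH.discX_eval ht₀ ht₁]

lemma IsAdmissible.branch₂_discX :
    branch₂ (discX (transform H) t) = (hH.weights ht₀ ht₁).x₂ := by
  simp only [branch₂, Weights.x₂, IsRoot.def, hH.discX_eval ht₀ ht₁]

lemma IsAdmissible.curve_eq : curve (transform H) t = (hH.weights ht₀ ht₁).curve := by
  simp only [curve, Weights.curve, hH.branch₁_discX ht₀ ht₁, hH.branch₂_discX ht₀ ht₁,
    hH.kernel_eq ht₀ ht₁]

lemma IsAdmissible.domain_eq : domain (transform H) t = (hH.weights ht₀ ht₁).domain := by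
  simp only [domain, Weights.domain, hH.curve_eq ht₀ ht₁]

lemma IsAdmissible.cuts_eq : cuts (transform H) t = (hH.weights ht₀ ht₁).cuts := by
  simp only [cuts, Weights.cuts, hH.discY_eval ht₀ ht₁]

lemma IsAdmissible.nhdsBranchValue_eq (x : ℝ) :
    nhdsBranchValue (transform H) t x = (hH.weights ht₀ ht₁).nhdsBranch x := by
  obtain ⟨h1, h2, -⟩ := hH.coeffInX_eval ht₀ ht₁ x
  simp only [nhdsBranchValue, branchValue, Weights.nhdsBranch, h1, h2, hH.domain_eq ht₀ ht₁]

lemma IsAdmissible.poles_eq (w : ℂ → ℂ) :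
    poles (transform H) t w = (hH.weights ht₀ ht₁).poles w := by
  simp only [poles, Weights.poles, hH.domain_eq ht₀ ht₁]

lemma IsAdmissible.gluedMap_eq (w : ℂ → ℂ) (W₁ W₂ : ℂ) :
    gluedMap (transform H) t w W₁ W₂ = (hH.weights ht₀ ht₁).glued w W₁ W₂ := by
  funext y
  unfold gluedMap Weights.glued
  rw [hH.poles_eq ht₀ ht₁]

-- The discriminant is positive on a whole neighbourhood of 1, which keeps the supremum and the
-- infimum of the roots strictly away from 1; this gives an interval around 1 on which any
-- admissible square root is real.
include ht₀ ht₁ in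
lemma IsAdmissible.branch₂_discY_lt_one : branch₂ (discY (transform H) t) < 1 ∧
    1 < branch₃ (discY (transform H) t) := by
  set W := hH.weights ht₀ ht₁
  obtain ⟨-, η₂, η₃, h2, h2', h3, h3', -⟩ := W.exists_sqrt_dYc
  simp only [branch₂, branch₃, IsRoot.def, hH.discY_eval ht₀ ht₁]
  have hpos := W.continuous_dY.continuousAt.eventually (lt_mem_nhds W.dY_one_pos)
  obtain ⟨δ, hδ, hball⟩ := Metric.eventually_nhds_iff.1 hpos
  simp only [Real.dist_eq] at hball
  constructor
  · refine lt_of_le_of_lt (csSup_le ⟨η₂, h2, h2'⟩ (a := 1 - δ) ?_) (by linarith)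
    rintro x ⟨hx, hx'⟩
    by_contra! hlt
    have := hball (y := x) (by rw [abs_lt] at hx ⊢; constructor <;> linarith)
    linarith
  · refine lt_of_lt_of_le (by linarith) (le_csInf ⟨η₃, h3, h3'⟩ (a := 1 + δ) ?_)
    rintro x ⟨hx, hx'⟩
    by_contra! hlt
    have := hball (y := x) (by rw [abs_lt]; constructor <;> linarith)
    linarith

include ht₀ ht₁ in
lemma IsAdmissible.exists_isSqrtDiscY : ∃ r, IsSqrtDiscY (transform H) t r := by
  set W := hH.weights ht₀ ht₁
  obtain ⟨r, η₂, η₃, h2, h2', h3, h3', hr, hsq, hpos⟩ := W.exists_sqrt_dYc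
  refine ⟨r, ?_, ?_, ?_⟩
  · rwa [hH.cuts_eq ht₀ ht₁]
  · intro y hy
    rw [hH.cuts_eq ht₀ ht₁] at hy
    rw [hsq y hy, hH.discY_aeval ht₀ ht₁]
  · intro y hy hy'
    -- The roots η₂ and η₃ need not be identified with the branch points: η₂ ≤ y₂ and y₃ ≤ η₃
    -- suffice.
    obtain ⟨v, hv, hv'⟩ := hpos y
      (lt_of_le_of_lt (le_csSup (s := {x : ℝ | |x| < 1 ∧ IsRoot _ x})
        ⟨1, fun x hx => (abs_lt.1 hx.1).2.le⟩ ⟨h2, by rw [IsRoot.def, hH.discY_eval ht₀ ht₁, h2']⟩) hy)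
      (lt_of_lt_of_le hy' (csInf_le (s := {x : ℝ | 1 < x ∧ IsRoot _ x})
        ⟨1, fun x hx => hx.1.le⟩ ⟨h3, by rw [IsRoot.def, hH.discY_eval ht₀ ht₁, h3']⟩))
    rw [hv']
    exact ⟨hv, Complex.ofReal_im v⟩

end Reduction

end ThreeQuadrant
end
open ThreeQuadrant

theorem theorem3p5 (H S : Finset (ℤ × ℤ)) (hH : IsAdmissible H) (hS : S = transform H)
    (t : ℝ) (ht₀ : 0 < t) (ht₁ : t < 1 / (S.card : ℝ)) :
    -- the square root in the decoupling condition exists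
    (∃ r : ℂ → ℂ, IsSqrtDiscY S t r) ∧
    -- `f = g / g'` for an arbitrary conformal mapping `g`; `F` is the boundary value of `f`
    (∀ g : ℂ → ℂ, IsSymmConformal S t g →
      (∀ y ∈ domain S t, deriv g y ≠ 0) ∧
      AnalyticOnNhd ℂ (fun y => g y / deriv g y) (domain S t) ∧
      ∃ F : ℂ → ℂ,
        (∀ y ∈ curve S t, y ∈ closure (domain S t) ∧
          Tendsto (fun y => g y / deriv g y) (𝓝[domain S t] y) (𝓝 (F y)) ∧ F y ≠ 0) ∧
        ∀ r : ℂ → ℂ, IsSqrtDiscY S t r → ∀ y ∈ curve S t,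
          y ∉ cuts S t ∧ starRingEnd ℂ y ∈ curve S t ∧ r y ≠ 0 ∧
          r (starRingEnd ℂ y) / r y = F (starRingEnd ℂ y) / F y) ∧
    -- the explicit choice of `g`; `W₁ = w(Y(x₁))`, `W₂ = w(Y(x₂))`
    (∀ (w : ℂ → ℂ) (W₁ W₂ : ℂ), IsConformalGluing S t w →
      (∀ y ∈ curve S t, ∃ u : ℝ, Tendsto w (𝓝[domain S t] y) (𝓝 (u : ℂ))) →
      Tendsto w (nhdsBranchValue S t (branch₁ (discX S t))) (𝓝 W₁) →
      Tendsto w (nhdsBranchValue S t (branch₂ (discX S t))) (𝓝 W₂) →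
      W₁ ≠ W₂ ∧ IsSymmConformal S t (gluedMap S t w W₁ W₂)) := by
  subst hS
  set W := hH.weights ht₀ ht₁ with hW
  have hdom : domain (transform H) t = W.domain := hH.domain_eq ht₀ ht₁
  have hcurve : curve (transform H) t = W.curve := hH.curve_eq ht₀ ht₁
  have hcuts : cuts (transform H) t = W.cuts := hH.cuts_eq ht₀ ht₁
  refine ⟨hH.exists_isSqrtDiscY ht₀ ht₁, fun g hg => ?_, fun w W₁ W₂ hw hreal h₁ h₂ => ?_⟩
  · obtain ⟨hga, hgb, hgc⟩ := hg
    rw [hdom] at hga hgb hgc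
    rw [hdom, hcurve, hcuts]
    have hne : ∀ y ∈ W.domain, deriv g y ≠ 0 := fun y hy =>
      deriv_ne_zero_of_injOn (hga y hy) (Weights.isOpen_domain.mem_nhds hy) hgb.injOn
    obtain ⟨F, hF, hFratio⟩ := Weights.exists_boundary_values hga hgb hgc
    refine ⟨hne, fun y hy => (hga y hy).div (hga y hy).deriv (hne y hy), F,
      fun y hy => ⟨Weights.mem_closure_domain hy, hF y hy⟩, ?_⟩
    rintro r hr y ⟨x, hx, hK⟩
    obtain ⟨hra, hrs, hrp⟩ := hr
    rw [hcuts] at hra hrs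
    obtain ⟨hb₂, hb₃⟩ := hH.branch₂_discY_lt_one ht₀ ht₁
    have hreal : ∀ᶠ u : ℝ in 𝓝 1, (r u).im = 0 := by
      filter_upwards [Ioo_mem_nhds hb₂ hb₃] with u hu using (hrp u hu.1 hu.2).2
    obtain ⟨h1, h2⟩ := Weights.sqrt_ratio hra
      (fun y hy => by rw [hrs y hy, hH.discY_aeval ht₀ ht₁]) hreal hx hK
    exact ⟨Weights.notMem_cuts_of_mem_curve ⟨x, hx, hK⟩, Weights.conj_mem_curve ⟨x, hx, hK⟩, h1,
      by rw [h2, hFratio x hx y hK]⟩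
  · obtain ⟨-, han, hps, hinj, hglue⟩ := hw
    have hpoles : poles (transform H) t w = W.poles w := hH.poles_eq ht₀ ht₁ w
    rw [hdom, hpoles] at han hinj
    rw [hpoles] at hps
    rw [hdom, hcurve] at hglue hreal
    rw [hH.branch₁_discX ht₀ ht₁, hH.nhdsBranchValue_eq ht₀ ht₁] at h₁
    rw [hH.branch₂_discX ht₀ ht₁, hH.nhdsBranchValue_eq ht₀ ht₁] at h₂
    -- The real limit and the glued limit agree by uniqueness, as the domain accumulates at every
    -- point of the curve.
    have hW : W.IsGluing w := by
      refine ⟨han, hps, hinj, fun y hy => ?_⟩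
      obtain ⟨u, hu⟩ := hreal y hy
      obtain ⟨v, hv, hv'⟩ := hglue y hy
      have := Weights.neBot_of_mem_curve hy
      rw [tendsto_nhds_unique hv hu] at hv'
      exact ⟨u, hu, hv'⟩
    obtain ⟨hne, h3, h4, h5⟩ := hW.isConformal h₁ h₂
    rw [← hH.gluedMap_eq ht₀ ht₁, ← hdom] at h3 h4 h5
    exact ⟨hne, h3, h4, h5⟩
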